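/- Throughout, the Fourier transform is normalised by $F(x)=\frac{1}{\sqrt{2\pi}}\int_{-\infty}^{\infty}f(t)e^{ixt}\,dt$ (in the $L_2$ sense on $\mathbb R$; by the same formula at complex points $z$ where the integral converges absolutely). Let $\{\!\{0\}\!\}$ be the set of square-integrable Hölder continuous functions $\mathbb R\to\mathbb C$, and let $\{0\}$ be its pre-image under the Fourier transform. For $c\in\mathbb R$ write $f\in\{c\}$ if $e^{-ct}f(t)\in\{0\}$. For real $a<b$ write $f\in\{a,b\}$ if $f\cdot 1_{(0,\infty)}\in\{a\}$ and $f\cdot 1_{(-\infty,0)}\in\{b\}$; write $f\in\{a,\infty\}$ if $f\in\{a\}$ and $f=0$ on $(-\infty,0)$, and $f\in\{-\infty,b\}$ if $f\in\{b\}$ and $f=0$ on $(0,\infty)$. Let $\{\!\{a,b\}\!\}$, $\{\!\{a,\infty\}\!\}$, $\{\!\{-\infty,b\}\!\}$ be the sets of Fourier transforms of these classes, as functions on $a<\operatorname{Im}z<b$, $\operatorname{Im}z>a$ and $\operatorname{Im}z<b$ respectively. The index of a continuous function $\varphi:\mathbb R\to\mathbb C\setminus\{0\}$ is $\frac1{2\pi}\big(\lim_{t\to+\infty}\arg\varphi(t)-\lim_{t\to-\infty}\arg\varphi(t)\big)$,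 with $\arg\varphi$ continuous. **Theorem (Wiener–Hopf factorisation).** Let $a<b$ be real and let $K$ be zero-free on the strip $S=\{a<\operatorname{Im}z<b\}$, with $K-1\in\{\!\{a,b\}\!\}$. Denote by $K(x+ia)$ the continuous boundary values of $K$ on $\operatorname{Im}z=a$, and suppose that $x\mapsto K(x+ia)$ has no zeros and has index $0$. Then there is an analytic branch $L=\ln K$ on $S$ with $L(x+is)\to0$ as $|x|\to\infty$ for every $a<s<b$, and it has an inverse Fourier transform $\kappa$, that is, a function with $$\kappa(t)=\frac1{\sqrt{2\pi}}\int_{\operatorname{Im}z=s}\ln K(z)\,e^{-izt}\,dz\qquad(a<s<b)$$ in the sense that $e^{-st}\kappa(t)$ is the $L_2$ inverse Fourier transform of $x\mapsto L(x+is)$ for every $a<s<b$. For every such $L$ and $\kappa$, the integrals in $$K^+(z)=\exp\Big(\frac1{\sqrt{2\pi}}\int_0^\infty\kappa(t)e^{izt}\,dt\Big),\qquad K^-(z)=\exp\Big(\frac1{\sqrt{2\pi}}\int_{-\infty}^0\kappa(t)e^{izt}\,dt\Big)$$ converge absolutely for $\operatorname{Im}z>a$ and for $\operatorname{Im}z<b$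 respectively; $K^+$ is analytic on $\operatorname{Im}z>a$ with $K^+-1\in\{\!\{a,\infty\}\!\}$; $K^-$ is analytic on $\operatorname{Im}z<b$ with $K^--1\in\{\!\{-\infty,b\}\!\}$; and $K(z)=K^+(z)K^-(z)$ on $S$. Moreover $(K^+,K^-)$ is the only pair with these properties (analyticity, classes, factorisation) whose members are zero-free on $\operatorname{Im}z>a$ and on $\operatorname{Im}z<b$ respectively. -/

import Mathlib

noncomputable section

open MeasureTheory Filter Topology
open scoped FourierTransform

namespace WienerHopf

/-- `F` is the (L²) Fourier transform of `f`, equivalently `f` is the inverse Fourier transform of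
`F`, with the normalisation `F x = (2π)^(-1/2) ∫ f t e^{ixt} dt`. Mathlib's `L²` transform `𝓕⁻ f` is
`y ↦ ∫ f t e^{2πiyt} dt`, hence the rescaling `y = x / (2π)`. -/
def IsFourierL2 (f F : ℝ → ℂ) : Prop :=
  ∃ hf : MemLp f 2 volume,
    F =ᵐ[volume] fun x : ℝ =>
      ((Real.sqrt (2 * Real.pi) : ℝ) : ℂ)⁻¹ *
        (𝓕⁻ (hf.toLp f) : Lp ℂ 2 (volume : Measure ℝ)) (x / (2 * Real.pi))

/-- The class `{{0}}`: square integrable Hölder continuous functions on the real line. -/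
def ImageClass (F : ℝ → ℂ) : Prop :=
  MemLp F 2 volume ∧ ∃ C r : NNReal, 0 < r ∧ r ≤ 1 ∧ HolderWith C r F

/-- The class `{0}`: the pre-image of `{{0}}` under the Fourier transform. -/
def OrigClass (f : ℝ → ℂ) : Prop :=
  ∃ F : ℝ → ℂ, ImageClass F ∧ IsFourierL2 f F

/-- The function `t ↦ e^{-at} f t`. -/
def expShift (a : ℝ) (f : ℝ → ℂ) : ℝ → ℂ :=
  fun t => (Real.exp (-(a * t)) : ℂ) * f t

/-- The class `{a}`: those `f` with `e^{-at} f ∈ {0}`. -/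
def OrigClassAt (a : ℝ) (f : ℝ → ℂ) : Prop :=
  OrigClass (expShift a f)

/-- The restriction `f₊` of `f` to the positive half-line. -/
def plusPart (f : ℝ → ℂ) : ℝ → ℂ := fun t => if 0 < t then f t else 0

/-- Minus the restriction of `f` to the negative half-line. -/
def minusPart (f : ℝ → ℂ) : ℝ → ℂ := fun t => if t < 0 then -f t else 0

/-- The class `{a, b}`: `f₊ ∈ {a}` and `f₋ ∈ {b}`. -/
def OrigStripClass (a b : ℝ) (f : ℝ → ℂ) : Prop :=
  OrigClassAt a (plusPart f) ∧ OrigClassAt b (minusPart f)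

/-- The class `{a, ∞}`: functions of class `{a}` carried by the positive half-line. -/
def OrigUpperClass (a : ℝ) (f : ℝ → ℂ) : Prop :=
  OrigClassAt a f ∧ ∀ t < 0, f t = 0

/-- The class `{-∞, b}`: functions of class `{b}` carried by the negative half-line. -/
def OrigLowerClass (b : ℝ) (f : ℝ → ℂ) : Prop :=
  OrigClassAt b f ∧ ∀ t > 0, f t = 0

/-- The Fourier integral `(2π)^(-1/2) ∫_A f t e^{izt} dt` over `A ⊆ ℝ`, at a complex point `z`. -/
def fourierIntegralOn (A : Set ℝ) (f : ℝ → ℂ) (z : ℂ) : ℂ :=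
  ((Real.sqrt (2 * Real.pi) : ℝ) : ℂ)⁻¹ * ∫ t in A, f t * Complex.exp (Complex.I * z * t)

/-- The open strip `a < Im z < b`. -/
def strip (a b : ℝ) : Set ℂ := {z | a < z.im ∧ z.im < b}

/-- The open half-plane `Im z > a`. -/
def upper (a : ℝ) : Set ℂ := {z | a < z.im}

/-- The open half-plane `Im z < b`. -/
def lower (b : ℝ) : Set ℂ := {z | z.im < b}

/-- The class `{{a, b}}`: on the strip, `F` is the Fourier transform of a function of class
`{a, b}` (for such functions the integral converges absolutely there). -/
def ImageStripClass (a b : ℝ) (F : ℂ → ℂ) : Prop :=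
  ∃ f, OrigStripClass a b f ∧ ∀ z ∈ strip a b, F z = fourierIntegralOn Set.univ f z

/-- The class `{{a, ∞}}`: on `Im z > a`, `F` is the Fourier transform of a function of class
`{a, ∞}`. -/
def ImageUpperClass (a : ℝ) (F : ℂ → ℂ) : Prop :=
  ∃ f, OrigUpperClass a f ∧ ∀ z ∈ upper a, F z = fourierIntegralOn Set.univ f z

/-- The class `{{-∞, b}}`: on `Im z < b`, `F` is the Fourier transform of a function of class
`{-∞, b}`. -/
def ImageLowerClass (b : ℝ) (F : ℂ → ℂ) : Prop :=
  ∃ f, OrigLowerClass b f ∧ ∀ z ∈ lower b, F z = fourierIntegralOn Set.univ f z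

/-- `φ` is a continuous non-zero function on the real line whose index
`(lim_{+∞} arg φ - lim_{-∞} arg φ) / (2π)`, for a continuous argument `θ` of `φ`, exists and
equals `n`. -/
def HasIndex (φ : ℝ → ℂ) (n : ℝ) : Prop :=
  Continuous φ ∧ (∀ x, φ x ≠ 0) ∧
    ∃ θ : ℝ → ℝ, Continuous θ ∧
      (∀ x, φ x = (‖φ x‖ : ℂ) * Complex.exp (Complex.I * (θ x : ℂ))) ∧
      ∃ p m : ℝ, Tendsto θ atTop (𝓝 p) ∧ Tendsto θ atBot (𝓝 m) ∧ n = (p - m) / (2 * Real.pi)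

/-- The restriction of `F` to the line `Im z = s`, as a function of the real part. -/
def onLine (s : ℝ) (F : ℂ → ℂ) : ℝ → ℂ := fun x => F ((x : ℂ) + (s : ℂ) * Complex.I)

/-- `L` is the analytic branch of `ln K` on the strip that vanishes at infinity. -/
structure IsLog (a b : ℝ) (K L : ℂ → ℂ) : Prop where
  analytic : DifferentiableOn ℂ L (strip a b)
  exp_eq : ∀ z ∈ strip a b, Complex.exp (L z) = K z
  vanish : ∀ s, a < s → s < b → Tendsto (onLine s L) (cocompact ℝ) (𝓝 0)

/-- `κ` is the inverse Fourier transform of the function `L` on the strip `a < Im z < b`, i.e.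
`κ t = (2π)^(-1/2) ∫_{Im z = s} L z e^{-izt} dz` in the L² sense for every `a < s < b`. On the line
`z = x + is` this says that `e^{-st} κ t` is the inverse Fourier transform of `x ↦ L (x + is)`. -/
def IsInverseFourierOnStrip (a b : ℝ) (L : ℂ → ℂ) (κ : ℝ → ℂ) : Prop :=
  ∀ s, a < s → s < b → IsFourierL2 (expShift s κ) (onLine s L)

/-- `(Kp, Km)` solves the Wiener–Hopf factorisation problem for `K` on the strip. As for `K`, it is
the difference with `1` that lies in the respective class. -/
structure IsFactorisation (a b : ℝ) (K Kp Km : ℂ → ℂ) : Prop where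
  analytic_plus : DifferentiableOn ℂ Kp (upper a)
  analytic_minus : DifferentiableOn ℂ Km (lower b)
  class_plus : ImageUpperClass a fun z => Kp z - 1
  class_minus : ImageLowerClass b fun z => Km z - 1
  eq_mul : ∀ z ∈ strip a b, K z = Kp z * Km z

/-- `K⁺ z = exp ((2π)^(-1/2) ∫_0^∞ κ t e^{izt} dt)`. -/
def factorPlus (κ : ℝ → ℂ) (z : ℂ) : ℂ := Complex.exp (fourierIntegralOn (Set.Ioi 0) κ z)

/-- `K⁻ z = exp ((2π)^(-1/2) ∫_{-∞}^0 κ t e^{izt} dt)`. -/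
def factorMinus (κ : ℝ → ℂ) (z : ℂ) : ℂ := Complex.exp (fourierIntegralOn (Set.Iio 0) κ z)

end WienerHopf

end

noncomputable section

open MeasureTheory Filter Topology Set
open scoped FourierTransform ENNReal NNReal

namespace WienerHopf

/-! Taking logarithms turns the product into a sum, and the sum is found by cutting the inverse
transform κ of L = ln K at t = 0: the piece on t > 0 has a transform analytic in Im z > a, the piece
on t < 0 one analytic in Im z < b. The analysis consists in showing that L is square integrable on
lines and that the exponentials stay in the Hölder classes up to the edges of their half-planes.

On a ≤ Im z ≤ s₁ < b the function K tends to 1 uniformly as |Re z| → ∞ (`strip_properties`). Index 0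
on Im z = a lets one logarithm vanish at both ends of that line, and then uniformly on the closed
substrips (`exists_isLog`). Far out |L| ≤ 2|K - 1|, so the L² norms of L on lines are bounded
(`exists_eLpNorm_log_le`); on Im z = a, L inherits Hölder continuity from K (`BddHolder.of_exp`). A
contour shift (`isFourierL2_onLine_shift`) shows that a single κ serves all lines, and a limit
reaches the edge Im z = a (`isFourierL2_expShift_left_edge`).

The two edges are treated differently. The line Im z = a is interior to the half-plane of the
negative part, whose transform is therefore smooth there; so the positive part has bounded Hölder
boundary values, Poisson's formula bounds its transform up to the edge, and exponentiation preserves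
all this (`imageUpperClass_exp`). On Im z = b the boundary values of K may vanish, and ln K gives no
control. There K⁻ = K / K⁺ is used, K⁺ being analytic and zero-free across that line
(`imageLowerClass_exp`). In both cases a Paley–Wiener theorem (`imageUpperClass_of_bounded`,
`imageLowerClass_of_bounded`) turns uniform L² bounds on lines and Hölder boundary values into
membership in the class.

Uniqueness is Liouville's theorem: the quotients of two zero-free factorisations glue to a bounded
entire function that tends to 1 along the imaginary axis (`IsFactorisation.unique`). -/

/-- The normalising constant `(2π)^(-1/2)`. -/
abbrev fconst : ℂ := ((Real.sqrt (2 * Real.pi) : ℝ) : ℂ)⁻¹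

/-! ### The unitary Fourier transform on L² -/

theorem two_pi_pos : (0 : ℝ) < 2 * Real.pi := by positivity

theorem sqrt_two_pi_ne : ((Real.sqrt (2 * Real.pi) : ℝ) : ℂ) ≠ 0 := by
  exact_mod_cast (Real.sqrt_pos.2 two_pi_pos).ne'

/-- The unitary dilation which turns the transform of `IsFourierL2` into Mathlib's. -/
def dilate (F : ℝ → ℂ) : ℝ → ℂ :=
  fun y => ((Real.sqrt (2 * Real.pi) : ℝ) : ℂ) * F (2 * Real.pi * y)

theorem map_two_pi_mul :
    Measure.map (fun y : ℝ => 2 * Real.pi * y) volume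
      = ENNReal.ofReal (2 * Real.pi)⁻¹ • (volume : Measure ℝ) := by
  have := Real.map_volume_mul_left two_pi_pos.ne'
  rw [abs_of_pos (inv_pos.2 two_pi_pos)] at this
  exact this

theorem measurableEmbedding_two_pi_mul :
    MeasurableEmbedding (fun y : ℝ => 2 * Real.pi * y) :=
  measurableEmbedding_mulLeft₀ two_pi_pos.ne'

theorem quasiMeasurePreserving_two_pi_mul :
    Measure.QuasiMeasurePreserving (fun y : ℝ => 2 * Real.pi * y) volume volume := by
  refine ⟨measurableEmbedding_two_pi_mul.measurable, ?_⟩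
  rw [map_two_pi_mul]
  exact Measure.smul_absolutelyContinuous

theorem quasiMeasurePreserving_div_two_pi :
    Measure.QuasiMeasurePreserving (fun y : ℝ => y / (2 * Real.pi)) volume volume := by
  have h0 : (2 * Real.pi)⁻¹ ≠ 0 := (inv_pos.2 two_pi_pos).ne'
  have : (fun y : ℝ => y / (2 * Real.pi)) = fun y => (2 * Real.pi)⁻¹ * y := by
    ext y; rw [div_eq_inv_mul]
  rw [this]
  refine ⟨(measurableEmbedding_mulLeft₀ h0).measurable, ?_⟩
  rw [Real.map_volume_mul_left h0]
  exact Measure.smul_absolutelyContinuous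

/-- The factor √(2π) in `dilate` cancels the square root of the Jacobian 1/(2π) of the substitution.
-/
theorem eLpNorm_dilate (F : ℝ → ℂ) : eLpNorm (dilate F) 2 volume = eLpNorm F 2 volume := by
  have h1 : dilate F = ((Real.sqrt (2 * Real.pi) : ℝ) : ℂ) •
      (F ∘ fun y => 2 * Real.pi * y) := rfl
  rw [h1, eLpNorm_const_smul, ← measurableEmbedding_two_pi_mul.eLpNorm_map_measure,
    map_two_pi_mul, eLpNorm_smul_measure_of_ne_top (by norm_num), smul_eq_mul, ← mul_assoc]
  have : ‖((Real.sqrt (2 * Real.pi) : ℝ) : ℂ)‖ₑ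
      * ENNReal.ofReal (2 * Real.pi)⁻¹ ^ (1 / (2 : ℝ≥0∞)).toReal = 1 := by
    rw [ENNReal.ofReal_rpow_of_pos (inv_pos.2 two_pi_pos), ← ofReal_norm,
      ← ENNReal.ofReal_mul (norm_nonneg _)]
    have : (1 / (2 : ℝ≥0∞)).toReal = 1 / 2 := by simp
    rw [this, ← Real.sqrt_eq_rpow, Complex.norm_real, Real.norm_of_nonneg (Real.sqrt_nonneg _),
      Real.sqrt_inv, mul_inv_cancel₀ (Real.sqrt_pos.2 two_pi_pos).ne']
    simp
  rw [this, one_mul]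

theorem aestronglyMeasurable_dilate {F : ℝ → ℂ} (hF : AEStronglyMeasurable F volume) :
    AEStronglyMeasurable (dilate F) volume :=
  (hF.comp_quasiMeasurePreserving quasiMeasurePreserving_two_pi_mul).const_mul _

theorem memLp_dilate {F : ℝ → ℂ} (hF : MemLp F 2 volume) : MemLp (dilate F) 2 volume :=
  ⟨aestronglyMeasurable_dilate hF.1, by rw [eLpNorm_dilate]; exact hF.2⟩

theorem eq_dilate_div (F : ℝ → ℂ) (x : ℝ) : F x = fconst * dilate F (x / (2 * Real.pi)) := by
  rw [dilate, mul_div_cancel₀ _ two_pi_pos.ne', inv_mul_cancel_left₀ sqrt_two_pi_ne]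

/-- The almost-everywhere relation becomes an equality in `Lp`, to which linearity, isometry and
inversion of `𝓕⁻` apply directly. -/
theorem isFourierL2_iff {f F : ℝ → ℂ} :
    IsFourierL2 f F ↔ ∃ (hf : MemLp f 2 volume) (hF : MemLp F 2 volume),
      (𝓕⁻ (hf.toLp f) : Lp ℂ 2 (volume : Measure ℝ)) = ((memLp_dilate hF)).toLp (dilate F) := by
  constructor
  · rintro ⟨hf, h⟩
    set g : Lp ℂ 2 (volume : Measure ℝ) := 𝓕⁻ (hf.toLp f) with hg
    have h1 : dilate F =ᵐ[volume] g := by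
      have := quasiMeasurePreserving_two_pi_mul.ae_eq_comp h
      filter_upwards [this] with y hy
      simp only [Function.comp] at hy
      rw [dilate, hy, mul_inv_cancel_left₀ sqrt_two_pi_ne, mul_div_cancel_left₀ _ two_pi_pos.ne']
    have hFm : AEStronglyMeasurable F volume := by
      refine AEStronglyMeasurable.congr ?_ h.symm
      exact ((Lp.aestronglyMeasurable g).comp_quasiMeasurePreserving
        quasiMeasurePreserving_div_two_pi).const_mul _
    have hF : MemLp F 2 volume := by
      refine ⟨hFm, ?_⟩
      rw [← eLpNorm_dilate, eLpNorm_congr_ae h1]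
      exact (Lp.memLp g).2
    refine ⟨hf, hF, ?_⟩
    apply Lp.ext
    exact h1.symm.trans (MemLp.coeFn_toLp _).symm
  · rintro ⟨hf, hF, h⟩
    refine ⟨hf, ?_⟩
    rw [h]
    have := quasiMeasurePreserving_div_two_pi.ae_eq_comp (MemLp.coeFn_toLp (memLp_dilate hF))
    filter_upwards [this] with x hx
    simp only [Function.comp] at hx
    rw [hx]
    exact eq_dilate_div F x

theorem IsFourierL2.memLp_left {f F : ℝ → ℂ} (h : IsFourierL2 f F) : MemLp f 2 volume := h.1

theorem IsFourierL2.memLp_right {f F : ℝ → ℂ} (h : IsFourierL2 f F) : MemLp F 2 volume :=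
  (isFourierL2_iff.1 h).2.1

theorem IsFourierL2.eLpNorm_eq {f F : ℝ → ℂ} (h : IsFourierL2 f F) :
    eLpNorm F 2 volume = eLpNorm f 2 volume := by
  obtain ⟨hf, hF, e⟩ := isFourierL2_iff.1 h
  have h1 : ‖(𝓕⁻ (hf.toLp f) : Lp ℂ 2 (volume : Measure ℝ))‖ = ‖hf.toLp f‖ :=
    (Lp.fourierTransformₗᵢ ℝ ℂ).symm.norm_map _
  rw [e, Lp.norm_toLp, Lp.norm_toLp, eLpNorm_dilate] at h1
  exact (ENNReal.toReal_eq_toReal_iff' hF.2.ne hf.2.ne).1 h1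

theorem exists_isFourierL2_left {F : ℝ → ℂ} (hF : MemLp F 2 volume) : ∃ f, IsFourierL2 f F := by
  set g : Lp ℂ 2 (volume : Measure ℝ) := 𝓕 (((memLp_dilate hF)).toLp (dilate F)) with hg
  refine ⟨g, isFourierL2_iff.2 ⟨Lp.memLp g, hF, ?_⟩⟩
  rw [Lp.toLp_coeFn, hg, FourierTransform.fourierInv_fourier_eq]

theorem exists_isFourierL2_right {f : ℝ → ℂ} (hf : MemLp f 2 volume) : ∃ F, IsFourierL2 f F :=
  ⟨_, hf, EventuallyEq.rfl⟩

theorem IsFourierL2.congr {f g F G : ℝ → ℂ} (h : IsFourierL2 f F) (h1 : f =ᵐ[volume] g)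
    (h2 : F =ᵐ[volume] G) : IsFourierL2 g G := by
  obtain ⟨hf, e⟩ := h
  refine ⟨hf.ae_eq h1, ?_⟩
  rw [MemLp.toLp_congr (hf.ae_eq h1) hf h1.symm]
  exact h2.symm.trans e

theorem IsFourierL2.sub {f g F G : ℝ → ℂ} (h : IsFourierL2 f F) (h' : IsFourierL2 g G) :
    IsFourierL2 (f - g) (F - G) := by
  obtain ⟨hf, hF, e⟩ := isFourierL2_iff.1 h
  obtain ⟨hg, hG, e'⟩ := isFourierL2_iff.1 h'
  refine isFourierL2_iff.2 ⟨hf.sub hg, hF.sub hG, ?_⟩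
  rw [MemLp.toLp_sub hf hg]
  have : (𝓕⁻ (hf.toLp f - hg.toLp g) : Lp ℂ 2 (volume : Measure ℝ))
      = 𝓕⁻ (hf.toLp f) - 𝓕⁻ (hg.toLp g) := (Lp.fourierTransformₗᵢ ℝ ℂ).symm.map_sub _ _
  rw [this, e, e', ← MemLp.toLp_sub]
  congr 1
  ext x
  simp [dilate, mul_sub]

theorem IsFourierL2.unique_right {f F G : ℝ → ℂ} (h : IsFourierL2 f F) (h' : IsFourierL2 f G) :
    F =ᵐ[volume] G := by
  have h1 := (h.sub h').eLpNorm_eq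
  rw [sub_self, eLpNorm_zero, eLpNorm_eq_zero_iff (h.sub h').memLp_right.1 (by norm_num)] at h1
  filter_upwards [h1] with x hx
  exact sub_eq_zero.1 hx

theorem isFourierL2_zero : IsFourierL2 0 0 := by
  obtain ⟨F, hF⟩ := exists_isFourierL2_right (MemLp.zero (α := ℝ) (ε := ℂ) (p := 2) (μ := volume))
  have := hF.sub hF
  simpa using this

theorem IsFourierL2.neg {f F : ℝ → ℂ} (h : IsFourierL2 f F) : IsFourierL2 (-f) (-F) := by
  simpa using isFourierL2_zero.sub h

theorem IsFourierL2.add {f g F G : ℝ → ℂ} (h : IsFourierL2 f F) (h' : IsFourierL2 g G) :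
    IsFourierL2 (f + g) (F + G) := by
  simpa using h.sub h'.neg

/-- If `f n → f` in `L²` and the transforms converge almost everywhere, then the limit is the
transform of `f`. -/
theorem isFourierL2_of_tendsto_left {f : ℕ → ℝ → ℂ} {F : ℕ → ℝ → ℂ} {f₀ F₀ : ℝ → ℂ}
    (h : ∀ n, IsFourierL2 (f n) (F n)) (hf₀ : MemLp f₀ 2 volume)
    (hf : Tendsto (fun n => eLpNorm (f n - f₀) 2 volume) atTop (𝓝 0))
    (hF : ∀ᵐ x, Tendsto (fun n => F n x) atTop (𝓝 (F₀ x))) : IsFourierL2 f₀ F₀ := by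
  obtain ⟨G, hG⟩ := exists_isFourierL2_right hf₀
  have h1 : Tendsto (fun n => eLpNorm (F n - G) 2 volume) atTop (𝓝 0) :=
    hf.congr fun n => ((h n).sub hG).eLpNorm_eq.symm
  have h2 := tendstoInMeasure_of_tendsto_eLpNorm (by norm_num : (2 : ℝ≥0∞) ≠ 0)
    (fun n => (h n).memLp_right.1) hG.memLp_right.1 h1
  obtain ⟨ns, hns, h3⟩ := h2.exists_seq_tendsto_ae
  refine hG.congr EventuallyEq.rfl ?_
  filter_upwards [h3, hF] with x hx hx'
  exact tendsto_nhds_unique hx (hx'.comp hns.tendsto_atTop)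

/-- By Plancherel the originals converge in L² as well. This gives pointwise access to inverse
transforms for which no convergent integral is at hand. -/
theorem exists_seq_tendsto_ae_of_isFourierL2 {f : ℕ → ℝ → ℂ} {F : ℕ → ℝ → ℂ} {f₀ F₀ : ℝ → ℂ}
    (h : ∀ n, IsFourierL2 (f n) (F n)) (h₀ : IsFourierL2 f₀ F₀)
    (hF : Tendsto (fun n => eLpNorm (F n - F₀) 2 volume) atTop (𝓝 0)) :
    ∃ ns : ℕ → ℕ, StrictMono ns ∧
      ∀ᵐ x, Tendsto (fun n => f (ns n) x) atTop (𝓝 (f₀ x)) := by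
  have h1 : Tendsto (fun n => eLpNorm (f n - f₀) 2 volume) atTop (𝓝 0) :=
    hF.congr fun n => ((h n).sub h₀).eLpNorm_eq
  exact (tendstoInMeasure_of_tendsto_eLpNorm (by norm_num : (2 : ℝ≥0∞) ≠ 0)
    (fun n => (h n).memLp_left.1) h₀.memLp_left.1 h1).exists_seq_tendsto_ae

/-- Parseval's identity. -/
theorem IsFourierL2.integral_conj_mul {f g F G : ℝ → ℂ} (h : IsFourierL2 f F)
    (h' : IsFourierL2 g G) :
    ∫ t, f t * starRingEnd ℂ (g t) = ∫ x, F x * starRingEnd ℂ (G x) := by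
  obtain ⟨hf, hF, e⟩ := isFourierL2_iff.1 h
  obtain ⟨hg, hG, e'⟩ := isFourierL2_iff.1 h'
  have h1 : inner ℂ (𝓕⁻ (hg.toLp g) : Lp ℂ 2 (volume : Measure ℝ)) (𝓕⁻ (hf.toLp f))
      = inner ℂ (hg.toLp g) (hf.toLp f) :=
    (Lp.fourierTransformₗᵢ ℝ ℂ).symm.inner_map_map _ _
  rw [e, e', L2.inner_def, L2.inner_def] at h1
  have h2 : ∫ t, f t * starRingEnd ℂ (g t) = ∫ t, inner ℂ (hg.toLp g t) (hf.toLp f t) := by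
    refine integral_congr_ae ?_
    filter_upwards [hf.coeFn_toLp, hg.coeFn_toLp] with t h1 h2
    rw [h1, h2]; rfl
  rw [h2, ← h1]
  have h3 : ∫ y, inner ℂ ((memLp_dilate hG).toLp (dilate G) y)
      ((memLp_dilate hF).toLp (dilate F) y)
      = ∫ y : ℝ, (2 * Real.pi : ℝ) • (F (2 * Real.pi * y) * starRingEnd ℂ (G (2 * Real.pi * y))) := by
    refine integral_congr_ae ?_
    filter_upwards [(memLp_dilate hF).coeFn_toLp, (memLp_dilate hG).coeFn_toLp] with t h1 h2
    rw [h1, h2]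
    have : ((Real.sqrt (2 * Real.pi) : ℝ) : ℂ) * ((Real.sqrt (2 * Real.pi) : ℝ) : ℂ)
        = ((2 * Real.pi : ℝ) : ℂ) := by
      rw [← Complex.ofReal_mul, Real.mul_self_sqrt two_pi_pos.le]
    rw [Complex.real_smul, ← this]
    simp only [RCLike.inner_apply, dilate, map_mul, Complex.conj_ofReal]
    ring
  rw [h3, integral_smul,
    Measure.integral_comp_mul_left (fun x => F x * starRingEnd ℂ (G x)) (2 * Real.pi),
    abs_of_pos (inv_pos.2 two_pi_pos), smul_smul, mul_inv_cancel₀ two_pi_pos.ne', one_smul]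


/-! ### The L² transform as an absolutely convergent integral -/

theorem inner_real_real (y t : ℝ) : inner ℝ y t = y * t := by
  simp [mul_comm]

theorem continuous_fourier_of_integrable {f : ℝ → ℂ} (h1 : Integrable f) : Continuous (𝓕 f) :=
  VectorFourier.fourierIntegral_continuous Real.continuous_fourierChar
    (by fun_prop) h1

theorem continuous_fourierInv_of_integrable {f : ℝ → ℂ} (h1 : Integrable f) :
    Continuous (𝓕⁻ f) := by
  have : 𝓕⁻ f = fun y => 𝓕 f (-y) := by ext y; exact Real.fourierInv_eq_fourier_neg f y
  rw [this]
  exact (continuous_fourier_of_integrable h1).comp continuous_neg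

theorem integral_fourier_mul_flip {f g : ℝ → ℂ} (hf : Integrable f) (hg : Integrable g) :
    ∫ x, 𝓕 g x • f x = ∫ x, g x • 𝓕 f x := by
  have h := VectorFourier.integral_fourierIntegral_smul_eq_flip (e := Real.fourierChar)
    (μ := volume) (ν := volume) (L := innerₗ ℝ) Real.continuous_fourierChar
    (by fun_prop) hg hf
  rw [flip_innerₗ] at h
  exact h

theorem integral_fourierInv_mul_flip {f g : ℝ → ℂ} (hf : Integrable f) (hg : Integrable g) :
    ∫ x, 𝓕⁻ g x • f x = ∫ x, g x • 𝓕⁻ f x := by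
  have h := VectorFourier.integral_fourierIntegral_smul_eq_flip (e := Real.fourierChar)
    (μ := volume) (ν := volume) (L := -innerₗ ℝ) Real.continuous_fourierChar
    (by simp only [LinearMap.neg_apply]; fun_prop) hg hf
  have e : (-innerₗ ℝ : ℝ →ₗ[ℝ] ℝ →ₗ[ℝ] ℝ).flip = -innerₗ ℝ := by
    ext
    simp
  rw [e] at h
  exact h

/-- Smooth compactly supported functions already separate locally integrable ones. Schwartz
functions are used because the distributional transform is defined by testing against them. -/
theorem ae_eq_of_integral_schwartz {G : Lp ℂ 2 (volume : Measure ℝ)} {H : ℝ → ℂ}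
    (hH : Continuous H)
    (h : ∀ φ : SchwartzMap ℝ ℂ, ∫ x, φ x • G x = ∫ x, φ x • H x) : G =ᵐ[volume] H := by
  refine ae_eq_of_integral_contDiff_smul_eq ((Lp.memLp G).locallyIntegrable (by norm_num))
    hH.locallyIntegrable fun g hg hgc => ?_
  have h1 : HasCompactSupport (fun x => (g x : ℂ)) := hgc.comp_left Complex.ofReal_zero
  have h2 := h (h1.toSchwartzMap (Complex.ofRealCLM.contDiff.comp hg))
  simp_rw [Complex.real_smul]
  exact h2

/-- The L² transform agrees with the transform of tempered distributions, and Fubini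
(`integral_fourier_mul_flip`) gives the integral transform the same pairing with every Schwartz
function. -/
theorem Lp_fourier_ae_eq {f : ℝ → ℂ} (h1 : Integrable f) (h2 : MemLp f 2 volume) :
    (𝓕 (h2.toLp f) : Lp ℂ 2 (volume : Measure ℝ)) =ᵐ[volume] 𝓕 f := by
  refine ae_eq_of_integral_schwartz (continuous_fourier_of_integrable h1) fun φ => ?_
  rw [← Lp.toTemperedDistribution_apply, ← Lp.fourier_toTemperedDistribution_eq,
    TemperedDistribution.fourier_apply, Lp.toTemperedDistribution_apply, SchwartzMap.fourier_coe,
    ← integral_fourier_mul_flip h1 φ.integrable]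
  refine integral_congr_ae ?_
  filter_upwards [h2.coeFn_toLp] with x hx
  rw [hx]

theorem Lp_fourierInv_ae_eq {f : ℝ → ℂ} (h1 : Integrable f) (h2 : MemLp f 2 volume) :
    (𝓕⁻ (h2.toLp f) : Lp ℂ 2 (volume : Measure ℝ)) =ᵐ[volume] 𝓕⁻ f := by
  refine ae_eq_of_integral_schwartz (continuous_fourierInv_of_integrable h1) fun φ => ?_
  rw [← Lp.toTemperedDistribution_apply, ← Lp.fourierInv_toTemperedDistribution_eq,
    TemperedDistribution.fourierInv_apply, Lp.toTemperedDistribution_apply,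
    SchwartzMap.fourierInv_coe, ← integral_fourierInv_mul_flip h1 φ.integrable]
  refine integral_congr_ae ?_
  filter_upwards [h2.coeFn_toLp] with x hx
  rw [hx]

theorem isFourierL2_integral {f : ℝ → ℂ} (h1 : Integrable f) (h2 : MemLp f 2 volume) :
    IsFourierL2 f fun x => fourierIntegralOn univ f x := by
  refine ⟨h2, ?_⟩
  have := quasiMeasurePreserving_div_two_pi.ae_eq_comp (Lp_fourierInv_ae_eq h1 h2)
  filter_upwards [this] with x hx
  simp only [Function.comp] at hx
  rw [hx, fourierIntegralOn, Real.fourierInv_eq', setIntegral_univ]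
  congr 1
  refine integral_congr_ae (Eventually.of_forall fun t => ?_)
  have : 2 * Real.pi * (t * (x / (2 * Real.pi))) = x * t := by
    have := two_pi_pos.ne'
    field_simp
  simp only [smul_eq_mul, inner_real_real]
  rw [this, mul_comm]
  congr 2
  push_cast
  ring

/-- The inverse transform is given by the inverse Fourier integral. -/
theorem isFourierL2_integral_inv {F : ℝ → ℂ} (h1 : Integrable F) (h2 : MemLp F 2 volume) :
    IsFourierL2 (fun t => fconst * ∫ x, F x * Complex.exp (-(Complex.I * x * t))) F := by
  obtain ⟨f, hf⟩ := exists_isFourierL2_left h2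
  refine hf.congr ?_ EventuallyEq.rfl
  obtain ⟨hf2, hF2, e⟩ := isFourierL2_iff.1 hf
  have h3 : (𝓕 ((memLp_dilate h2).toLp (dilate F)) : Lp ℂ 2 (volume : Measure ℝ))
      = hf2.toLp f := by
    rw [← e, FourierTransform.fourier_fourierInv_eq]
  have h4 : Integrable (dilate F) := (h1.comp_mul_left' two_pi_pos.ne').const_mul _
  have h5 := Lp_fourier_ae_eq h4 (memLp_dilate h2)
  rw [h3] at h5
  filter_upwards [h5, hf2.coeFn_toLp] with t h6 h7
  rw [← h7, h6, Real.fourier_eq']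
  have h8 : ∀ y : ℝ, Complex.exp (((-2 * Real.pi * inner ℝ y t : ℝ) : ℂ) * Complex.I) • dilate F y
      = ((Real.sqrt (2 * Real.pi) : ℝ) : ℂ) * (fun x : ℝ => F x * Complex.exp (-(Complex.I * x * t)))
        (2 * Real.pi * y) := by
    intro y
    simp only [smul_eq_mul, inner_real_real, dilate]
    rw [mul_comm, mul_assoc]
    congr 3
    push_cast
    ring
  simp_rw [h8]
  rw [integral_const_mul,
    Measure.integral_comp_mul_left (fun x : ℝ => F x * Complex.exp (-(Complex.I * x * t))),
    abs_of_pos (inv_pos.2 two_pi_pos), Complex.real_smul, ← mul_assoc]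
  congr 1
  have h9 : ((Real.sqrt (2 * Real.pi) : ℝ) : ℂ) * ((Real.sqrt (2 * Real.pi) : ℝ) : ℂ)
      = ((2 * Real.pi : ℝ) : ℂ) := by
    rw [← Complex.ofReal_mul, Real.mul_self_sqrt two_pi_pos.le]
  have h10 := sqrt_two_pi_ne
  rw [Complex.ofReal_inv, ← h9]
  field_simp

/-- Truncations converge in `L²`. -/
theorem tendsto_eLpNorm_of_dominated {f : ℕ → ℝ → ℂ} {f₀ : ℝ → ℂ} {g : ℝ → ℝ}
    (hg : MemLp g 2 volume) (hfm : ∀ n, AEStronglyMeasurable (f n) volume)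
    (hb : ∀ n, ∀ᵐ x, ‖f n x‖ ≤ g x) (hl : ∀ᵐ x, Tendsto (fun n => f n x) atTop (𝓝 (f₀ x))) :
    MemLp f₀ 2 volume ∧ Tendsto (fun n => eLpNorm (f n - f₀) 2 volume) atTop (𝓝 0) := by
  have hm₀ : AEStronglyMeasurable f₀ volume := aestronglyMeasurable_of_tendsto_ae _ hfm hl
  have hb₀ : ∀ᵐ x, ‖f₀ x‖ ≤ g x := by
    filter_upwards [ae_all_iff.2 hb, hl] with x h1 h2
    exact le_of_tendsto h2.norm (Eventually.of_forall h1)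
  have h₀ : MemLp f₀ 2 volume := hg.mono hm₀ (by
    filter_upwards [hb₀] with x hx
    exact hx.trans (le_abs_self _))
  refine ⟨h₀, ?_⟩
  -- Both ‖f n‖ and ‖f₀‖ are at most g, so (2g)² dominates ‖f n - f₀‖².
  have hfin : ∫⁻ x, ‖2 * g x‖ₑ ^ (2 : ℝ) ≠ ∞ := by
    have := (hg.const_mul 2).2
    rw [eLpNorm_lt_top_iff_lintegral_rpow_enorm_lt_top (by norm_num) (by norm_num)] at this
    simpa using this.ne
  have key : Tendsto (fun n => ∫⁻ x, ‖(f n - f₀) x‖ₑ ^ (2 : ℝ)) atTop (𝓝 (∫⁻ _ : ℝ, 0)) := by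
    refine tendsto_lintegral_of_dominated_convergence' (fun x => ‖2 * g x‖ₑ ^ (2 : ℝ))
      (fun n => ((hfm n).sub hm₀).enorm.pow_const _) (fun n => ?_) hfin ?_
    · filter_upwards [hb n, hb₀] with x h1 h2
      refine ENNReal.rpow_le_rpow ?_ (by norm_num)
      rw [enorm_le_iff_norm_le]
      calc ‖(f n - f₀) x‖ ≤ ‖f n x‖ + ‖f₀ x‖ := norm_sub_le _ _
        _ ≤ 2 * g x := by linarith
        _ ≤ ‖2 * g x‖ := le_abs_self _
    · filter_upwards [hl] with x hx
      have h1 : Tendsto (fun n => ‖f n x - f₀ x‖ₑ) atTop (𝓝 0) := by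
        have := (hx.sub_const (f₀ x)).enorm
        simpa using this
      have := (ENNReal.continuous_rpow_const (y := 2)).tendsto 0 |>.comp h1
      simpa [Function.comp_def] using this
  rw [lintegral_zero] at key
  have h2 := (ENNReal.continuous_rpow_const (y := 1 / 2)).tendsto 0 |>.comp key
  rw [ENNReal.zero_rpow_of_pos (by norm_num)] at h2
  refine h2.congr fun n => ?_
  rw [eLpNorm_eq_lintegral_rpow_enorm_toReal (by norm_num) (by norm_num)]
  simp [Function.comp]

/-- For the truncations to [-n, n] this is a change of variables in the Fourier integral; the
general case follows in the L² limit, along a subsequence on which the transforms converge almost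
everywhere. -/
theorem IsFourierL2.comp_neg {f F : ℝ → ℂ} (h : IsFourierL2 f F) :
    IsFourierL2 (fun t => f (-t)) (fun x => F (-x)) := by
  have hf := h.memLp_left
  set g : ℕ → ℝ → ℂ := fun n => indicator (Icc (-n : ℝ) n) f with hgdef
  have hgm : ∀ n, MemLp (g n) 2 volume := fun n => hf.indicator measurableSet_Icc
  have hg1 : ∀ n, Integrable (g n) := fun n => by
    rw [hgdef, integrable_indicator_iff measurableSet_Icc]
    have : IsFiniteMeasure (volume.restrict (Icc (-n : ℝ) n)) := ⟨by simp⟩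
    exact (hf.restrict _).integrable (by norm_num)
  have hlim : ∀ᵐ t, Tendsto (fun n => g n t) atTop (𝓝 (f t)) := by
    refine Eventually.of_forall fun t => tendsto_const_nhds.congr' ?_
    obtain ⟨N, hN⟩ := exists_nat_ge |t|
    filter_upwards [eventually_ge_atTop N] with n hn
    have : |t| ≤ n := hN.trans (by exact_mod_cast hn)
    rw [hgdef]
    exact (Set.indicator_of_mem (s := Icc (-n : ℝ) n) (abs_le.1 this) f).symm
  have hb : ∀ n, ∀ᵐ t, ‖g n t‖ ≤ ‖f t‖ := fun n =>
    Eventually.of_forall fun t => norm_indicator_le_norm_self _ _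
  have h2 := tendsto_eLpNorm_of_dominated hf.norm (fun n => (hgm n).1) hb hlim
  set G : ℕ → ℝ → ℂ := fun n x => fourierIntegralOn univ (g n) x
  have hG : ∀ n, IsFourierL2 (g n) (G n) := fun n => isFourierL2_integral (hg1 n) (hgm n)
  have h3 : Tendsto (fun n => eLpNorm (G n - F) 2 volume) atTop (𝓝 0) :=
    h2.2.congr fun n => ((hG n).sub h).eLpNorm_eq.symm
  have h4 := tendstoInMeasure_of_tendsto_eLpNorm (by norm_num : (2 : ℝ≥0∞) ≠ 0)
    (fun n => (hG n).memLp_right.1) h.memLp_right.1 h3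
  obtain ⟨ns, hns, h5⟩ := h4.exists_seq_tendsto_ae
  have hq := (Measure.measurePreserving_neg (volume : Measure ℝ)).quasiMeasurePreserving
  have hneg : ∀ n, IsFourierL2 (fun t => g n (-t)) (fun x => G n (-x)) := fun n => by
    have := isFourierL2_integral (hg1 n).comp_neg
      ((hgm n).comp_measurePreserving (Measure.measurePreserving_neg _))
    refine this.congr EventuallyEq.rfl (Eventually.of_forall fun x => ?_)
    simp only [G, fourierIntegralOn, setIntegral_univ]
    congr 1
    rw [← integral_neg_eq_self]
    refine integral_congr_ae (Eventually.of_forall fun t => ?_)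
    simp
  have hf' := hf.comp_measurePreserving (Measure.measurePreserving_neg _)
  have h6 := tendsto_eLpNorm_of_dominated (f := fun n t => g n (-t)) (f₀ := fun t => f (-t))
    hf'.norm
    (fun n => ((hgm n).comp_measurePreserving (Measure.measurePreserving_neg _)).1)
    (fun n => hq.ae (hb n)) (hq.ae hlim)
  exact isFourierL2_of_tendsto_left (fun n => hneg (ns n)) hf'
    (h6.2.comp hns.tendsto_atTop) (hq.ae h5)


/-! ### Exponential weights and Fourier integrals in a half-plane -/

theorem norm_expShift (s : ℝ) (h : ℝ → ℂ) (t : ℝ) :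
    ‖expShift s h t‖ = Real.exp (-(s * t)) * ‖h t‖ := by
  rw [expShift, norm_mul, Complex.norm_real, Real.norm_of_nonneg (Real.exp_pos _).le]

theorem expShift_expShift (s r : ℝ) (h : ℝ → ℂ) :
    expShift s (expShift r h) = expShift (s + r) h := by
  ext t
  simp only [expShift]
  rw [← mul_assoc, ← Complex.ofReal_mul, ← Real.exp_add]
  congr 3
  ring

theorem norm_mul_cexp (h : ℝ → ℂ) (z : ℂ) (t : ℝ) :
    ‖h t * Complex.exp (Complex.I * z * t)‖ = ‖expShift z.im h t‖ := by
  rw [norm_expShift, norm_mul, Complex.norm_exp, mul_comm]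
  congr 2
  simp [Complex.mul_re, Complex.mul_im]

theorem expShift_mul_cexp (s : ℝ) (h : ℝ → ℂ) (z : ℂ) (t : ℝ) :
    expShift s h t * Complex.exp (Complex.I * z * t)
      = h t * Complex.exp (Complex.I * (z + s * Complex.I) * t) := by
  rw [expShift, mul_assoc, mul_left_comm, Complex.ofReal_exp, ← Complex.exp_add]
  congr 2
  push_cast
  linear_combination (-(s : ℂ) * t) * Complex.I_sq

/-- The weight e^{-st} is absorbed into e^{izt}, so that a transform on the line Im z = s is the
transform of a weighted function on the real axis. -/
theorem fourierIntegralOn_expShift (A : Set ℝ) (s : ℝ) (h : ℝ → ℂ) (z : ℂ) :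
    fourierIntegralOn A (expShift s h) z = fourierIntegralOn A h (z + s * Complex.I) := by
  simp only [fourierIntegralOn, expShift_mul_cexp]

theorem continuous_expFactor (s : ℝ) : Continuous fun t : ℝ => (Real.exp (-(s * t)) : ℂ) := by
  fun_prop

theorem aestronglyMeasurable_expShift {s : ℝ} {h : ℝ → ℂ} (hm : AEStronglyMeasurable h volume) :
    AEStronglyMeasurable (expShift s h) volume :=
  (continuous_expFactor s).aestronglyMeasurable.mul hm

theorem aestronglyMeasurable_of_expShift {s : ℝ} {h : ℝ → ℂ}
    (hm : AEStronglyMeasurable (expShift s h) volume) : AEStronglyMeasurable h volume := by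
  have := aestronglyMeasurable_expShift (s := -s) hm
  rw [expShift_expShift, neg_add_cancel] at this
  convert this using 1
  ext t
  simp [expShift]

/-- `t ↦ t ^ n e^{-ct}` on the positive half-line is square integrable. -/
theorem memLp_pow_mul_exp (n : ℕ) {c : ℝ} (hc : 0 < c) :
    MemLp (indicator (Ioi 0) fun t : ℝ => t ^ n * Real.exp (-(c * t))) 2 volume := by
  have hm : AEStronglyMeasurable (indicator (Ioi 0) fun t : ℝ => t ^ n * Real.exp (-(c * t)))
      volume :=
    (Continuous.aestronglyMeasurable (by fun_prop)).indicator measurableSet_Ioi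
  rw [memLp_two_iff_integrable_sq hm]
  have h1 := integrableOn_rpow_mul_exp_neg_mul_rpow (p := 1) (s := (2 * n : ℕ)) (b := 2 * c)
    (by have : (0 : ℝ) ≤ ((2 * n : ℕ) : ℝ) := by positivity
        linarith) one_pos (by positivity)
  rw [← integrable_indicator_iff measurableSet_Ioi] at h1
  refine h1.congr (Eventually.of_forall fun t => ?_)
  by_cases ht : t ∈ Ioi (0 : ℝ)
  · simp only [indicator_of_mem ht, Real.rpow_natCast, Real.rpow_one]
    rw [mul_pow, ← pow_mul, ← Real.exp_nat_mul, mul_comm n 2]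
    congr 2
    push_cast
    ring
  · simp [indicator_of_notMem ht]

section Upper

variable {a : ℝ} {h : ℝ → ℂ}

/-- Cauchy–Schwarz: on t > 0 the integrand is the product of t^n e^{-(s-a)t} and e^{-at} h, both
square integrable. The case n = 0 gives absolute convergence of the Fourier integral, the case n = 1
dominates its derivative. -/
theorem integrable_pow_mul_expShift (h2 : MemLp (expShift a h) 2 volume) (h0 : ∀ t < 0, h t = 0)
    (n : ℕ) {s : ℝ} (hs : a < s) : Integrable fun t : ℝ => (t : ℂ) ^ n * expShift s h t := by
  have hk := (memLp_pow_mul_exp n (sub_pos.2 hs)).ofReal (K := ℂ)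
  have h1 := hk.integrable_mul h2
  refine h1.congr ?_
  have : ∀ᵐ t : ℝ, t ≠ 0 := by simp [ae_iff, measure_singleton]
  filter_upwards [this] with t ht
  rcases lt_or_gt_of_ne ht with ht | ht
  · simp [expShift, h0 t ht]
  · simp only [Pi.mul_apply, indicator_of_mem (mem_Ioi.2 ht), expShift, RCLike.ofReal_mul,
      RCLike.ofReal_pow]
    have : Real.exp (-(s * t)) = Real.exp (-((s - a) * t)) * Real.exp (-(a * t)) := by
      rw [← Real.exp_add]; congr 1; ring
    rw [this, Complex.ofReal_mul]
    simp only [Complex.coe_algebraMap]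
    ring

theorem integrable_expShift (h2 : MemLp (expShift a h) 2 volume) (h0 : ∀ t < 0, h t = 0)
    {s : ℝ} (hs : a < s) : Integrable (expShift s h) := by
  simpa using integrable_pow_mul_expShift h2 h0 0 hs

theorem norm_expShift_le (h0 : ∀ t < 0, h t = 0) {s r : ℝ} (hs : s ≤ r) (t : ℝ) :
    ‖expShift r h t‖ ≤ ‖expShift s h t‖ := by
  rw [norm_expShift, norm_expShift]
  rcases lt_or_ge t 0 with ht | ht
  · simp [h0 t ht]
  · gcongr

theorem memLp_expShift (h2 : MemLp (expShift a h) 2 volume) (h0 : ∀ t < 0, h t = 0)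
    {s : ℝ} (hs : a ≤ s) : MemLp (expShift s h) 2 volume :=
  h2.mono (aestronglyMeasurable_expShift (aestronglyMeasurable_of_expShift h2.1))
    (Eventually.of_forall (norm_expShift_le h0 hs))

theorem eLpNorm_expShift_le (h0 : ∀ t < 0, h t = 0) {s r : ℝ} (hs : s ≤ r) :
    eLpNorm (expShift r h) 2 volume ≤ eLpNorm (expShift s h) 2 volume :=
  eLpNorm_mono (norm_expShift_le h0 hs)

theorem integrable_mul_cexp (h2 : MemLp (expShift a h) 2 volume) (h0 : ∀ t < 0, h t = 0)
    {z : ℂ} (hz : a < z.im) : Integrable fun t : ℝ => h t * Complex.exp (Complex.I * z * t) := by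
  have h1 := integrable_expShift h2 h0 hz
  refine h1.mono ?_ (Eventually.of_forall fun t => (norm_mul_cexp h z t).le)
  exact (aestronglyMeasurable_of_expShift h2.1).mul
    (Continuous.aestronglyMeasurable (by fun_prop))

theorem isFourierL2_onLine (h2 : MemLp (expShift a h) 2 volume) (h0 : ∀ t < 0, h t = 0)
    {s : ℝ} (hs : a < s) : IsFourierL2 (expShift s h) (onLine s (fourierIntegralOn univ h)) := by
  have := isFourierL2_integral (integrable_expShift h2 h0 hs) (memLp_expShift h2 h0 hs.le)
  simp only [fourierIntegralOn_expShift] at this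
  exact this

theorem hasDerivAt_fourierIntegral (h2 : MemLp (expShift a h) 2 volume) (h0 : ∀ t < 0, h t = 0)
    {z : ℂ} (hz : a < z.im) :
    HasDerivAt (fourierIntegralOn univ h)
      (fconst * ∫ t : ℝ, h t * (Complex.I * t * Complex.exp (Complex.I * z * t))) z := by
  obtain ⟨s, has, hsz⟩ := exists_between hz
  have hm := aestronglyMeasurable_of_expShift h2.1
  -- The radius keeps the ball above the line Im w = s, so |t e^{-st} h(t)| dominates the
  -- derivatives of the integrand at all its points.
  have hball : ∀ w ∈ Metric.ball z (z.im - s), s < w.im := by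
    intro w hw
    have h1 : |(w - z).im| ≤ ‖w - z‖ := Complex.abs_im_le_norm _
    rw [mem_ball_iff_norm] at hw
    have h3 := (abs_le.1 (h1.trans hw.le)).1
    have h4 : |(w - z).im| < z.im - s := h1.trans_lt hw
    have h5 := (abs_lt.1 h4).1
    rw [Complex.sub_im] at h5
    linarith
  have key := hasDerivAt_integral_of_dominated_loc_of_deriv_le (μ := volume) (x₀ := z)
    (s := Metric.ball z (z.im - s))
    (F := fun w (t : ℝ) => h t * Complex.exp (Complex.I * w * (t : ℝ)))
    (F' := fun w (t : ℝ) => h t * (Complex.I * t * Complex.exp (Complex.I * w * (t : ℝ))))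
    (bound := fun t : ℝ => ‖(t : ℂ) ^ 1 * expShift s h t‖)
    (Metric.ball_mem_nhds z (by linarith))
    (Eventually.of_forall fun w =>
      hm.mul (Continuous.aestronglyMeasurable (by fun_prop)))
    (integrable_mul_cexp h2 h0 hz)
    (hm.mul (Continuous.aestronglyMeasurable (by fun_prop)))
    (Eventually.of_forall fun t w hw => by
      have h1 : ‖h t * (Complex.I * t * Complex.exp (Complex.I * w * (t : ℝ)))‖
          = ‖(t : ℂ)‖ * ‖h t * Complex.exp (Complex.I * w * (t : ℝ))‖ := by
        simp only [norm_mul, Complex.norm_I, one_mul]; ring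
      rw [h1, norm_mul_cexp, pow_one, norm_mul]
      gcongr
      exact norm_expShift_le h0 (hball w hw).le t)
    (integrable_pow_mul_expShift h2 h0 1 has).norm
    (Eventually.of_forall fun t w _ => by
      have h1 : HasDerivAt (fun w : ℂ => Complex.I * w * t) (Complex.I * t) w := by
        simpa using ((hasDerivAt_id w).const_mul Complex.I).mul_const (t : ℂ)
      have h3 := h1.cexp.const_mul (h t)
      refine h3.congr_deriv ?_
      ring)
  have h3 := key.2.const_mul fconst
  refine h3.congr_of_eventuallyEq (Eventually.of_forall fun w => ?_)
  simp only [fourierIntegralOn, setIntegral_univ]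

theorem differentiableOn_fourierIntegral (h2 : MemLp (expShift a h) 2 volume)
    (h0 : ∀ t < 0, h t = 0) : DifferentiableOn ℂ (fourierIntegralOn univ h) (upper a) :=
  fun _ hz => (hasDerivAt_fourierIntegral h2 h0 hz).differentiableAt.differentiableWithinAt

theorem exists_norm_fourierIntegral_le (h2 : MemLp (expShift a h) 2 volume)
    (h0 : ∀ t < 0, h t = 0) {s : ℝ} (hs : a < s) :
    ∃ B, ∀ z : ℂ, s ≤ z.im → ‖fourierIntegralOn univ h z‖ ≤ B := by
  refine ⟨‖fconst‖ * ∫ t, ‖expShift s h t‖, fun z hz => ?_⟩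
  rw [fourierIntegralOn, norm_mul, setIntegral_univ]
  gcongr
  refine (norm_integral_le_integral_norm _).trans ?_
  refine integral_mono (integrable_mul_cexp h2 h0 (hs.trans_le hz)).norm
    (integrable_expShift h2 h0 hs).norm fun t => ?_
  simp only [norm_mul_cexp]
  exact norm_expShift_le h0 hz t

theorem exists_lipschitz_fourierIntegral (h2 : MemLp (expShift a h) 2 volume)
    (h0 : ∀ t < 0, h t = 0) {s : ℝ} (hs : a < s) :
    ∃ B, ∀ z w : ℂ, s ≤ z.im → s ≤ w.im →
      ‖fourierIntegralOn univ h z - fourierIntegralOn univ h w‖ ≤ B * ‖z - w‖ := by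
  refine ⟨‖fconst‖ * ∫ t : ℝ, ‖(t : ℂ) ^ 1 * expShift s h t‖, fun z w hz hw => ?_⟩
  have hconv : Convex ℝ {z : ℂ | s ≤ z.im} := convex_halfSpace_im_ge s
  refine hconv.norm_image_sub_le_of_norm_hasDerivWithin_le
    (fun u hu => (hasDerivAt_fourierIntegral h2 h0 (hs.trans_le hu)).hasDerivWithinAt)
    (fun u hu => ?_) hw hz
  rw [norm_mul]
  gcongr
  refine (norm_integral_le_integral_norm _).trans ?_
  refine integral_mono_of_nonneg (Eventually.of_forall fun t => norm_nonneg _)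
    (integrable_pow_mul_expShift h2 h0 1 hs).norm (Eventually.of_forall fun t => ?_)
  have h1 : ‖h t * (Complex.I * t * Complex.exp (Complex.I * u * (t : ℝ)))‖
      = ‖(t : ℂ)‖ * ‖h t * Complex.exp (Complex.I * u * (t : ℝ))‖ := by
    simp only [norm_mul, Complex.norm_I, one_mul]; ring
  simp only [h1]
  rw [norm_mul_cexp, pow_one, norm_mul]
  gcongr
  exact norm_expShift_le h0 hu t

end Upper

/-! ### The Riemann–Lebesgue lemma in a half-plane -/

/-- Integration by parts, with |e^{iwt}| ≤ 1 for t > 0 and Im w ≥ 0. The term g(0) is kept because g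
need not vanish at the end-point of the half-line. -/
theorem integral_Ioi_contDiff_mul_cexp_le {g : ℝ → ℂ} (hg : ContDiff ℝ 1 g)
    (hgc : HasCompactSupport g) {w : ℂ} (hw : 0 ≤ w.im) :
    ‖w‖ * ‖∫ t in Ioi (0 : ℝ), g t * Complex.exp (Complex.I * w * t)‖
      ≤ ‖g 0‖ + ∫ t, ‖deriv g t‖ := by
  have hdc : Continuous (deriv g) := hg.continuous_deriv le_rfl
  have hE : Continuous fun t : ℝ => Complex.exp (Complex.I * w * t) := by fun_prop
  have hi1 : Integrable fun t : ℝ => deriv g t * Complex.exp (Complex.I * w * t) :=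
    (hdc.mul hE).integrable_of_hasCompactSupport hgc.deriv.mul_right
  have hi2 : Integrable fun t : ℝ => g t * Complex.exp (Complex.I * w * t) :=
    (hg.continuous.mul hE).integrable_of_hasCompactSupport hgc.mul_right
  have hder : ∀ t : ℝ, HasDerivAt (fun t : ℝ => g t * Complex.exp (Complex.I * w * t))
      (deriv g t * Complex.exp (Complex.I * w * t)
        + Complex.I * w * (g t * Complex.exp (Complex.I * w * t))) t := by
    intro t
    have h1 : HasDerivAt (fun t : ℝ => Complex.I * w * (t : ℂ)) (Complex.I * w) t := by
      simpa using ((hasDerivAt_id t).ofReal_comp).const_mul (Complex.I * w)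
    have h2 := ((hg.differentiable one_ne_zero).differentiableAt (x := t)).hasDerivAt.mul h1.cexp
    refine h2.congr_deriv ?_
    ring
  have hlim : Tendsto (fun t : ℝ => g t * Complex.exp (Complex.I * w * t)) atTop (𝓝 0) := by
    have hc : HasCompactSupport fun t : ℝ => g t * Complex.exp (Complex.I * w * t) :=
      hgc.mul_right
    refine tendsto_const_nhds.congr' ?_
    have h3 : (tsupport fun t : ℝ => g t * Complex.exp (Complex.I * w * t))ᶜ ∈ atTop :=
      atTop_le_cocompact hc.compl_mem_cocompact
    filter_upwards [h3] with t ht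
    exact (image_eq_zero_of_notMem_tsupport ht).symm
  have key := integral_Ioi_of_hasDerivAt_of_tendsto (a := 0) (hder 0).continuousAt.continuousWithinAt
    (fun t _ => hder t) (hi1.add (hi2.const_mul _)).integrableOn hlim
  rw [integral_add hi1.integrableOn (hi2.const_mul _).integrableOn, integral_const_mul] at key
  have h4 : ‖w‖ * ‖∫ t in Ioi (0 : ℝ), g t * Complex.exp (Complex.I * w * t)‖
      = ‖Complex.I * w * ∫ t in Ioi (0 : ℝ), g t * Complex.exp (Complex.I * w * t)‖ := by
    simp
  have h5 : Complex.I * w * ∫ t in Ioi (0 : ℝ), g t * Complex.exp (Complex.I * w * t)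
      = -g 0 - ∫ t in Ioi (0 : ℝ), deriv g t * Complex.exp (Complex.I * w * t) := by
    simp only [Complex.ofReal_zero, mul_zero, Complex.exp_zero, mul_one] at key
    linear_combination key
  rw [h4, h5]
  refine (norm_sub_le _ _).trans ?_
  rw [norm_neg]
  gcongr
  refine (norm_integral_le_integral_norm _).trans ?_
  have hdi : Integrable fun t => ‖deriv g t‖ :=
    (hdc.integrable_of_hasCompactSupport hgc.deriv).norm
  refine le_trans ?_ (setIntegral_le_integral (s := Ioi (0 : ℝ)) hdi
    (Eventually.of_forall fun t => norm_nonneg _))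
  refine setIntegral_mono_on hi1.norm.integrableOn hdi.integrableOn measurableSet_Ioi
    fun t ht => ?_
  rw [norm_mul, Complex.norm_exp]
  refine mul_le_of_le_one_right (norm_nonneg _) (Real.exp_le_one_iff.2 ?_)
  have : (Complex.I * w * (t : ℂ)).re = -(w.im * t) := by simp
  rw [this]
  have := mul_nonneg hw (le_of_lt ht)
  linarith

/-- The Riemann–Lebesgue lemma, uniformly in a closed half-plane. -/
theorem fourierIntegral_small_at_infinity {a : ℝ} {h : ℝ → ℂ}
    (h2 : MemLp (expShift a h) 2 volume) (h0 : ∀ t < 0, h t = 0) {s : ℝ} (hs : a < s)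
    {ε : ℝ} (hε : 0 < ε) :
    ∃ R, ∀ z : ℂ, s ≤ z.im → R ≤ ‖z‖ → ‖fourierIntegralOn univ h z‖ ≤ ε := by
  set u := expShift s h with hu
  have hui : Integrable u := integrable_expShift h2 h0 hs
  have hu1 : MemLp u 1 volume := memLp_one_iff_integrable.2 hui
  have hfc : 0 < ‖fconst‖ := by
    rw [norm_pos_iff]; exact inv_ne_zero sqrt_two_pi_ne
  -- One η for the L¹ error of replacing u by a smooth g, one for the integral of g; multiplied by
  -- ‖fconst‖ they add up to ε.
  set η := ε / (2 * ‖fconst‖) with hη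
  have hηpos : 0 < η := by positivity
  obtain ⟨g, hgc, hg, hgu⟩ := hu1.exist_eLpNorm_sub_le (by norm_num) le_rfl hηpos
  have hg1 : ContDiff ℝ 1 g := hg.of_le (by exact_mod_cast le_top)
  have hgi : Integrable g := hg.continuous.integrable_of_hasCompactSupport hgc
  have hdiff : ∫ t, ‖u t - g t‖ ≤ η := by
    rw [eLpNorm_one_eq_lintegral_enorm] at hgu
    have := integral_norm_eq_lintegral_enorm (hui.sub hgi).1
    simp only [Pi.sub_apply] at this
    rw [this]
    exact ENNReal.toReal_le_of_le_ofReal hηpos.le hgu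
  set D := ‖g 0‖ + ∫ t, ‖deriv g t‖ with hD
  have hD0 : 0 ≤ D := add_nonneg (norm_nonneg _) (integral_nonneg fun t => norm_nonneg _)
  -- Subtracting is costs at most |s|, so |w| ≥ (D + 1)/η and D/|w| ≤ η; the extra 1 keeps the lower
  -- bound positive even if D = 0.
  refine ⟨|s| + (D + 1) / η, fun z hz hR => ?_⟩
  set w : ℂ := z - s * Complex.I with hw
  have hwim : 0 ≤ w.im := by simp [hw]; linarith
  have hwn : (D + 1) / η ≤ ‖w‖ := by
    have h1 : ‖z‖ - ‖(s : ℂ) * Complex.I‖ ≤ ‖w‖ := norm_sub_norm_le _ _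
    have h3 : ‖(s : ℂ) * Complex.I‖ = |s| := by simp
    rw [h3] at h1
    linarith
  have hwpos : 0 < ‖w‖ := lt_of_lt_of_le (by positivity) hwn
  have hzw : z = w + s * Complex.I := by rw [hw]; ring
  have hE : ∀ t ∈ Ioi (0 : ℝ), ‖Complex.exp (Complex.I * w * t)‖ ≤ 1 := by
    intro t ht
    rw [Complex.norm_exp]
    refine Real.exp_le_one_iff.2 ?_
    have h1 : (Complex.I * w * (t : ℂ)).re = -(w.im * t) := by simp
    rw [h1]
    have := mul_nonneg hwim (le_of_lt ht)
    linarith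
  have hF : fourierIntegralOn univ h z
      = fconst * ∫ t in Ioi (0 : ℝ), u t * Complex.exp (Complex.I * w * t) := by
    rw [hzw, ← fourierIntegralOn_expShift, fourierIntegralOn, setIntegral_univ]
    congr 1
    rw [← integral_indicator measurableSet_Ioi]
    refine integral_congr_ae ?_
    have : ∀ᵐ t : ℝ, t ≠ 0 := by simp [ae_iff, measure_singleton]
    filter_upwards [this] with t ht
    rcases lt_or_gt_of_ne ht with ht | ht
    · rw [indicator_of_notMem (by simpa using ht.le)]
      simp [expShift, h0 t ht]
    · rw [indicator_of_mem (mem_Ioi.2 ht)]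
  have hEc : Continuous fun t : ℝ => Complex.exp (Complex.I * w * t) := by fun_prop
  have hmul : ∀ v : ℝ → ℂ, Integrable v →
      IntegrableOn (fun t : ℝ => v t * Complex.exp (Complex.I * w * t)) (Ioi 0) := by
    intro v hv
    refine Integrable.mono hv.integrableOn (hv.1.restrict.mul hEc.aestronglyMeasurable) ?_
    refine (ae_restrict_iff' measurableSet_Ioi).2 (Eventually.of_forall fun t ht => ?_)
    rw [norm_mul]
    exact mul_le_of_le_one_right (norm_nonneg _) (hE t ht)
  have hsplit : ∫ t in Ioi (0 : ℝ), u t * Complex.exp (Complex.I * w * t)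
      = (∫ t in Ioi (0 : ℝ), (u t - g t) * Complex.exp (Complex.I * w * t))
        + ∫ t in Ioi (0 : ℝ), g t * Complex.exp (Complex.I * w * t) := by
    have := integral_add (hmul _ (hui.sub hgi)) (hmul g hgi)
    simp only [Pi.sub_apply] at this
    rw [← this]
    congr 1
    ext t
    ring
  have hA : ‖∫ t in Ioi (0 : ℝ), (u t - g t) * Complex.exp (Complex.I * w * t)‖ ≤ η := by
    refine (norm_integral_le_integral_norm _).trans (le_trans ?_ hdiff)
    have hi : Integrable fun t => ‖u t - g t‖ := (hui.sub hgi).norm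
    refine le_trans ?_ (setIntegral_le_integral (s := Ioi (0 : ℝ)) hi
      (Eventually.of_forall fun t => norm_nonneg _))
    refine setIntegral_mono_on (hmul _ (hui.sub hgi)).norm hi.integrableOn measurableSet_Ioi
      fun t ht => ?_
    rw [norm_mul]
    exact mul_le_of_le_one_right (norm_nonneg _) (hE t ht)
  have hB : ‖∫ t in Ioi (0 : ℝ), g t * Complex.exp (Complex.I * w * t)‖ ≤ η := by
    have h1 := integral_Ioi_contDiff_mul_cexp_le hg1 hgc hwim
    rw [div_le_iff₀ hηpos] at hwn
    have h3 : ‖w‖ * ‖∫ t in Ioi (0 : ℝ), g t * Complex.exp (Complex.I * w * t)‖ ≤ ‖w‖ * η :=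
      h1.trans (by rw [← hD]; linarith)
    exact le_of_mul_le_mul_left h3 hwpos
  rw [hF, norm_mul, hsplit]
  calc ‖fconst‖ * ‖_ + _‖ ≤ ‖fconst‖ * (η + η) := by
        gcongr
        exact (norm_add_le _ _).trans (add_le_add hA hB)
    _ = ε := by rw [hη]; field_simp; ring


/-! ### Bounded Hölder functions and their algebra -/

/-- Bounded Hölder continuous functions on the real line. -/
def BddHolder (F : ℝ → ℂ) : Prop :=
  (∃ B, ∀ x, ‖F x‖ ≤ B) ∧
    ∃ C r : ℝ, 0 ≤ C ∧ 0 < r ∧ r ≤ 1 ∧ ∀ x y, ‖F x - F y‖ ≤ C * |x - y| ^ r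

/-- For |x - y| ≤ 1 a smaller exponent gives a larger power, and for |x - y| ≥ 1 the bound 2B
suffices. Functions with different exponents can thus be brought to a common one. -/
theorem BddHolder.exists_smaller {F : ℝ → ℂ} (hF : BddHolder F) :
    ∃ r₀ : ℝ, 0 < r₀ ∧ r₀ ≤ 1 ∧ ∀ r, 0 < r → r ≤ r₀ →
      ∃ C, 0 ≤ C ∧ ∀ x y, ‖F x - F y‖ ≤ C * |x - y| ^ r := by
  obtain ⟨⟨B, hB⟩, C, r₀, hC, hr₀, hr₁, h⟩ := hF
  have hB0 : 0 ≤ B := (norm_nonneg _).trans (hB 0)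
  refine ⟨r₀, hr₀, hr₁, fun r hr hrr => ⟨C + 2 * B, by positivity, fun x y => ?_⟩⟩
  have hp : 0 ≤ |x - y| ^ r := by positivity
  rcases le_total |x - y| 1 with h1 | h1
  · have h2 : |x - y| ^ r₀ ≤ |x - y| ^ r := by
      rcases (abs_nonneg (x - y)).eq_or_lt with h0 | h0
      · rw [← h0, Real.zero_rpow hr.ne', Real.zero_rpow hr₀.ne']
      · exact Real.rpow_le_rpow_of_exponent_ge h0 h1 hrr
    nlinarith [h x y, mul_le_mul_of_nonneg_left h2 hC]
  · have h2 : 1 ≤ |x - y| ^ r := Real.one_le_rpow h1 hr.le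
    have h3 : ‖F x - F y‖ ≤ 2 * B := (norm_sub_le _ _).trans (by linarith [hB x, hB y])
    nlinarith

/-- Functions whose increments are controlled by those of bounded Hölder functions. -/
theorem BddHolder.of_le {F F' G : ℝ → ℂ} (hF : BddHolder F) (hF' : BddHolder F')
    {B A A' D : ℝ} (hB : ∀ x, ‖G x‖ ≤ B) (hA : 0 ≤ A) (hA' : 0 ≤ A') (hD : 0 ≤ D)
    (h : ∀ x y, ‖G x - G y‖ ≤ A * ‖F x - F y‖ + A' * ‖F' x - F' y‖ + D * |x - y|) :
    BddHolder G := by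
  have hB0 : 0 ≤ B := (norm_nonneg _).trans (hB 0)
  obtain ⟨r₁, h1, h1', H1⟩ := hF.exists_smaller
  obtain ⟨r₂, h2, h2', H2⟩ := hF'.exists_smaller
  have hr : 0 < min r₁ r₂ := lt_min h1 h2
  have hr' : min r₁ r₂ ≤ 1 := (min_le_left _ _).trans h1'
  obtain ⟨C₁, c1, e1⟩ := H1 _ hr (min_le_left _ _)
  obtain ⟨C₂, c2, e2⟩ := H2 _ hr (min_le_right _ _)
  -- The summand 2B serves |x - y| ≥ 1, where the linear term D|x - y| is no longer controlled by a
  -- power with exponent at most 1.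
  refine ⟨⟨B, hB⟩, A * C₁ + A' * C₂ + D + 2 * B, _, by positivity, hr, hr', fun x y => ?_⟩
  have hp : 0 ≤ |x - y| ^ min r₁ r₂ := by positivity
  have m1 : A * ‖F x - F y‖ ≤ A * (C₁ * |x - y| ^ min r₁ r₂) := by gcongr; exact e1 x y
  have m2 : A' * ‖F' x - F' y‖ ≤ A' * (C₂ * |x - y| ^ min r₁ r₂) := by gcongr; exact e2 x y
  have hBp : 0 ≤ 2 * B * |x - y| ^ min r₁ r₂ := by positivity
  rcases le_total |x - y| 1 with h3 | h3
  · have h4 : |x - y| ≤ |x - y| ^ min r₁ r₂ := by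
      rcases (abs_nonneg (x - y)).eq_or_lt with h0 | h0
      · rw [← h0, Real.zero_rpow hr.ne']
      · calc |x - y| = |x - y| ^ (1 : ℝ) := (Real.rpow_one _).symm
          _ ≤ _ := Real.rpow_le_rpow_of_exponent_ge h0 h3 hr'
    have m3 := mul_le_mul_of_nonneg_left h4 hD
    linarith [h x y]
  · have h4 : 1 ≤ |x - y| ^ min r₁ r₂ := Real.one_le_rpow h3 hr.le
    have h5 : ‖G x - G y‖ ≤ 2 * B := (norm_sub_le _ _).trans (by linarith [hB x, hB y])
    have h6 : 2 * B * 1 ≤ 2 * B * |x - y| ^ min r₁ r₂ := by gcongr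
    have h7 : 0 ≤ (A * C₁ + A' * C₂ + D) * |x - y| ^ min r₁ r₂ := by positivity
    linarith

theorem bddHolder_const (c : ℂ) : BddHolder fun _ => c :=
  ⟨⟨‖c‖, fun _ => le_rfl⟩, 0, 1, le_rfl, one_pos, le_rfl, fun x y => by simp⟩

theorem bddHolder_of_lipschitz {F : ℝ → ℂ} {B D : ℝ} (hB : ∀ x, ‖F x‖ ≤ B) (hD : 0 ≤ D)
    (h : ∀ x y, ‖F x - F y‖ ≤ D * |x - y|) : BddHolder F :=
  (bddHolder_const 0).of_le (bddHolder_const 0) hB le_rfl le_rfl hD (by simpa using h)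

theorem BddHolder.add {F G : ℝ → ℂ} (hF : BddHolder F) (hG : BddHolder G) :
    BddHolder (F + G) := by
  obtain ⟨B, hB⟩ := hF.1
  obtain ⟨B', hB'⟩ := hG.1
  refine hF.of_le hG (B := B + B') (A := 1) (A' := 1) (D := 0)
    (fun x => (norm_add_le _ _).trans (add_le_add (hB x) (hB' x)))
    zero_le_one zero_le_one le_rfl fun x y => ?_
  simp only [Pi.add_apply, one_mul, zero_mul, add_zero]
  rw [add_sub_add_comm]
  exact norm_add_le _ _

theorem BddHolder.mul {F G : ℝ → ℂ} (hF : BddHolder F) (hG : BddHolder G) :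
    BddHolder (F * G) := by
  obtain ⟨B, hB⟩ := hF.1
  obtain ⟨B', hB'⟩ := hG.1
  have hB0 : 0 ≤ B := (norm_nonneg _).trans (hB 0)
  have hB0' : 0 ≤ B' := (norm_nonneg _).trans (hB' 0)
  refine hF.of_le hG (B := B * B') (A := B') (A' := B) (D := 0)
    (fun x => (norm_mul_le _ _).trans (mul_le_mul (hB x) (hB' x) (norm_nonneg _) hB0))
    hB0' hB0 le_rfl fun x y => ?_
  have : (F * G) x - (F * G) y = G x * (F x - F y) + F y * (G x - G y) := by
    simp only [Pi.mul_apply]; ring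
  rw [this, zero_mul, add_zero]
  refine (norm_add_le _ _).trans ?_
  rw [norm_mul, norm_mul]
  gcongr
  · exact hB' x
  · exact hB y

theorem BddHolder.neg {F : ℝ → ℂ} (hF : BddHolder F) : BddHolder (-F) := by
  have := (bddHolder_const (-1)).mul hF
  convert this using 1
  ext x
  simp

theorem BddHolder.sub {F G : ℝ → ℂ} (hF : BddHolder F) (hG : BddHolder G) :
    BddHolder (F - G) := by
  rw [sub_eq_add_neg]; exact hF.add hG.neg

theorem norm_exp_sub_one_le {w : ℂ} {B : ℝ} (hw : ‖w‖ ≤ B) :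
    ‖Complex.exp w - 1‖ ≤ Real.exp B * ‖w‖ := by
  have hconv : Convex ℝ (Metric.closedBall (0 : ℂ) B) := convex_closedBall _ _
  have hB : 0 ≤ B := (norm_nonneg _).trans hw
  have := hconv.norm_image_sub_le_of_norm_hasDerivWithin_le (f := Complex.exp) (f' := Complex.exp)
    (C := Real.exp B) (x := 0) (y := w)
    (fun u _ => (Complex.hasDerivAt_exp u).hasDerivWithinAt)
    (fun u hu => by
      rw [Complex.norm_exp]
      exact Real.exp_le_exp.2 ((Complex.re_le_norm u).trans (by simpa using hu)))
    (by simpa using hB) (by simpa using hw)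
  simpa using this

theorem BddHolder.exp {F : ℝ → ℂ} (hF : BddHolder F) : BddHolder fun x => Complex.exp (F x) := by
  obtain ⟨B, hB⟩ := hF.1
  have hconv : Convex ℝ (Metric.closedBall (0 : ℂ) B) := convex_closedBall _ _
  refine hF.of_le hF (B := Real.exp B) (A := Real.exp B) (A' := 0) (D := 0)
    (fun x => by
      rw [Complex.norm_exp]
      exact Real.exp_le_exp.2 ((Complex.re_le_norm _).trans (hB x)))
    (Real.exp_pos _).le le_rfl le_rfl fun x y => ?_
  have := hconv.norm_image_sub_le_of_norm_hasDerivWithin_le (f := Complex.exp) (f' := Complex.exp)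
    (C := Real.exp B) (x := F y) (y := F x)
    (fun u _ => (Complex.hasDerivAt_exp u).hasDerivWithinAt)
    (fun u hu => by
      rw [Complex.norm_exp]
      exact Real.exp_le_exp.2 ((Complex.re_le_norm u).trans (by simpa using hu)))
    (by simpa using hB y) (by simpa using hB x)
  simpa using this

/-- The remainder e^w - 1 - w is at most |w|² ≤ |w|/2 and is absorbed on the left. -/
theorem half_norm_le_norm_exp_sub_one {w : ℂ} (hw : ‖w‖ ≤ 1 / 2) :
    ‖w‖ ≤ 2 * ‖Complex.exp w - 1‖ := by
  have h1 := Complex.norm_exp_sub_one_sub_id_le (x := w) (by linarith)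
  have h2 : ‖w‖ ≤ ‖Complex.exp w - 1‖ + ‖Complex.exp w - 1 - w‖ := by
    have := norm_sub_le (Complex.exp w - 1) (Complex.exp w - 1 - w)
    rwa [sub_sub_cancel] at this
  nlinarith [norm_nonneg w]

/-- A bounded uniformly continuous logarithm of a bounded Hölder function is Hölder. -/
theorem BddHolder.of_exp {L : ℝ → ℂ} (hK : BddHolder fun x => Complex.exp (L x)) {B : ℝ}
    (hB : ∀ x, ‖L x‖ ≤ B) (hL : UniformContinuous L) : BddHolder L := by
  have hB0 : 0 ≤ B := (norm_nonneg _).trans (hB 0)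
  obtain ⟨δ, hδ, h⟩ := Metric.uniformContinuous_iff.1 hL (1 / 2) (by norm_num)
  refine hK.of_le hK (B := B) (A := 2 * Real.exp B) (A' := 0) (D := 2 * B / δ) hB
    (by positivity) le_rfl (by positivity) fun x y => ?_
  rw [zero_mul, add_zero]
  rcases lt_or_ge |x - y| δ with h1 | h1
  · have h2 : ‖L x - L y‖ ≤ 1 / 2 := by
      have := h (a := x) (b := y) (by rwa [Real.dist_eq])
      rw [dist_eq_norm] at this
      exact this.le
    have h3 := half_norm_le_norm_exp_sub_one h2
    have h4 : Complex.exp (L x - L y) - 1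
        = Complex.exp (-L y) * (Complex.exp (L x) - Complex.exp (L y)) := by
      rw [mul_sub, ← Complex.exp_add, ← Complex.exp_add, neg_add_cancel, Complex.exp_zero]
      congr 2
      ring
    rw [h4, norm_mul] at h3
    have h5 : ‖Complex.exp (-L y)‖ ≤ Real.exp B := by
      rw [Complex.norm_exp]
      refine Real.exp_le_exp.2 ((Complex.re_le_norm _).trans ?_)
      rw [norm_neg]; exact hB y
    have h6 : ‖Complex.exp (-L y)‖ * ‖Complex.exp (L x) - Complex.exp (L y)‖
        ≤ Real.exp B * ‖Complex.exp (L x) - Complex.exp (L y)‖ := by gcongr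
    have h7 : 0 ≤ 2 * B / δ * |x - y| := by positivity
    linarith
  -- At distance at least δ the exponentials may be close while the logarithms differ by a multiple
  -- of 2πi; the bound on L is used instead, at the price of the Lipschitz constant 2B/δ.
  · have h2 : ‖L x - L y‖ ≤ 2 * B := (norm_sub_le _ _).trans (by linarith [hB x, hB y])
    have h3 : 2 * B ≤ 2 * B / δ * |x - y| := by
      rw [div_mul_eq_mul_div, le_div_iff₀ hδ]
      gcongr
    have h4 : 0 ≤ 2 * Real.exp B * ‖Complex.exp (L x) - Complex.exp (L y)‖ := by positivity
    linarith

theorem BddHolder.continuous {F : ℝ → ℂ} (hF : BddHolder F) : Continuous F := by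
  obtain ⟨-, C, r, hC, hr, -, h⟩ := hF
  rw [continuous_iff_continuousAt]
  intro x
  rw [ContinuousAt, tendsto_iff_norm_sub_tendsto_zero]
  have h1 : Tendsto (fun y => C * |y - x| ^ r) (𝓝 x) (𝓝 0) := by
    have hc : Continuous fun y : ℝ => C * |y - x| ^ r :=
      continuous_const.mul ((by fun_prop : Continuous fun y : ℝ => |y - x|).rpow_const
        fun _ => Or.inr hr.le)
    have := hc.tendsto x
    simpa [Real.zero_rpow hr.ne'] using this
  exact squeeze_zero (fun y => norm_nonneg _) (fun y => h y x) h1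

theorem BddHolder.imageClass {F : ℝ → ℂ} (hF : BddHolder F) (h2 : MemLp F 2 volume) :
    ImageClass F := by
  obtain ⟨-, C, r, hC, hr, hr1, h⟩ := hF
  refine ⟨h2, C.toNNReal, r.toNNReal, by simpa using hr, by simpa using hr1, fun x y => ?_⟩
  have h1 := h x y
  have h3 : edist x y = ENNReal.ofReal |x - y| := by rw [edist_dist, Real.dist_eq]
  rw [edist_dist, dist_eq_norm, h3]
  refine (ENNReal.ofReal_le_ofReal h1).trans ?_
  rw [ENNReal.ofReal_mul hC, Real.coe_toNNReal r hr.le,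
    ENNReal.ofReal_rpow_of_nonneg (abs_nonneg _) hr.le]
  rfl

theorem ImageClass.exists_holder {F : ℝ → ℂ} (hF : ImageClass F) :
    ∃ C r : ℝ, 0 ≤ C ∧ 0 < r ∧ r ≤ 1 ∧ ∀ x y, ‖F x - F y‖ ≤ C * |x - y| ^ r := by
  obtain ⟨-, C, r, hr, hr1, h⟩ := hF
  refine ⟨C, r, C.2, hr, hr1, fun x y => ?_⟩
  have h1 := h.dist_le x y
  rwa [dist_eq_norm, Real.dist_eq] at h1

/-- Square integrable Hölder continuous functions vanish at infinity. -/
theorem ImageClass.small_at_infinity {F : ℝ → ℂ} (hF : ImageClass F) {ε : ℝ} (hε : 0 < ε) :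
    ∃ R, ∀ x : ℝ, R ≤ |x| → ‖F x‖ ≤ ε := by
  obtain ⟨C, r, hC, hr, hr1, h⟩ := hF.exists_holder
  have hc : Continuous fun y : ℝ => C * |y| ^ r :=
    continuous_const.mul ((by fun_prop : Continuous fun y : ℝ => |y|).rpow_const
      fun _ => Or.inr hr.le)
  have h0 : Tendsto (fun y : ℝ => C * |y| ^ r) (𝓝 0) (𝓝 0) := by
    have := hc.tendsto 0
    simpa [Real.zero_rpow hr.ne'] using this
  obtain ⟨δ', hδ', hδ⟩ := Metric.eventually_nhds_iff.1 (h0.eventually (gt_mem_nhds (half_pos hε)))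
  set δ := min (δ' / 2) 1 with hδdef
  have hδ0 : 0 < δ := lt_min (half_pos hδ') one_pos
  have hδ1 : δ ≤ 1 := min_le_right _ _
  have hδδ' : δ < δ' := (min_le_left _ _).trans_lt (half_lt_self hδ')
  have hint : Integrable fun x => ‖F x‖ ^ 2 := hF.1.norm.integrable_sq
  have hsets : Tendsto (fun n : ℕ => ∫ x in {x : ℝ | (n : ℝ) ≤ |x|}, ‖F x‖ ^ 2) atTop (𝓝 0) := by
    have hm : ∀ n : ℕ, MeasurableSet {x : ℝ | (n : ℝ) ≤ |x|} := fun n =>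
      measurableSet_le measurable_const measurable_norm
    have := tendsto_setIntegral_of_antitone (μ := volume) (f := fun x => ‖F x‖ ^ 2) hm
      (fun m n hmn x (hx : (n : ℝ) ≤ |x|) =>
        show (m : ℝ) ≤ |x| from (Nat.cast_le.2 hmn).trans hx) ⟨0, hint.integrableOn⟩
    have he : (⋂ n : ℕ, {x : ℝ | (n : ℝ) ≤ |x|}) = ∅ := by
      ext x
      simp only [mem_iInter, mem_ofPred_eq, mem_empty_iff_false, iff_false, not_forall, not_le]
      exact exists_nat_gt |x|
    rwa [he, Measure.restrict_empty, integral_zero_measure] at this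
  -- If |F(x)| > ε, Hölder continuity keeps |F| ≥ ε/2 within distance δ of x, an interval on which
  -- |F|² has integral at least 2δ(ε/2)². The tail beyond n is made smaller than that.
  obtain ⟨n, hn⟩ := (hsets.eventually (gt_mem_nhds
    (by positivity : (0 : ℝ) < 2 * δ * (ε / 2) ^ 2))).exists
  refine ⟨n + 1, fun x hx => ?_⟩
  by_contra hcon
  rw [not_le] at hcon
  have hlow : ∀ y ∈ Icc (x - δ) (x + δ), ε / 2 ≤ ‖F y‖ := by
    intro y hy
    have h1 : |y - x| ≤ δ := abs_le.2 ⟨by linarith [hy.1], by linarith [hy.2]⟩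
    have h2 := hδ (y := y - x) (by rw [dist_zero_right]; exact h1.trans_lt hδδ')
    have h3 := h y x
    have h4 := norm_sub_norm_le (F x) (F y)
    rw [norm_sub_rev] at h4
    linarith
  have hsub : Icc (x - δ) (x + δ) ⊆ {x : ℝ | (n : ℝ) ≤ |x|} := by
    intro y hy
    have h1 : |y - x| ≤ δ := abs_le.2 ⟨by linarith [hy.1], by linarith [hy.2]⟩
    have h2 := abs_sub_abs_le_abs_sub x y
    rw [abs_sub_comm] at h2
    simp only [mem_ofPred_eq]
    linarith
  have h5 : ∫ y in Icc (x - δ) (x + δ), (ε / 2) ^ 2 ≤ ∫ y in Icc (x - δ) (x + δ), ‖F y‖ ^ 2 := by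
    refine setIntegral_mono_on (by simp) hint.integrableOn measurableSet_Icc fun y hy => ?_
    have := hlow y hy
    gcongr
  have h6 : ∫ y in Icc (x - δ) (x + δ), ‖F y‖ ^ 2
      ≤ ∫ x in {x : ℝ | (n : ℝ) ≤ |x|}, ‖F x‖ ^ 2 :=
    setIntegral_mono_set hint.integrableOn (Eventually.of_forall fun y => by positivity)
      (LE.le.eventuallyLE hsub)
  rw [setIntegral_const, measureReal_def, Real.volume_Icc,
    ENNReal.toReal_ofReal (by linarith), smul_eq_mul] at h5
  have h7 : x + δ - (x - δ) = 2 * δ := by ring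
  rw [h7] at h5
  linarith

theorem ImageClass.continuous {F : ℝ → ℂ} (hF : ImageClass F) : Continuous F := by
  obtain ⟨-, C, r, hr, -, h⟩ := hF
  exact h.continuous hr

theorem ImageClass.bddHolder {F : ℝ → ℂ} (hF : ImageClass F) : BddHolder F := by
  obtain ⟨R, hR⟩ := hF.small_at_infinity one_pos
  obtain ⟨B, hB⟩ := (isCompact_Icc (a := -|R|) (b := |R|)).exists_bound_of_continuousOn
    hF.continuous.continuousOn
  refine ⟨⟨max B 1, fun x => ?_⟩, hF.exists_holder⟩
  rcases le_total R |x| with h | h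
  · exact (hR x h).trans (le_max_right _ _)
  · exact (hB x (abs_le.1 (h.trans (le_abs_self R)))).trans (le_max_left _ _)


/-! ### Poisson's formula and boundary values -/

/-- The half-lines t < 0 and t > 0 contribute 1/(y + iv) and 1/(y - iv). Their sum is, up to
normalisation, the Poisson kernel. -/
theorem integral_exp_neg_abs_mul_cexp {y : ℝ} (hy : 0 < y) (v : ℝ) :
    Integrable (fun t : ℝ => (Real.exp (-(y * |t|)) : ℂ) * Complex.exp (Complex.I * v * t)) ∧
    ∫ t : ℝ, (Real.exp (-(y * |t|)) : ℂ) * Complex.exp (Complex.I * v * t)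
      = ((2 * y / (y ^ 2 + v ^ 2) : ℝ) : ℂ) := by
  set α : ℂ := -y + Complex.I * v with hα
  set β : ℂ := y + Complex.I * v with hβ
  have hαre : α.re < 0 := by simp [hα, hy]
  have hβre : 0 < β.re := by simp [hβ, hy]
  have e1 : ∀ t ∈ Ioi (0 : ℝ), (Real.exp (-(y * |t|)) : ℂ) * Complex.exp (Complex.I * v * t)
      = Complex.exp (α * t) := fun t ht => by
    rw [abs_of_pos ht, Complex.ofReal_exp, ← Complex.exp_add, hα]
    congr 1; push_cast; ring
  have e2 : ∀ t ∈ Iic (0 : ℝ), (Real.exp (-(y * |t|)) : ℂ) * Complex.exp (Complex.I * v * t)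
      = Complex.exp (β * t) := fun t ht => by
    rw [abs_of_nonpos ht, Complex.ofReal_exp, ← Complex.exp_add, hβ]
    congr 1; push_cast; ring
  have i1 : IntegrableOn
      (fun t : ℝ => (Real.exp (-(y * |t|)) : ℂ) * Complex.exp (Complex.I * v * t)) (Ioi 0) :=
    (integrableOn_exp_mul_complex_Ioi hαre 0).congr_fun (fun t ht => (e1 t ht).symm)
      measurableSet_Ioi
  have i2 : IntegrableOn
      (fun t : ℝ => (Real.exp (-(y * |t|)) : ℂ) * Complex.exp (Complex.I * v * t)) (Iic 0) :=
    (integrableOn_exp_mul_complex_Iic hβre 0).congr_fun (fun t ht => (e2 t ht).symm)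
      measurableSet_Iic
  have hint : Integrable
      (fun t : ℝ => (Real.exp (-(y * |t|)) : ℂ) * Complex.exp (Complex.I * v * t)) := by
    rw [← integrableOn_univ, ← Iic_union_Ioi (a := (0 : ℝ))]
    exact i2.union i1
  refine ⟨hint, ?_⟩
  rw [← intervalIntegral.integral_Iic_add_Ioi i2 i1, setIntegral_congr_fun measurableSet_Ioi e1,
    setIntegral_congr_fun measurableSet_Iic e2, integral_exp_mul_complex_Ioi hαre,
    integral_exp_mul_complex_Iic hβre]
  have hα0 : α ≠ 0 := fun h => by simp [h] at hαre
  have hβ0 : β ≠ 0 := fun h => by simp [h] at hβre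
  have hprod : α * β = -((y ^ 2 + v ^ 2 : ℝ) : ℂ) := by
    rw [hα, hβ]; push_cast; linear_combination (v : ℂ) ^ 2 * Complex.I_sq
  have hd : ((y ^ 2 + v ^ 2 : ℝ) : ℂ) ≠ 0 := by
    have : 0 < y ^ 2 + v ^ 2 := by positivity
    exact_mod_cast this.ne'
  simp only [Complex.ofReal_zero, mul_zero, Complex.exp_zero]
  rw [Complex.ofReal_div, div_add_div _ _ hβ0 hα0, div_eq_div_iff (mul_ne_zero hβ0 hα0) hd,
    mul_comm β α, hprod, hα, hβ]
  push_cast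
  ring

theorem memLp_exp_neg_abs_mul_cexp {y : ℝ} (hy : 0 < y) (v : ℝ) :
    MemLp (fun t : ℝ => (Real.exp (-(y * |t|)) : ℂ) * Complex.exp (Complex.I * v * t)) 2
      volume := by
  have hm : Continuous
      fun t : ℝ => (Real.exp (-(y * |t|)) : ℂ) * Complex.exp (Complex.I * v * t) := by fun_prop
  rw [memLp_two_iff_integrable_sq_norm hm.aestronglyMeasurable]
  have h := (integral_exp_neg_abs_mul_cexp (y := 2 * y) (by linarith) 0).1.norm
  refine h.congr (Eventually.of_forall fun t => ?_)
  simp only [norm_mul, Complex.norm_real, Complex.norm_exp, Complex.norm_exp]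
  rw [Real.norm_of_nonneg (Real.exp_pos _).le, Real.norm_of_nonneg (Real.exp_pos _).le]
  simp only [Complex.ofReal_zero, mul_zero, zero_mul, Complex.zero_re, Real.exp_zero, mul_one]
  have : (Complex.I * (v : ℂ) * (t : ℂ)).re = 0 := by simp
  rw [this, Real.exp_zero, mul_one, ← Real.exp_nat_mul]
  congr 1
  push_cast
  ring

theorem norm_fconst_sq : fconst * fconst = ((2 * Real.pi : ℝ) : ℂ)⁻¹ := by
  rw [← mul_inv, ← Complex.ofReal_mul, Real.mul_self_sqrt two_pi_pos.le]

/-- Poisson's formula for the Fourier integral of a function on the positive half-line. -/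
theorem fourierIntegral_eq_poisson {a : ℝ} {h Φ : ℝ → ℂ} (h0 : ∀ t < 0, h t = 0)
    (hΦ : IsFourierL2 (expShift a h) Φ) {y : ℝ} (hy : 0 < y) (x : ℝ) :
    onLine (a + y) (fourierIntegralOn univ h) x
      = ((Real.pi : ℝ) : ℂ)⁻¹ * ∫ v : ℝ, ((1 + v ^ 2 : ℝ) : ℂ)⁻¹ * Φ (x + y * v) := by
  -- As h vanishes for t < 0, the weight e^{-yt} may be replaced by e^{-y|t|}, which lies in L¹ and
  -- L². With the phase e^{-ixt} its transform is the Poisson kernel centred at x, and Parseval's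
  -- identity together with u = x + yv gives the formula.
  set g : ℝ → ℂ := fun t => (Real.exp (-(y * |t|)) : ℂ) * Complex.exp (Complex.I * (-x : ℝ) * t)
    with hg
  have hgi : Integrable g := (integral_exp_neg_abs_mul_cexp hy (-x)).1
  have hgF := isFourierL2_integral hgi (memLp_exp_neg_abs_mul_cexp hy (-x))
  have hG : ∀ u : ℝ, fourierIntegralOn univ g u
      = fconst * ((2 * y / (y ^ 2 + (u - x) ^ 2) : ℝ) : ℂ) := by
    intro u
    rw [fourierIntegralOn, setIntegral_univ, ← (integral_exp_neg_abs_mul_cexp hy (u - x)).2]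
    congr 1
    refine integral_congr_ae (Eventually.of_forall fun t => ?_)
    simp only [hg]
    rw [mul_assoc, ← Complex.exp_add]
    congr 2
    push_cast
    ring
  have hpars := hΦ.integral_conj_mul hgF
  have hlhs : onLine (a + y) (fourierIntegralOn univ h) x
      = fconst * ∫ t, expShift a h t * starRingEnd ℂ (g t) := by
    rw [onLine, ← fourierIntegralOn_expShift, fourierIntegralOn, setIntegral_univ]
    congr 1
    refine integral_congr_ae (Eventually.of_forall fun t => ?_)
    simp only
    rcases lt_or_ge t 0 with ht | ht
    · simp [expShift, h0 t ht]
    · have h1 : expShift (a + y) h t = (Real.exp (-(y * |t|)) : ℂ) * expShift a h t := by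
        rw [add_comm, ← expShift_expShift, abs_of_nonneg ht]
        rfl
      rw [h1, hg, map_mul, Complex.conj_ofReal, ← Complex.exp_conj]
      simp only [map_mul, Complex.conj_I, Complex.conj_ofReal]
      have h2 : -Complex.I * ((-x : ℝ) : ℂ) * t = Complex.I * x * t := by push_cast; ring
      rw [h2]
      ring
  rw [hlhs, hpars]
  have hcov := Measure.integral_comp_mul_left
    (fun w : ℝ => Φ (x + w) * (fconst * ((2 * y / (y ^ 2 + w ^ 2) : ℝ) : ℂ))) y
  have hsub : ∫ u, Φ u * starRingEnd ℂ (fourierIntegralOn univ g u)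
      = ∫ w : ℝ, Φ (x + w) * (fconst * ((2 * y / (y ^ 2 + w ^ 2) : ℝ) : ℂ)) := by
    rw [← integral_add_left_eq_self
      (fun u : ℝ => Φ u * starRingEnd ℂ (fourierIntegralOn univ g u)) x]
    refine integral_congr_ae (Eventually.of_forall fun w => ?_)
    simp only
    rw [hG]
    simp only [map_mul, Complex.conj_ofReal, map_inv₀, fconst]
    congr 5
    ring
  have hcov' : ∫ w : ℝ, Φ (x + w) * (fconst * ((2 * y / (y ^ 2 + w ^ 2) : ℝ) : ℂ))
      = (y : ℂ) * ∫ v : ℝ, Φ (x + y * v) *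
        (fconst * ((2 * y / (y ^ 2 + (y * v) ^ 2) : ℝ) : ℂ)) := by
    rw [hcov, abs_of_pos (inv_pos.2 hy), Complex.real_smul, ← mul_assoc, ← Complex.ofReal_mul,
      mul_inv_cancel₀ hy.ne', Complex.ofReal_one, one_mul]
  rw [hsub, hcov', ← mul_assoc, ← integral_const_mul, ← integral_const_mul]
  refine integral_congr_ae (Eventually.of_forall fun v => ?_)
  simp only
  have h1 : (fconst * (y : ℂ)) * (Φ (x + y * v) *
      (fconst * ((2 * y / (y ^ 2 + (y * v) ^ 2) : ℝ) : ℂ)))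
      = (fconst * fconst) * ((y * (2 * y / (y ^ 2 + (y * v) ^ 2)) : ℝ) : ℂ) * Φ (x + y * v) := by
    push_cast; ring
  rw [h1, norm_fconst_sq, ← mul_assoc, ← Complex.ofReal_inv, ← Complex.ofReal_inv,
    ← Complex.ofReal_inv, ← Complex.ofReal_mul, ← Complex.ofReal_mul]
  congr 2
  have := Real.pi_pos.ne'
  have h3 : (1 + v ^ 2 : ℝ) ≠ 0 := by positivity
  have h4 : y ^ 2 + (y * v) ^ 2 = y ^ 2 * (1 + v ^ 2) := by ring
  rw [h4]
  field_simp

theorem integrable_poisson_integrand {Φ : ℝ → ℂ} (hΦ : Continuous Φ) {B : ℝ}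
    (hB : ∀ x, ‖Φ x‖ ≤ B) (x y : ℝ) :
    Integrable fun v : ℝ => ((1 + v ^ 2 : ℝ) : ℂ)⁻¹ * Φ (x + y * v) := by
  have h1 : Integrable fun v : ℝ => ((1 + v ^ 2 : ℝ) : ℂ)⁻¹ := by
    have := integrable_inv_one_add_sq.ofReal (𝕜 := ℂ)
    simpa using this
  refine h1.mul_bdd (c := B) ?_ (Eventually.of_forall fun v => hB _)
  exact (hΦ.comp (by fun_prop : Continuous fun v : ℝ => x + y * v)).aestronglyMeasurable

/-- The Poisson kernel is positive of total mass 1. Unlike `exists_norm_fourierIntegral_le`, the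
bound does not depend on the distance to the edge. -/
theorem norm_fourierIntegral_le_of_boundary {a : ℝ} {h Φ : ℝ → ℂ} (h0 : ∀ t < 0, h t = 0)
    (hΦ : IsFourierL2 (expShift a h) Φ) {B : ℝ}
    (hB : ∀ x, ‖Φ x‖ ≤ B) {z : ℂ} (hz : a < z.im) : ‖fourierIntegralOn univ h z‖ ≤ B := by
  have h1 := fourierIntegral_eq_poisson h0 hΦ (sub_pos.2 hz) z.re
  have hB0 : 0 ≤ B := (norm_nonneg _).trans (hB 0)
  have h2 : onLine (a + (z.im - a)) (fourierIntegralOn univ h) z.re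
      = fourierIntegralOn univ h z := by
    rw [onLine, add_sub_cancel, Complex.re_add_im]
  rw [← h2, h1, norm_mul, norm_inv, Complex.norm_real, Real.norm_of_nonneg Real.pi_pos.le]
  have h3 : ‖∫ v : ℝ, ((1 + v ^ 2 : ℝ) : ℂ)⁻¹ * Φ (z.re + (z.im - a) * v)‖
      ≤ ∫ v : ℝ, (1 + v ^ 2)⁻¹ * B := by
    refine norm_integral_le_of_norm_le (integrable_inv_one_add_sq.mul_const B)
      (Eventually.of_forall fun v => ?_)
    have : (0 : ℝ) ≤ 1 + v ^ 2 := by positivity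
    rw [norm_mul, norm_inv, Complex.norm_real, Real.norm_of_nonneg this]
    gcongr
    exact hB _
  rw [integral_mul_const, integral_univ_inv_one_add_sq] at h3
  rw [inv_mul_le_iff₀ Real.pi_pos]
  exact h3

/-- The Fourier integral converges uniformly to its Hölder continuous boundary values. -/
theorem fourierIntegral_tendsto_boundary {a : ℝ} {h Φ : ℝ → ℂ} (h0 : ∀ t < 0, h t = 0)
    (hΦ : IsFourierL2 (expShift a h) Φ) (hH : BddHolder Φ) {ε : ℝ} (hε : 0 < ε) :
    ∃ δ > 0, ∀ s, a < s → s < a + δ → ∀ x,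
      ‖onLine s (fourierIntegralOn univ h) x - Φ x‖ ≤ ε := by
  obtain ⟨B, hB⟩ := hH.1
  have hB0 : 0 ≤ B := (norm_nonneg _).trans (hB 0)
  have hcont := hH.continuous
  obtain ⟨-, C, r, hC, hr, -, hCr⟩ := hH
  -- A modulus independent of x. The minimum with 2B is essential: |v|^r / (1 + v²) is not
  -- integrable when r = 1, whereas 2B / (1 + v²) dominates for every y.
  set ω : ℝ → ℝ := fun y => ∫ v : ℝ, (1 + v ^ 2)⁻¹ * min (C * |y * v| ^ r) (2 * B) with hω
  have hbase : ∀ y v : ℝ, 0 ≤ min (C * |y * v| ^ r) (2 * B) := fun y v =>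
    le_min (by positivity) (by positivity)
  have hpos : ∀ v : ℝ, (0 : ℝ) ≤ (1 + v ^ 2)⁻¹ := fun v => by positivity
  have hcy : ∀ y : ℝ, Continuous fun v : ℝ => (1 + v ^ 2)⁻¹ * min (C * |y * v| ^ r) (2 * B) := by
    intro y
    have h1 : Continuous fun v : ℝ => |y * v| ^ r :=
      (by fun_prop : Continuous fun v : ℝ => |y * v|).rpow_const fun _ => Or.inr hr.le
    have h2 : Continuous fun v : ℝ => (1 + v ^ 2)⁻¹ :=
      Continuous.inv₀ (by fun_prop) fun v => by positivity
    exact h2.mul ((continuous_const.mul h1).min continuous_const)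
  have hbd : ∀ y v : ℝ, ‖(1 + v ^ 2)⁻¹ * min (C * |y * v| ^ r) (2 * B)‖ ≤ (1 + v ^ 2)⁻¹ * (2 * B) := by
    intro y v
    rw [Real.norm_of_nonneg (mul_nonneg (hpos v) (hbase y v))]
    exact mul_le_mul_of_nonneg_left (min_le_right _ _) (hpos v)
  have hlim : Tendsto ω (𝓝 0) (𝓝 0) := by
    have h1 : Tendsto ω (𝓝 0) (𝓝 (∫ v : ℝ, (0 : ℝ))) := by
      refine tendsto_integral_filter_of_dominated_convergence
        (fun v : ℝ => (1 + v ^ 2)⁻¹ * (2 * B))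
        (Eventually.of_forall fun y => (hcy y).aestronglyMeasurable)
        (Eventually.of_forall fun y => Eventually.of_forall (hbd y))
        (integrable_inv_one_add_sq.mul_const _) (Eventually.of_forall fun v => ?_)
      have h2 : Continuous fun y : ℝ => |y * v| ^ r :=
        (by fun_prop : Continuous fun y : ℝ => |y * v|).rpow_const fun _ => Or.inr hr.le
      have h3 : Continuous fun y : ℝ => (1 + v ^ 2)⁻¹ * min (C * |y * v| ^ r) (2 * B) :=
        continuous_const.mul ((continuous_const.mul h2).min continuous_const)
      have h4 := h3.tendsto 0
      simpa [Real.zero_rpow hr.ne', hB0] using h4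
    simpa using h1
  obtain ⟨δ, hδ, hω'⟩ := Metric.eventually_nhds_iff.1
    (hlim.eventually (gt_mem_nhds (mul_pos Real.pi_pos hε)))
  refine ⟨δ, hδ, fun s has hs x => ?_⟩
  have hy : 0 < s - a := sub_pos.2 has
  have h1 := fourierIntegral_eq_poisson h0 hΦ hy x
  rw [add_sub_cancel] at h1
  have h2 : Φ x = ((Real.pi : ℝ) : ℂ)⁻¹ * ∫ v : ℝ, ((1 + v ^ 2 : ℝ) : ℂ)⁻¹ * Φ x := by
    rw [integral_mul_const]
    have : ∫ v : ℝ, ((1 + v ^ 2 : ℝ) : ℂ)⁻¹ = ((Real.pi : ℝ) : ℂ) := by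
      rw [← integral_univ_inv_one_add_sq, ← integral_complex_ofReal]
      simp
    rw [this, inv_mul_cancel_left₀]
    exact_mod_cast Real.pi_pos.ne'
  have hi1 := integrable_poisson_integrand hcont hB x (s - a)
  have hi2 := integrable_poisson_integrand (Φ := fun _ => Φ x) continuous_const
    (fun _ => hB x) x (s - a)
  have h3 : onLine s (fourierIntegralOn univ h) x - Φ x
      = ((Real.pi : ℝ) : ℂ)⁻¹ * ∫ v : ℝ,
        ((1 + v ^ 2 : ℝ) : ℂ)⁻¹ * (Φ (x + (s - a) * v) - Φ x) := by
    have h4 := integral_sub hi1 hi2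
    simp only [← mul_sub] at h4
    rw [h4, mul_sub, ← h1, ← h2]
  rw [h3, norm_mul, norm_inv, Complex.norm_real, Real.norm_of_nonneg Real.pi_pos.le,
    inv_mul_le_iff₀ Real.pi_pos]
  have h4 : ‖∫ v : ℝ, ((1 + v ^ 2 : ℝ) : ℂ)⁻¹ * (Φ (x + (s - a) * v) - Φ x)‖ ≤ ω (s - a) := by
    refine norm_integral_le_of_norm_le
      ((integrable_inv_one_add_sq.mul_const (2 * B)).mono' (hcy _).aestronglyMeasurable
        (Eventually.of_forall (hbd _))) (Eventually.of_forall fun v => ?_)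
    have hp : (0 : ℝ) ≤ 1 + v ^ 2 := by positivity
    rw [norm_mul, norm_inv, Complex.norm_real, Real.norm_of_nonneg hp]
    refine mul_le_mul_of_nonneg_left (le_min ?_ ?_) (hpos v)
    · have := hCr (x + (s - a) * v) x
      rwa [add_sub_cancel_left] at this
    · exact (norm_sub_le _ _).trans (by linarith [hB (x + (s - a) * v), hB x])
  have h5 := hω' (y := s - a) (by rw [Real.dist_eq, sub_zero, abs_of_pos hy]; linarith)
  exact h4.trans h5.le


/-! ### Contour shift, passage to the edge, and Paley–Wiener -/

theorem onLine_im (s x : ℝ) : ((x : ℂ) + (s : ℂ) * Complex.I).im = s := by simp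

theorem onLine_re (s x : ℝ) : ((x : ℂ) + (s : ℂ) * Complex.I).re = x := by simp

theorem onLine_re_im (F : ℂ → ℂ) (z : ℂ) : onLine z.im F z.re = F z := by
  rw [onLine, Complex.re_add_im]

theorem continuous_onLine_of_continuousAt {G : ℂ → ℂ} {s : ℝ}
    (h : ∀ z : ℂ, z.im = s → ContinuousAt G z) : Continuous (onLine s G) := by
  rw [continuous_iff_continuousAt]
  intro x
  have h1 : ContinuousAt G ((x : ℂ) + (s : ℂ) * Complex.I) := h _ (onLine_im s x)
  exact ContinuousAt.comp (f := fun x : ℝ => (x : ℂ) + (s : ℂ) * Complex.I) h1 (by fun_prop)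

/-- Contour shift for functions with Gaussian decay. -/
theorem integral_onLine_eq_of_gaussian_decay {H : ℂ → ℂ} {s₁ s₂ ε M : ℝ} (hε : 0 < ε)
    (hd : ∀ z : ℂ, z.im ∈ uIcc s₁ s₂ → DifferentiableAt ℂ H z)
    (hM : ∀ z : ℂ, z.im ∈ uIcc s₁ s₂ → ‖H z‖ ≤ M * Real.exp (-ε * z.re ^ 2)) :
    ∫ x, onLine s₁ H x = ∫ x, onLine s₂ H x := by
  have hint : ∀ s ∈ uIcc s₁ s₂, Integrable (onLine s H) := by
    intro s hs
    refine ((integrable_exp_neg_mul_sq hε).const_mul M).mono'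
      (continuous_onLine_of_continuousAt fun z hz =>
        (hd z (hz ▸ hs)).continuousAt).aestronglyMeasurable
      (Eventually.of_forall fun x => ?_)
    have := hM ((x : ℂ) + (s : ℂ) * Complex.I) (by rw [onLine_im]; exact hs)
    rwa [onLine_re] at this
  have hl : ∀ s ∈ uIcc s₁ s₂, Tendsto (fun n : ℕ => ∫ x in (-n : ℝ)..n, onLine s H x) atTop
      (𝓝 (∫ x, onLine s H x)) := fun s hs =>
    intervalIntegral_tendsto_integral (hint s hs)
      (tendsto_neg_atTop_atBot.comp tendsto_natCast_atTop_atTop) tendsto_natCast_atTop_atTop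
  have hexp : Tendsto (fun n : ℕ => M * Real.exp (-ε * (n : ℝ) ^ 2) * |s₂ - s₁|) atTop (𝓝 0) := by
    have h1 : Tendsto (fun n : ℕ => ε * (n : ℝ) ^ 2) atTop atTop :=
      ((tendsto_pow_atTop two_ne_zero).comp tendsto_natCast_atTop_atTop).const_mul_atTop hε
    have h2 := (Real.tendsto_exp_neg_atTop_nhds_zero.comp h1).const_mul M
    have h3 := h2.mul_const |s₂ - s₁|
    simpa [Function.comp_def, neg_mul] using h3
  have hside : ∀ σ : ℝ, |σ| = 1 → Tendsto (fun n : ℕ =>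
      ∫ y in s₁..s₂, H (((σ * n : ℝ) : ℂ) + y * Complex.I)) atTop (𝓝 0) := by
    intro σ hσ
    refine squeeze_zero_norm (fun n => ?_) hexp
    refine intervalIntegral.norm_integral_le_of_norm_le_const fun y hy => ?_
    have := hM (((σ * n : ℝ) : ℂ) + y * Complex.I) (by
      rw [onLine_im]; exact uIoc_subset_uIcc hy)
    rwa [onLine_re, mul_pow, ← sq_abs σ, hσ, one_pow, one_mul] at this
  have hrect : ∀ n : ℕ, ((∫ x in (-n : ℝ)..n, onLine s₁ H x) - ∫ x in (-n : ℝ)..n, onLine s₂ H x)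
      + Complex.I * (∫ y in s₁..s₂, H (((1 * n : ℝ) : ℂ) + y * Complex.I))
      - Complex.I * (∫ y in s₁..s₂, H (((-1 * n : ℝ) : ℂ) + y * Complex.I)) = 0 := by
    intro n
    have := Complex.integral_boundary_rect_eq_zero_of_differentiableOn H
      (((-n : ℝ) : ℂ) + s₁ * Complex.I) (((n : ℝ) : ℂ) + s₂ * Complex.I) (fun z hz => by
        rw [Complex.mem_reProdIm, onLine_im, onLine_im] at hz
        exact (hd z hz.2).differentiableWithinAt)
    simp only [onLine_im, onLine_re, smul_eq_mul] at this
    rw [one_mul, neg_one_mul]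
    exact this
  have hlim := ((hl s₁ left_mem_uIcc).sub (hl s₂ right_mem_uIcc)).add
    ((hside 1 (by simp)).const_mul Complex.I) |>.sub ((hside (-1) (by simp)).const_mul Complex.I)
  simp only [hrect, mul_zero, add_zero, sub_zero] at hlim
  exact (sub_eq_zero.1 (tendsto_nhds_unique hlim tendsto_const_nhds))

theorem norm_cexp_neg_mul_sq (ε : ℝ) (z : ℂ) :
    ‖Complex.exp (-ε * z ^ 2)‖ = Real.exp (ε * z.im ^ 2) * Real.exp (-ε * z.re ^ 2) := by
  rw [Complex.norm_exp, ← Real.exp_add]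
  congr 1
  rw [neg_mul, Complex.neg_re, Complex.re_ofReal_mul, sq, Complex.mul_re]
  ring

theorem memLp_onLine_mul_gaussian {G : ℂ → ℂ} {s ε : ℝ} (hε : 0 < ε)
    (hc : Continuous (onLine s G)) {B : ℝ} (hB : ∀ x, ‖onLine s G x‖ ≤ B) :
    Integrable (onLine s fun z => G z * Complex.exp (-ε * z ^ 2)) ∧
      MemLp (onLine s fun z => G z * Complex.exp (-ε * z ^ 2)) 2 volume := by
  have hB0 : 0 ≤ B := (norm_nonneg _).trans (hB 0)
  have hm : Continuous (onLine s fun z => G z * Complex.exp (-ε * z ^ 2)) :=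
    hc.mul (by fun_prop : Continuous fun x : ℝ =>
      Complex.exp (-ε * ((x : ℂ) + (s : ℂ) * Complex.I) ^ 2))
  have hb : ∀ x, ‖onLine s (fun z => G z * Complex.exp (-ε * z ^ 2)) x‖
      ≤ B * Real.exp (ε * s ^ 2) * Real.exp (-ε * x ^ 2) := by
    intro x
    have h1 : ‖onLine s (fun z => G z * Complex.exp (-ε * z ^ 2)) x‖
        = ‖onLine s G x‖ * (Real.exp (ε * s ^ 2) * Real.exp (-ε * x ^ 2)) := by
      simp only [onLine, norm_mul]
      rw [norm_cexp_neg_mul_sq, onLine_im, onLine_re]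
    rw [h1, mul_assoc]
    gcongr
    exact hB x
  have hi : Integrable (onLine s fun z => G z * Complex.exp (-ε * z ^ 2)) :=
    ((integrable_exp_neg_mul_sq hε).const_mul _).mono' hm.aestronglyMeasurable
      (Eventually.of_forall hb)
  refine ⟨hi, (memLp_two_iff_integrable_sq_norm hm.aestronglyMeasurable).2 ?_⟩
  refine ((hi.norm.const_mul (B * Real.exp (ε * s ^ 2)))).mono'
    (hm.norm.pow 2).aestronglyMeasurable (Eventually.of_forall fun x => ?_)
  rw [Real.norm_of_nonneg (by positivity), sq]
  refine mul_le_mul_of_nonneg_right ((hb x).trans ?_) (norm_nonneg _)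
  refine mul_le_of_le_one_right (by positivity) (Real.exp_le_one_iff.2 ?_)
  have : 0 ≤ ε * x ^ 2 := by positivity
  linarith

/-- The inverse Fourier transforms of an analytic function on two horizontal lines differ by an
exponential factor. -/
theorem isFourierL2_onLine_shift {G : ℂ → ℂ} {g : ℝ → ℂ} {s₁ s₂ B : ℝ}
    (hd : ∀ z : ℂ, z.im ∈ uIcc s₁ s₂ → DifferentiableAt ℂ G z)
    (hB : ∀ z : ℂ, z.im ∈ uIcc s₁ s₂ → ‖G z‖ ≤ B)
    (h1 : IsFourierL2 (expShift s₁ g) (onLine s₁ G)) (h2 : MemLp (onLine s₂ G) 2 volume) :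
    IsFourierL2 (expShift s₂ g) (onLine s₂ G) := by
  have hB0 : 0 ≤ B := (norm_nonneg _).trans (hB (s₁ * Complex.I) (by simp))
  -- The factors exp(-ε z²) make the bounded function G integrable on lines and kill the vertical
  -- sides of the rectangles. Keeping ε ≤ 1 allows domination by e^{s²}|G| on Im z = s when ε → 0.
  set ε : ℕ → ℝ := fun n => 1 / ((n : ℝ) + 1) with hεdef
  have hε : ∀ n, 0 < ε n := fun n => by positivity
  have hε1 : ∀ n, ε n ≤ 1 := fun n => by
    rw [hεdef, div_le_one (by positivity)]
    have : (0 : ℝ) ≤ n := n.cast_nonneg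
    linarith
  have hε0 : Tendsto ε atTop (𝓝 0) := tendsto_one_div_add_atTop_nhds_zero_nat
  set Gn : ℕ → ℂ → ℂ := fun n z => G z * Complex.exp (-(ε n : ℝ) * z ^ 2) with hGn
  set k : ℝ → ℕ → ℝ → ℂ := fun s n t =>
    fconst * ∫ x : ℝ, onLine s (Gn n) x * Complex.exp (-(Complex.I * x * t)) with hk
  have hcont : ∀ s ∈ uIcc s₁ s₂, Continuous (onLine s G) := fun s hs =>
    continuous_onLine_of_continuousAt fun z hz => (hd z (hz ▸ hs)).continuousAt
  have hbline : ∀ s ∈ uIcc s₁ s₂, ∀ x, ‖onLine s G x‖ ≤ B := fun s hs x =>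
    hB _ (by rw [onLine_im]; exact hs)
  have hkF : ∀ s ∈ uIcc s₁ s₂, ∀ n, IsFourierL2 (k s n) (onLine s (Gn n)) := by
    intro s hs n
    have := memLp_onLine_mul_gaussian (hε n) (hcont s hs) (hbline s hs)
    exact isFourierL2_integral_inv this.1 this.2
  have hexpk : ∀ s ∈ uIcc s₁ s₂, ∀ n t, (Real.exp (s * t) : ℂ) * k s n t
      = fconst * ∫ x, onLine s (fun z => Gn n z * Complex.exp (-(Complex.I * z * t))) x := by
    intro s _ n t
    rw [hk, mul_left_comm, ← integral_const_mul]
    congr 2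
    ext x
    simp only [onLine]
    rw [mul_left_comm, Complex.ofReal_exp, ← Complex.exp_add]
    congr 2
    push_cast
    linear_combination ((s : ℂ) * t) * Complex.I_sq
  -- Cauchy's theorem: up to `fconst`, e^{st} k_s(t) is the integral of G_n(z) e^{-izt} along Im z =
  -- s, which is the same on both lines.
  have hkeq : ∀ n t, (Real.exp (s₁ * t) : ℂ) * k s₁ n t = (Real.exp (s₂ * t) : ℂ) * k s₂ n t := by
    intro n t
    rw [hexpk s₁ left_mem_uIcc, hexpk s₂ right_mem_uIcc]
    congr 1
    refine integral_onLine_eq_of_gaussian_decay (hε n)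
      (M := B * Real.exp (ε n * (max |s₁| |s₂|) ^ 2) * Real.exp (max |s₁| |s₂| * |t|))
      (fun z hz => ?_) (fun z hz => ?_)
    · exact ((hd z hz).mul (by fun_prop)).mul (by fun_prop)
    · have him : |z.im| ≤ max |s₁| |s₂| := by
        rcases mem_uIcc.1 hz with h | h
        · rw [max_comm]; exact abs_le_max_abs_abs h.1 h.2 |>.trans (le_of_eq (max_comm _ _))
        · rw [max_comm]; exact abs_le_max_abs_abs h.1 h.2
      simp only [hGn]
      rw [norm_mul, norm_mul, norm_cexp_neg_mul_sq]
      have e1 : ‖Complex.exp (-(Complex.I * z * t))‖ ≤ Real.exp (max |s₁| |s₂| * |t|) := by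
        rw [Complex.norm_exp]
        refine Real.exp_le_exp.2 ?_
        have : (-(Complex.I * z * (t : ℂ))).re = z.im * t := by simp
        rw [this]
        refine (le_abs_self _).trans ?_
        rw [abs_mul]
        gcongr
      have e2 : z.im ^ 2 ≤ (max |s₁| |s₂|) ^ 2 := by
        rw [← sq_abs z.im]; gcongr
      have e3 : Real.exp (ε n * z.im ^ 2) ≤ Real.exp (ε n * (max |s₁| |s₂|) ^ 2) := by
        have := hε n
        gcongr
      calc ‖G z‖ * (Real.exp (ε n * z.im ^ 2) * Real.exp (-ε n * z.re ^ 2))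
            * ‖Complex.exp (-(Complex.I * z * t))‖
          ≤ B * (Real.exp (ε n * (max |s₁| |s₂|) ^ 2) * Real.exp (-ε n * z.re ^ 2))
            * Real.exp (max |s₁| |s₂| * |t|) := by
            have := hB z hz
            gcongr
        _ = _ := by ring
  have hconv : ∀ s ∈ uIcc s₁ s₂, MemLp (onLine s G) 2 volume →
      Tendsto (fun n => eLpNorm (onLine s (Gn n) - onLine s G) 2 volume) atTop (𝓝 0) := by
    intro s hs hmem
    refine (tendsto_eLpNorm_of_dominated (g := fun x => Real.exp (s ^ 2) * ‖onLine s G x‖)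
      (hmem.norm.const_mul _) (fun n => (hkF s hs n).memLp_right.1)
      (fun n => Eventually.of_forall fun x => ?_) (Eventually.of_forall fun x => ?_)).2
    · simp only [hGn, onLine]
      rw [norm_mul, mul_comm, norm_cexp_neg_mul_sq, onLine_im, onLine_re]
      gcongr
      rw [← Real.exp_add]
      refine Real.exp_le_exp.2 ?_
      have h3 := mul_le_mul_of_nonneg_right (hε1 n) (sq_nonneg s)
      have h4 := mul_nonneg (hε n).le (sq_nonneg x)
      linarith
    · have h3 : Tendsto (fun n => Complex.exp (-(ε n : ℝ) * ((x : ℂ) + s * Complex.I) ^ 2)) atTop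
          (𝓝 (Complex.exp (-((0 : ℝ) : ℂ) * ((x : ℂ) + s * Complex.I) ^ 2))) := by
        have hc : Continuous fun r : ℝ => Complex.exp (-(r : ℂ) * ((x : ℂ) + s * Complex.I) ^ 2) := by
          fun_prop
        exact (hc.tendsto 0).comp hε0
      have h4 := h3.const_mul (onLine s G x)
      simpa [onLine, hGn] using h4
  obtain ⟨f₂, hf₂⟩ := exists_isFourierL2_left h2
  -- L² convergence gives almost everywhere convergence only along subsequences; the second is
  -- extracted from the first so that both lines can be compared along `ns ∘ ms`.
  obtain ⟨ns, hns, ha⟩ := exists_seq_tendsto_ae_of_isFourierL2 (hkF s₁ left_mem_uIcc) h1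
    (hconv s₁ left_mem_uIcc h1.memLp_right)
  obtain ⟨ms, hms, hb⟩ := exists_seq_tendsto_ae_of_isFourierL2
    (fun n => hkF s₂ right_mem_uIcc (ns n)) hf₂
    ((hconv s₂ right_mem_uIcc h2).comp hns.tendsto_atTop)
  refine hf₂.congr ?_ EventuallyEq.rfl
  filter_upwards [ha, hb] with t h3 h4
  have h5 := (h3.comp hms.tendsto_atTop).const_mul ((Real.exp (-(s₂ * t)) : ℂ) * Real.exp (s₁ * t))
  have h6 : ∀ n, ((Real.exp (-(s₂ * t)) : ℂ) * Real.exp (s₁ * t)) * k s₁ (ns (ms n)) t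
      = k s₂ (ns (ms n)) t := fun n => by
    rw [mul_assoc, hkeq, ← mul_assoc, ← Complex.ofReal_mul, ← Real.exp_add, neg_add_cancel,
      Real.exp_zero, Complex.ofReal_one, one_mul]
  have h7 : Tendsto (fun n => k s₂ (ns (ms n)) t) atTop
      (𝓝 (((Real.exp (-(s₂ * t)) : ℂ) * Real.exp (s₁ * t)) * expShift s₁ g t)) :=
    h5.congr h6
  rw [tendsto_nhds_unique h4 h7, expShift, expShift, mul_assoc, ← mul_assoc (Complex.ofReal _)
    (Complex.ofReal _) (g t), ← Complex.ofReal_mul, ← Real.exp_add, add_neg_cancel,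
    Real.exp_zero, Complex.ofReal_one, one_mul]

/-- For fixed t the weight is monotone in s, so its maximum is at an end-point. The sum gives one
dominating function for all intermediate lines. -/
theorem exp_le_of_mem_uIcc {c r s : ℝ} (h : s ∈ uIcc c r) (t : ℝ) :
    Real.exp (-(s * t)) ≤ Real.exp (-(c * t)) + Real.exp (-(r * t)) := by
  have hc := Real.exp_pos (-(c * t))
  have hr := Real.exp_pos (-(r * t))
  have : -(s * t) ≤ max (-(c * t)) (-(r * t)) := by
    rcases mem_uIcc.1 h with h | h <;> rcases le_total 0 t with ht | ht
    · exact le_max_of_le_left (by nlinarith)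
    · exact le_max_of_le_right (by nlinarith)
    · exact le_max_of_le_right (by nlinarith)
    · exact le_max_of_le_left (by nlinarith)
  rcases le_max_iff.1 this with h | h
  · linarith [Real.exp_le_exp.2 h]
  · linarith [Real.exp_le_exp.2 h]

/-- Passage to the boundary of the strip in the inverse Fourier transform. -/
theorem isFourierL2_expShift_of_tendsto {g : ℝ → ℂ} {G : ℕ → ℝ → ℂ} {G₀ : ℝ → ℂ} {s : ℕ → ℝ}
    {c : ℝ} {M : ℝ≥0∞} (hM : M ≠ ∞) (h : ∀ n, IsFourierL2 (expShift (s n) g) (G n))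
    (hb : ∀ n, eLpNorm (G n) 2 volume ≤ M) (hs : Tendsto s atTop (𝓝 c))
    (hs' : ∀ n, s n ∈ uIcc c (s 0))
    (hl : ∀ᵐ x, Tendsto (fun n => G n x) atTop (𝓝 (G₀ x))) :
    IsFourierL2 (expShift c g) G₀ := by
  have hlim : ∀ t, Tendsto (fun n => expShift (s n) g t) atTop (𝓝 (expShift c g t)) := by
    intro t
    have hc : Continuous fun r : ℝ => (Real.exp (-(r * t)) : ℂ) * g t := by fun_prop
    exact (hc.tendsto c).comp hs
  have hgm := aestronglyMeasurable_of_expShift (h 0).memLp_left.1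
  -- Fatou's lemma: by Plancherel the norms of e^{-s_n t} g are those of `G n`, hence at most M.
  have hmem : MemLp (expShift c g) 2 volume := by
    refine ⟨aestronglyMeasurable_expShift hgm, lt_of_le_of_lt ?_ hM.lt_top⟩
    refine (Lp.eLpNorm_lim_le_liminf_eLpNorm (fun n => (h n).memLp_left.1) _
      (Eventually.of_forall hlim)).trans ?_
    refine liminf_le_of_le (by isBoundedDefault) fun b hbb => ?_
    obtain ⟨n, hn⟩ := hbb.exists
    exact hn.trans ((h n).eLpNorm_eq ▸ hb n)
  refine isFourierL2_of_tendsto_left h hmem ?_ hl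
  refine (tendsto_eLpNorm_of_dominated (g := fun t => ‖expShift c g t‖ + ‖expShift (s 0) g t‖)
    (hmem.norm.add (h 0).memLp_left.norm) (fun n => (h n).memLp_left.1)
    (fun n => Eventually.of_forall fun t => ?_) (Eventually.of_forall hlim)).2
  simp only [norm_expShift]
  rw [← add_mul]
  gcongr
  exact exp_le_of_mem_uIcc (hs' n) t

/-- By Fatou the lower limit of |e^{-(s₀+n)t} g(t)|² as n → ∞ is integrable, hence finite almost
everywhere; at a t < 0 with g(t) ≠ 0 it would be infinite. -/
theorem ae_eq_zero_of_eLpNorm_expShift_le {g : ℝ → ℂ} {M : ℝ≥0∞} (hM : M ≠ ∞) {s₀ : ℝ}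
    (hg : AEStronglyMeasurable g volume)
    (h : ∀ s, s₀ ≤ s → eLpNorm (expShift s g) 2 volume ≤ M) : ∀ᵐ t, t < 0 → g t = 0 := by
  have hm : ∀ n : ℕ, AEMeasurable (fun t => ‖expShift (s₀ + n) g t‖ₑ ^ (2 : ℝ)) volume :=
    fun n => (aestronglyMeasurable_expShift hg).enorm.pow_const _
  have hfin : ∫⁻ t, liminf (fun n : ℕ => ‖expShift (s₀ + n) g t‖ₑ ^ (2 : ℝ)) atTop ≠ ∞ := by
    refine ne_top_of_le_ne_top (b := M ^ (2 : ℝ)) (ENNReal.rpow_ne_top_of_nonneg (by norm_num) hM) ?_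
    refine (lintegral_liminf_le' hm).trans ?_
    refine liminf_le_of_le (by isBoundedDefault) fun b hbb => ?_
    obtain ⟨n, hn⟩ := hbb.exists
    refine hn.trans ?_
    have h1 := h (s₀ + n) (by have : (0 : ℝ) ≤ n := n.cast_nonneg
                              linarith)
    rw [eLpNorm_eq_lintegral_rpow_enorm_toReal (by norm_num) (by norm_num)] at h1
    simp only [ENNReal.toReal_ofNat] at h1
    have h2 := ENNReal.rpow_le_rpow h1 (by norm_num : (0 : ℝ) ≤ 2)
    rwa [← ENNReal.rpow_mul, one_div_mul_cancel (by norm_num), ENNReal.rpow_one] at h2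
  have hlm : AEMeasurable
      (fun t => liminf (fun n : ℕ => ‖expShift (s₀ + n) g t‖ₑ ^ (2 : ℝ)) atTop) volume := by
    have h1 : ∀ n : ℕ, Measurable fun t => ‖expShift (s₀ + n) (hg.mk g) t‖ₑ ^ (2 : ℝ) := fun n =>
      ((continuous_expFactor _).measurable.mul hg.measurable_mk).enorm.pow_const _
    refine (Measurable.liminf h1).aemeasurable.congr ?_
    filter_upwards [hg.ae_eq_mk] with t ht
    simp only [expShift, ← ht]
  have hae := ae_lt_top' hlm hfin
  filter_upwards [hae] with t ht htneg
  by_contra hne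
  refine ht.ne ?_
  refine Tendsto.liminf_eq ?_
  have h1 : Tendsto (fun n : ℕ => ‖expShift (s₀ + n) g t‖) atTop atTop := by
    simp only [norm_expShift]
    refine Tendsto.atTop_mul_const (norm_pos_iff.2 hne) (Real.tendsto_exp_atTop.comp ?_)
    have h2 : Tendsto (fun n : ℕ => s₀ + (n : ℝ)) atTop atTop :=
      tendsto_atTop_add_const_left _ _ tendsto_natCast_atTop_atTop
    have h3 := h2.atTop_mul_const (neg_pos.2 htneg)
    refine h3.congr fun n => by ring
  have h4 : Tendsto (fun n : ℕ => ‖expShift (s₀ + n) g t‖ₑ) atTop (𝓝 ∞) := by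
    have := ENNReal.tendsto_ofReal_atTop.comp h1
    refine this.congr fun n => ofReal_norm _
  have h5 := (ENNReal.continuous_rpow_const (y := 2)).tendsto ∞ |>.comp h4
  rw [ENNReal.top_rpow_of_pos (by norm_num)] at h5
  exact h5

/-- A Paley–Wiener theorem for the class `{{a, ∞}}`. -/
theorem imageUpperClass_of_bounded {a : ℝ} {G : ℂ → ℂ} {Φ : ℝ → ℂ}
    (hd : DifferentiableOn ℂ G (upper a))
    (hB : ∀ s, a < s → ∃ B, ∀ z : ℂ, s ≤ z.im → ‖G z‖ ≤ B) {M : ℝ≥0∞} (hM : M ≠ ∞)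
    (h2 : ∀ s, a < s → eLpNorm (onLine s G) 2 volume ≤ M) (hΦ : BddHolder Φ)
    (hl : ∀ x, Tendsto (fun s => onLine s G x) (𝓝[>] a) (𝓝 (Φ x))) :
    ImageUpperClass a G := by
  have hopen : IsOpen (upper a) := isOpen_lt continuous_const Complex.continuous_im
  have hda : ∀ z : ℂ, a < z.im → DifferentiableAt ℂ G z := fun z hz =>
    hd.differentiableAt (hopen.mem_nhds hz)
  have hcont : ∀ s, a < s → Continuous (onLine s G) := fun s hs =>
    continuous_onLine_of_continuousAt fun z hz => (hda z (hz ▸ hs)).continuousAt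
  have hmem : ∀ s, a < s → MemLp (onLine s G) 2 volume := fun s hs =>
    ⟨(hcont s hs).aestronglyMeasurable, (h2 s hs).trans_lt hM.lt_top⟩
  have ha1 : a < a + 1 := by linarith
  obtain ⟨g₁, hg₁⟩ := exists_isFourierL2_left (hmem (a + 1) ha1)
  set g := expShift (-(a + 1)) g₁ with hg
  have hgs : IsFourierL2 (expShift (a + 1) g) (onLine (a + 1) G) := by
    have : expShift (a + 1) g = g₁ := by
      rw [hg, expShift_expShift, add_neg_cancel]
      ext t; simp [expShift]
    rwa [this]
  have hall : ∀ s, a < s → IsFourierL2 (expShift s g) (onLine s G) := by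
    intro s hs
    obtain ⟨B, hB'⟩ := hB (min (a + 1) s) (lt_min ha1 hs)
    refine isFourierL2_onLine_shift (B := B) (fun z hz => hda z ?_) (fun z hz => hB' z hz.1)
      hgs (hmem s hs)
    exact (lt_min ha1 hs).trans_le hz.1
  have hgm := aestronglyMeasurable_of_expShift (hall (a + 1) ha1).memLp_left.1
  have hbdry : IsFourierL2 (expShift a g) Φ := by
    set s : ℕ → ℝ := fun n => a + 1 / ((n : ℝ) + 1) with hsdef
    have hs : ∀ n, a < s n := fun n => by
      have : (0 : ℝ) < 1 / ((n : ℝ) + 1) := by positivity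
      simp only [hsdef]; linarith
    have hlim : Tendsto s atTop (𝓝 a) := by
      simpa [hsdef] using (tendsto_one_div_add_atTop_nhds_zero_nat (𝕜 := ℝ)).const_add a
    have hlim' : Tendsto s atTop (𝓝[>] a) :=
      tendsto_nhdsWithin_iff.2 ⟨hlim, Eventually.of_forall hs⟩
    refine isFourierL2_expShift_of_tendsto hM (fun n => hall (s n) (hs n))
      (fun n => h2 (s n) (hs n)) hlim (fun n => ?_)
      (Eventually.of_forall fun x => (hl x).comp hlim')
    rw [uIcc_of_le (hs 0).le]
    refine ⟨(hs n).le, ?_⟩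
    simp only [hsdef]
    gcongr
    exact n.zero_le
  have hneg := ae_eq_zero_of_eLpNorm_expShift_le hM hgm (s₀ := a + 1) fun s hs =>
    (hall s (by linarith)).eLpNorm_eq ▸ h2 s (by linarith)
  -- The original g vanishes only almost everywhere on t < 0, while the class asks for it at every
  -- point.
  set f : ℝ → ℂ := fun t => if t < 0 then 0 else g t with hf
  have hfg : f =ᵐ[volume] g := by
    filter_upwards [hneg] with t ht
    by_cases h : t < 0
    · simp [hf, h, ht h]
    · simp [hf, h]
  have hf0 : ∀ t < 0, f t = 0 := fun t ht => by simp [hf, ht]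
  have hfs : ∀ s, expShift s g =ᵐ[volume] expShift s f := fun s => by
    filter_upwards [hfg] with t ht
    simp [expShift, ht]
  have hbf : IsFourierL2 (expShift a f) Φ := hbdry.congr (hfs a) EventuallyEq.rfl
  refine ⟨f, ⟨⟨Φ, hΦ.imageClass hbdry.memLp_right, hbf⟩, hf0⟩, fun z hz => ?_⟩
  have hz' : a < z.im := hz
  have e1 := (hall z.im hz').congr (hfs _) EventuallyEq.rfl
  have e2 := isFourierL2_onLine hbf.memLp_left hf0 hz'
  have hc2 : Continuous (onLine z.im (fourierIntegralOn univ f)) :=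
    continuous_onLine_of_continuousAt fun w hw =>
      (hasDerivAt_fourierIntegral hbf.memLp_left hf0 (hw ▸ hz')).continuousAt
  have e3 := (hcont _ hz').ae_eq_iff_eq volume hc2 |>.1 (e1.unique_right e2)
  have e4 := congrFun e3 z.re
  rwa [onLine_re_im, onLine_re_im] at e4


/-! ### Reflection and the lower half-plane -/

/-- Under t ↦ -t and z ↦ -z the half-plane Im z < b becomes Im z > -b; the results for lower
half-planes are drawn from the upper ones in this way. -/
theorem fourierIntegral_comp_neg (h : ℝ → ℂ) (z : ℂ) :
    fourierIntegralOn univ (fun t => h (-t)) (-z) = fourierIntegralOn univ h z := by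
  simp only [fourierIntegralOn, setIntegral_univ]
  congr 1
  rw [← integral_neg_eq_self]
  refine integral_congr_ae (Eventually.of_forall fun t => ?_)
  simp

theorem expShift_comp_neg (s : ℝ) (h : ℝ → ℂ) :
    (expShift (-s) fun t => h (-t)) = fun t => expShift s h (-t) := by
  ext t
  simp [expShift]

theorem memLp_expShift_comp_neg {s : ℝ} {h : ℝ → ℂ} (h2 : MemLp (expShift s h) 2 volume) :
    MemLp (expShift (-s) fun t => h (-t)) 2 volume := by
  rw [expShift_comp_neg]
  exact h2.comp_measurePreserving (Measure.measurePreserving_neg _)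

theorem BddHolder.comp_neg {F : ℝ → ℂ} (hF : BddHolder F) : BddHolder fun x => F (-x) := by
  obtain ⟨⟨B, hB⟩, C, r, hC, hr, hr1, h⟩ := hF
  refine ⟨⟨B, fun x => hB _⟩, C, r, hC, hr, hr1, fun x y => ?_⟩
  have := h (-x) (-y)
  rwa [neg_sub_neg, abs_sub_comm] at this

theorem ImageClass.comp_neg {F : ℝ → ℂ} (hF : ImageClass F) : ImageClass fun x => F (-x) :=
  hF.bddHolder.comp_neg.imageClass (hF.1.comp_measurePreserving (Measure.measurePreserving_neg _))

theorem OrigClassAt.comp_neg {s : ℝ} {h : ℝ → ℂ} (hh : OrigClassAt s h) :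
    OrigClassAt (-s) fun t => h (-t) := by
  obtain ⟨F, hF, hF'⟩ := hh
  refine ⟨fun x => F (-x), hF.comp_neg, ?_⟩
  rw [expShift_comp_neg]
  exact hF'.comp_neg

theorem ImageUpperClass.comp_neg {b : ℝ} {F : ℂ → ℂ} (hF : ImageUpperClass (-b) F) :
    ImageLowerClass b fun z => F (-z) := by
  obtain ⟨f, ⟨hf, hf0⟩, h⟩ := hF
  refine ⟨fun t => f (-t), ⟨by simpa using hf.comp_neg, fun t ht => hf0 _ (by linarith)⟩,
    fun z hz => ?_⟩
  have hz' : z.im < b := hz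
  beta_reduce
  rw [h (-z) (show -b < (-z).im by rw [Complex.neg_im]; linarith),
    ← fourierIntegral_comp_neg, neg_neg]

theorem ImageLowerClass.comp_neg {b : ℝ} {F : ℂ → ℂ} (hF : ImageLowerClass b F) :
    ImageUpperClass (-b) fun z => F (-z) := by
  obtain ⟨f, ⟨hf, hf0⟩, h⟩ := hF
  refine ⟨fun t => f (-t), ⟨hf.comp_neg, fun t ht => hf0 _ (by linarith)⟩,
    fun z hz => ?_⟩
  have hz' : -b < z.im := hz
  beta_reduce
  rw [h (-z) (show (-z).im < b by rw [Complex.neg_im]; linarith),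
    ← fourierIntegral_comp_neg, neg_neg]

section Lower

variable {b : ℝ} {h : ℝ → ℂ}

theorem comp_neg_eq_zero (h0 : ∀ t > 0, h t = 0) : ∀ t < 0, h (-t) = 0 :=
  fun t ht => h0 (-t) (by linarith)

theorem onLine_fourierIntegral_comp_neg (h : ℝ → ℂ) (s : ℝ) :
    onLine s (fourierIntegralOn univ h)
      = fun x => onLine (-s) (fourierIntegralOn univ fun t => h (-t)) (-x) := by
  ext x
  rw [onLine, onLine, ← fourierIntegral_comp_neg]
  congr 1
  push_cast
  ring

theorem norm_expShift_le_lower (h0 : ∀ t > 0, h t = 0) {s r : ℝ} (hs : r ≤ s) (t : ℝ) :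
    ‖expShift r h t‖ ≤ ‖expShift s h t‖ := by
  rw [norm_expShift, norm_expShift]
  rcases lt_or_ge 0 t with ht | ht
  · simp [h0 t ht]
  · have := mul_le_mul_of_nonpos_right hs ht
    gcongr ?_ * _
    exact Real.exp_le_exp.2 (by linarith)

theorem memLp_expShift_lower (h2 : MemLp (expShift b h) 2 volume) (h0 : ∀ t > 0, h t = 0)
    {s : ℝ} (hs : s ≤ b) : MemLp (expShift s h) 2 volume :=
  h2.mono (aestronglyMeasurable_expShift (aestronglyMeasurable_of_expShift h2.1))
    (Eventually.of_forall (norm_expShift_le_lower h0 hs))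

theorem integrable_mul_cexp_lower (h2 : MemLp (expShift b h) 2 volume) (h0 : ∀ t > 0, h t = 0)
    {z : ℂ} (hz : z.im < b) : Integrable fun t : ℝ => h t * Complex.exp (Complex.I * z * t) := by
  have := integrable_mul_cexp (memLp_expShift_comp_neg h2) (comp_neg_eq_zero h0) (z := -z)
    (by rw [Complex.neg_im]; linarith)
  simpa using this.comp_neg

theorem isFourierL2_onLine_lower (h2 : MemLp (expShift b h) 2 volume) (h0 : ∀ t > 0, h t = 0)
    {s : ℝ} (hs : s < b) : IsFourierL2 (expShift s h) (onLine s (fourierIntegralOn univ h)) := by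
  have := (isFourierL2_onLine (memLp_expShift_comp_neg h2) (comp_neg_eq_zero h0)
    (neg_lt_neg hs)).comp_neg
  rw [onLine_fourierIntegral_comp_neg]
  rw [expShift_comp_neg] at this
  simpa using this

theorem eLpNorm_onLine_lower_le (h2 : MemLp (expShift b h) 2 volume) (h0 : ∀ t > 0, h t = 0)
    {s : ℝ} (hs : s < b) :
    eLpNorm (onLine s (fourierIntegralOn univ h)) 2 volume ≤ eLpNorm (expShift b h) 2 volume := by
  rw [(isFourierL2_onLine_lower h2 h0 hs).eLpNorm_eq]
  exact eLpNorm_mono (norm_expShift_le_lower h0 hs.le)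

theorem differentiableAt_fourierIntegral_lower (h2 : MemLp (expShift b h) 2 volume)
    (h0 : ∀ t > 0, h t = 0) {z : ℂ} (hz : z.im < b) :
    DifferentiableAt ℂ (fourierIntegralOn univ h) z := by
  have h1 := (hasDerivAt_fourierIntegral (memLp_expShift_comp_neg h2) (comp_neg_eq_zero h0)
    (z := -z) (by rw [Complex.neg_im]; linarith)).differentiableAt
  have h3 : DifferentiableAt ℂ
      (fun z => fourierIntegralOn univ (fun t => h (-t)) (-z)) z :=
    DifferentiableAt.comp (g := fourierIntegralOn univ fun t => h (-t)) z h1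
      differentiable_neg.differentiableAt
  simpa only [fourierIntegral_comp_neg] using h3

theorem exists_norm_fourierIntegral_le_lower (h2 : MemLp (expShift b h) 2 volume)
    (h0 : ∀ t > 0, h t = 0) {s : ℝ} (hs : s < b) :
    ∃ B, ∀ z : ℂ, z.im ≤ s → ‖fourierIntegralOn univ h z‖ ≤ B := by
  obtain ⟨B, hB⟩ := exists_norm_fourierIntegral_le (memLp_expShift_comp_neg h2)
    (comp_neg_eq_zero h0) (neg_lt_neg hs)
  refine ⟨B, fun z hz => ?_⟩
  rw [← fourierIntegral_comp_neg]
  exact hB _ (by rw [Complex.neg_im]; linarith)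

theorem fourierIntegral_small_at_infinity_lower
    (h2 : MemLp (expShift b h) 2 volume) (h0 : ∀ t > 0, h t = 0) {s : ℝ} (hs : s < b)
    {ε : ℝ} (hε : 0 < ε) :
    ∃ R, ∀ z : ℂ, z.im ≤ s → R ≤ ‖z‖ → ‖fourierIntegralOn univ h z‖ ≤ ε := by
  obtain ⟨R, hR⟩ := fourierIntegral_small_at_infinity (memLp_expShift_comp_neg h2)
    (comp_neg_eq_zero h0) (neg_lt_neg hs) hε
  refine ⟨R, fun z hz hz' => ?_⟩
  rw [← fourierIntegral_comp_neg]
  exact hR _ (by rw [Complex.neg_im]; linarith) (by rwa [norm_neg])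

theorem fourierIntegral_tendsto_boundary_lower {Φ : ℝ → ℂ} (h0 : ∀ t > 0, h t = 0)
    (hΦ : IsFourierL2 (expShift b h) Φ) (hH : BddHolder Φ) {ε : ℝ} (hε : 0 < ε) :
    ∃ δ > 0, ∀ s, s < b → b - δ < s → ∀ x,
      ‖onLine s (fourierIntegralOn univ h) x - Φ x‖ ≤ ε := by
  have h1 := hΦ.comp_neg
  rw [← expShift_comp_neg] at h1
  obtain ⟨δ, hδ, h3⟩ := fourierIntegral_tendsto_boundary (comp_neg_eq_zero h0) h1
    hH.comp_neg hε
  refine ⟨δ, hδ, fun s hs hs' x => ?_⟩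
  have := h3 (-s) (by linarith) (by linarith) (-x)
  rw [neg_neg] at this
  rwa [onLine_fourierIntegral_comp_neg]

/-- A Paley–Wiener theorem for the class `{{-∞, b}}`. -/
theorem imageLowerClass_of_bounded {b : ℝ} {G : ℂ → ℂ} {Φ : ℝ → ℂ}
    (hd : DifferentiableOn ℂ G (lower b))
    (hB : ∀ s, s < b → ∃ B, ∀ z : ℂ, z.im ≤ s → ‖G z‖ ≤ B) {M : ℝ≥0∞} (hM : M ≠ ∞)
    (h2 : ∀ s, s < b → eLpNorm (onLine s G) 2 volume ≤ M) (hΦ : BddHolder Φ)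
    (hl : ∀ x, Tendsto (fun s => onLine s G x) (𝓝[<] b) (𝓝 (Φ x))) :
    ImageLowerClass b G := by
  have hline : ∀ s, (onLine s fun z => G (-z)) = fun x => onLine (-s) G (-x) := by
    intro s
    ext x
    rw [onLine, onLine]
    congr 1
    push_cast
    ring
  have key : ImageUpperClass (-b) fun z => G (-z) := by
    refine imageUpperClass_of_bounded (M := M) (Φ := fun x => Φ (-x)) ?_ ?_ hM ?_ hΦ.comp_neg ?_
    · exact hd.comp differentiable_neg.differentiableOn fun z (hz : -b < z.im) =>
        show (-z).im < b by rw [Complex.neg_im]; linarith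
    · intro s hs
      obtain ⟨B, hB'⟩ := hB (-s) (by linarith)
      exact ⟨B, fun z hz => hB' _ (by rw [Complex.neg_im]; linarith)⟩
    · intro s hs
      rw [hline]
      refine le_trans ?_ (h2 (-s) (by linarith))
      by_cases hm : AEStronglyMeasurable (onLine (-s) G) volume
      · exact (eLpNorm_comp_measurePreserving hm (Measure.measurePreserving_neg _)).le
      · have hc : Continuous (onLine (-s) G) := continuous_onLine_of_continuousAt fun z hz =>
          (hd.differentiableAt ((isOpen_lt Complex.continuous_im continuous_const).mem_nhds
            (show z.im < b by linarith))).continuousAt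
        exact absurd hc.aestronglyMeasurable hm
    · intro x
      simp only [hline]
      refine (hl (-x)).comp (tendsto_nhdsWithin_iff.2 ⟨?_, ?_⟩)
      · have : Tendsto (fun s : ℝ => -s) (𝓝 (-b)) (𝓝 b) := by
          simpa using (continuous_neg (G := ℝ)).tendsto (-b)
        exact this.mono_left nhdsWithin_le_nhds
      · filter_upwards [self_mem_nhdsWithin] with s hs
        have : -b < s := hs
        exact mem_Iio.2 (by linarith)
  have := key.comp_neg
  simpa using this

end Lower

/-! ### Uniqueness of zero-free factorisations -/

/-- A zero-free function with `G - 1` of class `{{a, ∞}}` is bounded and bounded away from zero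
on every smaller half-plane. -/
theorem exists_bounds_of_imageUpperClass {a : ℝ} {G : ℂ → ℂ}
    (hG : ImageUpperClass a fun z => G z - 1) (h0 : ∀ z ∈ upper a, G z ≠ 0) {s : ℝ} (hs : a < s) :
    ∃ m B, 0 < m ∧ ∀ z : ℂ, s ≤ z.im → m ≤ ‖G z‖ ∧ ‖G z‖ ≤ B := by
  obtain ⟨f, ⟨⟨F, hF, hfF⟩, hf0⟩, h⟩ := hG
  obtain ⟨R, hR⟩ := fourierIntegral_small_at_infinity hfF.memLp_left hf0 hs
    (show (0 : ℝ) < 1 / 2 by norm_num)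
  have hsub : {z : ℂ | s ≤ z.im} ⊆ upper a := fun z (hz : s ≤ z.im) => hs.trans_le hz
  have hGd : ∀ z : ℂ, s ≤ z.im → ContinuousAt G z := by
    intro z hz
    have h1 := (hasDerivAt_fourierIntegral hfF.memLp_left hf0 (hs.trans_le hz)).continuousAt
    have h2 : (fun z => fourierIntegralOn univ f z + 1) =ᶠ[𝓝 z] G := by
      filter_upwards [(isOpen_lt continuous_const Complex.continuous_im).mem_nhds
        (show a < z.im from hs.trans_le hz)] with w hw
      rw [← h w hw, sub_add_cancel]
    exact (h1.add continuousAt_const).congr h2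
  -- Outside the radius R the values lie within 1/2 of 1, and the compact rest is handled by extreme
  -- values. The alternative radius |s| + 1 only ensures that S contains the point is.
  set S : Set ℂ := {z : ℂ | s ≤ z.im} ∩ Metric.closedBall 0 (max R (|s| + 1)) with hS
  have hSc : IsCompact S := (isCompact_closedBall _ _).inter_left
    (isClosed_le continuous_const Complex.continuous_im)
  have hSne : S.Nonempty := ⟨s * Complex.I, by simp, by
    simp only [mem_closedBall_zero_iff, norm_mul, Complex.norm_real, Complex.norm_I, mul_one,
      Real.norm_eq_abs]
    exact le_max_of_le_right (by linarith)⟩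
  have hcS : ContinuousOn (fun z => ‖G z‖) S := fun z hz =>
    (hGd z hz.1).norm.continuousWithinAt
  obtain ⟨z₁, hz₁, hmin⟩ := hSc.exists_isMinOn hSne hcS
  obtain ⟨z₂, hz₂, hmax⟩ := hSc.exists_isMaxOn hSne hcS
  refine ⟨min (1 / 2) ‖G z₁‖, max (3 / 2) ‖G z₂‖,
    lt_min (by norm_num) (norm_pos_iff.2 (h0 _ (hsub hz₁.1))), fun z hz => ?_⟩
  by_cases hzR : R ≤ ‖z‖
  · have h1 := hR z hz hzR
    rw [← h z (hsub hz)] at h1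
    have h2 := norm_sub_norm_le 1 (G z)
    have h3 := norm_sub_norm_le (G z) 1
    rw [norm_sub_rev] at h2
    rw [norm_one] at h2 h3
    exact ⟨(min_le_left _ _).trans (by linarith), le_trans (by linarith) (le_max_left _ _)⟩
  · have hzS : z ∈ S := ⟨hz, by
      rw [mem_closedBall_zero_iff]; exact (not_le.1 hzR).le.trans (le_max_left _ _)⟩
    exact ⟨(min_le_right _ _).trans (hmin hzS), (hmax hzS).trans (le_max_right _ _)⟩

theorem exists_bounds_of_imageLowerClass {b : ℝ} {G : ℂ → ℂ}
    (hG : ImageLowerClass b fun z => G z - 1) (h0 : ∀ z ∈ lower b, G z ≠ 0) {s : ℝ} (hs : s < b) :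
    ∃ m B, 0 < m ∧ ∀ z : ℂ, z.im ≤ s → m ≤ ‖G z‖ ∧ ‖G z‖ ≤ B := by
  obtain ⟨m, B, hm, h⟩ := exists_bounds_of_imageUpperClass (G := fun z => G (-z)) hG.comp_neg
    (fun z (hz : -b < z.im) => h0 _ (show (-z).im < b by rw [Complex.neg_im]; linarith))
    (neg_lt_neg hs)
  refine ⟨m, B, hm, fun z hz => ?_⟩
  have := h (-z) (by rw [Complex.neg_im]; linarith)
  simpa using this

/-- This normalisation identifies the constant that Liouville's theorem produces. -/
theorem tendsto_one_of_imageUpperClass {a : ℝ} {G : ℂ → ℂ}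
    (hG : ImageUpperClass a fun z => G z - 1) :
    Tendsto (fun y : ℝ => G (y * Complex.I)) atTop (𝓝 1) := by
  obtain ⟨f, ⟨⟨F, hF, hfF⟩, hf0⟩, h⟩ := hG
  rw [tendsto_iff_norm_sub_tendsto_zero, Metric.tendsto_atTop]
  intro ε hε
  obtain ⟨R, hR⟩ := fourierIntegral_small_at_infinity hfF.memLp_left hf0 (lt_add_one a)
    (half_pos hε)
  refine ⟨max (a + 1) |R|, fun y hy => ?_⟩
  have h1 : a + 1 ≤ (y * Complex.I : ℂ).im := by simpa using (le_max_left _ _).trans hy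
  have h2 : R ≤ ‖(y * Complex.I : ℂ)‖ := by
    have := (le_abs_self R).trans ((le_max_right _ _).trans hy)
    simpa using this.trans (le_abs_self y)
  have h3 := hR _ h1 h2
  rw [← h _ (show a < (y * Complex.I : ℂ).im by linarith)] at h3
  rw [dist_zero_right, norm_norm]
  linarith

/-- Zero-free factorisations are unique. -/
theorem IsFactorisation.unique {a b : ℝ} (hab : a < b) {K Pp Pm Qp Qm : ℂ → ℂ}
    (hP : IsFactorisation a b K Pp Pm) (hQ : IsFactorisation a b K Qp Qm)
    (hPp : ∀ z ∈ upper a, Pp z ≠ 0) (hPm : ∀ z ∈ lower b, Pm z ≠ 0)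
    (hQp : ∀ z ∈ upper a, Qp z ≠ 0) (hQm : ∀ z ∈ lower b, Qm z ≠ 0) :
    EqOn Pp Qp (upper a) ∧ EqOn Pm Qm (lower b) := by
  classical
  obtain ⟨s, has, hsb⟩ := exists_between hab
  have hag : ∀ z, a < z.im → z.im < b → Pp z / Qp z = Qm z / Pm z := by
    intro z h1 h2
    rw [div_eq_div_iff (hQp z h1) (hPm z h2), ← hP.eq_mul z ⟨h1, h2⟩, hQ.eq_mul z ⟨h1, h2⟩,
      mul_comm]
  -- The quotients P⁺/Q⁺ and Q⁻/P⁻ agree on the strip, because both products equal K, and so glue to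
  -- an entire function. It is bounded on either side of Im z = s by the bounds on closed smaller
  -- half-planes.
  set E : ℂ → ℂ := fun z => if s < z.im then Pp z / Qp z else Qm z / Pm z with hE
  have hEu : ∀ z, a < z.im → E z = Pp z / Qp z := by
    intro z hz
    by_cases h : s < z.im
    · simp [hE, h]
    · simp only [hE, h, if_false]
      exact (hag z hz ((not_lt.1 h).trans_lt hsb)).symm
  have hEl : ∀ z, z.im < b → E z = Qm z / Pm z := by
    intro z hz
    by_cases h : s < z.im
    · simp only [hE, h, if_true]
      exact hag z (has.trans h) hz
    · simp [hE, h]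
  have hou : IsOpen (upper a) := isOpen_lt continuous_const Complex.continuous_im
  have hol : IsOpen (lower b) := isOpen_lt Complex.continuous_im continuous_const
  have hEd : Differentiable ℂ E := by
    intro z
    rcases lt_or_ge a z.im with h | h
    · have h1 := ((hP.analytic_plus.differentiableAt (hou.mem_nhds h)).div
        (hQ.analytic_plus.differentiableAt (hou.mem_nhds h)) (hQp z h))
      refine h1.congr_of_eventuallyEq ?_
      filter_upwards [hou.mem_nhds h] with w hw using hEu w hw
    · have h' : z.im < b := h.trans_lt hab
      have h1 := ((hQ.analytic_minus.differentiableAt (hol.mem_nhds h')).div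
        (hP.analytic_minus.differentiableAt (hol.mem_nhds h')) (hPm z h'))
      refine h1.congr_of_eventuallyEq ?_
      filter_upwards [hol.mem_nhds h'] with w hw using hEl w hw
  obtain ⟨m₁, B₁, hm₁, h₁⟩ := exists_bounds_of_imageUpperClass hP.class_plus hPp has
  obtain ⟨m₂, B₂, hm₂, h₂⟩ := exists_bounds_of_imageUpperClass hQ.class_plus hQp has
  obtain ⟨m₃, B₃, hm₃, h₃⟩ := exists_bounds_of_imageLowerClass hP.class_minus hPm hsb
  obtain ⟨m₄, B₄, hm₄, h₄⟩ := exists_bounds_of_imageLowerClass hQ.class_minus hQm hsb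
  have hEb : Bornology.IsBounded (range E) := by
    refine isBounded_iff_forall_norm_le.2 ⟨max (B₁ / m₂) (B₄ / m₃), ?_⟩
    rintro _ ⟨z, rfl⟩
    rcases le_total s z.im with h | h
    · rw [hEu z (has.trans_le h), norm_div]
      refine le_max_of_le_left ?_
      exact div_le_div₀ ((norm_nonneg _).trans (h₁ z h).2) (h₁ z h).2 hm₂ (h₂ z h).1
    · rw [hEl z (h.trans_lt hsb), norm_div]
      refine le_max_of_le_right ?_
      exact div_le_div₀ ((norm_nonneg _).trans (h₄ z h).2) (h₄ z h).2 hm₃ (h₃ z h).1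
  have hE1 : ∀ z, E z = 1 := by
    intro z
    have h5 : Tendsto (fun y : ℝ => E (y * Complex.I)) atTop (𝓝 1) := by
      have h6 := (tendsto_one_of_imageUpperClass hP.class_plus).div
        (tendsto_one_of_imageUpperClass hQ.class_plus) one_ne_zero
      rw [div_one] at h6
      refine h6.congr' ?_
      filter_upwards [eventually_gt_atTop a] with y hy
      exact (hEu _ (by simpa using hy)).symm
    have h7 : Tendsto (fun y : ℝ => E (y * Complex.I)) atTop (𝓝 (E z)) := by
      refine tendsto_const_nhds.congr fun y => ?_
      exact hEd.apply_eq_apply_of_bounded hEb z _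
    exact tendsto_nhds_unique h7 h5
  constructor
  · intro z hz
    have := hE1 z
    rwa [hEu z hz, div_eq_one_iff_eq (hQp z hz)] at this
  · intro z hz
    have := hE1 z
    rw [hEl z hz, div_eq_one_iff_eq (hPm z hz)] at this
    exact this.symm


/-! ### Splitting at the origin and the boundary behaviour of the kernel -/

theorem plusPart_of_neg (f : ℝ → ℂ) : ∀ t < 0, plusPart f t = 0 := fun t ht => by
  simp [plusPart, not_lt.2 ht.le]

theorem minusPart_of_pos (f : ℝ → ℂ) : ∀ t > 0, minusPart f t = 0 := fun t ht => by
  simp [minusPart, not_lt.2 (le_of_lt ht)]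

theorem ae_ne_zero : ∀ᵐ t : ℝ, t ≠ 0 := by simp [ae_iff, measure_singleton]

theorem plusPart_sub_minusPart_ae (f : ℝ → ℂ) : plusPart f - minusPart f =ᵐ[volume] f := by
  filter_upwards [ae_ne_zero] with t ht
  rcases lt_or_gt_of_ne ht with h | h
  · simp [plusPart, minusPart, h, not_lt.2 h.le]
  · simp [plusPart, minusPart, h, not_lt.2 h.le]

theorem fourierIntegralOn_Ioi (f : ℝ → ℂ) (z : ℂ) :
    fourierIntegralOn (Ioi 0) f z = fourierIntegralOn univ (plusPart f) z := by
  simp only [fourierIntegralOn, setIntegral_univ]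
  rw [← integral_indicator measurableSet_Ioi]
  congr 2
  ext t
  by_cases h : 0 < t
  · rw [indicator_of_mem (mem_Ioi.2 h)]; simp [plusPart, h]
  · rw [indicator_of_notMem (by simpa using h)]; simp [plusPart, h]

/-- The sign is that of `minusPart`, chosen so that f is the difference of its two parts. -/
theorem fourierIntegralOn_Iio (f : ℝ → ℂ) (z : ℂ) :
    fourierIntegralOn (Iio 0) f z = -fourierIntegralOn univ (minusPart f) z := by
  simp only [fourierIntegralOn, setIntegral_univ]
  rw [← integral_indicator measurableSet_Iio, ← mul_neg, ← integral_neg]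
  congr 2
  ext t
  by_cases h : t < 0
  · rw [indicator_of_mem (mem_Iio.2 h)]; simp [minusPart, h]
  · rw [indicator_of_notMem (by simpa using h)]; simp [minusPart, h]

theorem fourierIntegral_eq_sub {a b : ℝ} {f : ℝ → ℂ} (hp : MemLp (expShift a (plusPart f)) 2 volume)
    (hm : MemLp (expShift b (minusPart f)) 2 volume) {z : ℂ} (hz : z ∈ strip a b) :
    fourierIntegralOn univ f z
      = fourierIntegralOn univ (plusPart f) z - fourierIntegralOn univ (minusPart f) z := by
  simp only [fourierIntegralOn, setIntegral_univ]
  rw [← mul_sub, ← integral_sub (integrable_mul_cexp hp (plusPart_of_neg f) hz.1)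
    (integrable_mul_cexp_lower hm (minusPart_of_pos f) hz.2)]
  congr 1
  refine integral_congr_ae ?_
  filter_upwards [plusPart_sub_minusPart_ae f] with t ht
  rw [← sub_mul, ← ht]
  rfl

theorem norm_eq_abs_re_le (z : ℂ) {R : ℝ} (h : R ≤ |z.re|) : R ≤ ‖z‖ :=
  h.trans (Complex.abs_re_le_norm z)

theorem tendsto_of_uniform_right {a : ℝ} {F : ℝ → ℂ} {c : ℂ}
    (h : ∀ ε > 0, ∃ δ > 0, ∀ s, a < s → s < a + δ → ‖F s - c‖ ≤ ε) :
    Tendsto F (𝓝[>] a) (𝓝 c) := by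
  rw [Metric.tendsto_nhds]
  intro ε hε
  obtain ⟨δ, hδ, h1⟩ := h (ε / 2) (half_pos hε)
  filter_upwards [Ioo_mem_nhdsGT (show a < a + δ by linarith)] with s hs
  rw [dist_eq_norm]
  linarith [h1 s hs.1 hs.2]

theorem tendsto_of_uniform_left {b : ℝ} {F : ℝ → ℂ} {c : ℂ}
    (h : ∀ ε > 0, ∃ δ > 0, ∀ s, s < b → b - δ < s → ‖F s - c‖ ≤ ε) :
    Tendsto F (𝓝[<] b) (𝓝 c) := by
  rw [Metric.tendsto_nhds]
  intro ε hε
  obtain ⟨δ, hδ, h1⟩ := h (ε / 2) (half_pos hε)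
  filter_upwards [Ioo_mem_nhdsLT (show b - δ < b by linarith)] with s hs
  rw [dist_eq_norm]
  linarith [h1 s hs.2 hs.1]

theorem tendsto_onLine_of_continuousWithinAt {F : ℂ → ℂ} {S : Set ℂ} {c x : ℝ} {l : Set ℝ}
    (hF : ContinuousWithinAt F S ((x : ℂ) + (c : ℂ) * Complex.I))
    (hl : ∀ᶠ s : ℝ in 𝓝[l] c, ((x : ℂ) + (s : ℂ) * Complex.I) ∈ S) :
    Tendsto (fun s => onLine s F x) (𝓝[l] c) (𝓝 (onLine c F x)) := by
  refine Tendsto.comp (g := F) (f := fun s : ℝ => (x : ℂ) + (s : ℂ) * Complex.I) hF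
    (tendsto_nhdsWithin_iff.2 ⟨?_, hl⟩)
  have : Continuous fun s : ℝ => (x : ℂ) + (s : ℂ) * Complex.I := by fun_prop
  exact (this.tendsto c).mono_left nhdsWithin_le_nhds

/-- Restrictions to lines of Fourier integrals inside the half-plane are bounded Hölder. -/
theorem bddHolder_onLine {a : ℝ} {h : ℝ → ℂ} (h2 : MemLp (expShift a h) 2 volume)
    (h0 : ∀ t < 0, h t = 0) {s : ℝ} (hs : a < s) :
    BddHolder (onLine s (fourierIntegralOn univ h)) := by
  obtain ⟨B, hB⟩ := exists_norm_fourierIntegral_le h2 h0 hs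
  obtain ⟨D, hD⟩ := exists_lipschitz_fourierIntegral h2 h0 hs
  refine bddHolder_of_lipschitz (B := B) (D := |D|) (fun x => hB _ (onLine_im s x).ge)
    (abs_nonneg _) fun x y => ?_
  refine (hD _ _ (onLine_im s x).ge (onLine_im s y).ge).trans ?_
  have : (x : ℂ) + s * Complex.I - (y + s * Complex.I) = ((x - y : ℝ) : ℂ) := by push_cast; ring
  rw [this, Complex.norm_real, Real.norm_eq_abs]
  exact mul_le_mul_of_nonneg_right (le_abs_self D) (abs_nonneg _)

theorem bddHolder_onLine_lower {b : ℝ} {h : ℝ → ℂ} (h2 : MemLp (expShift b h) 2 volume)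
    (h0 : ∀ t > 0, h t = 0) {s : ℝ} (hs : s < b) :
    BddHolder (onLine s (fourierIntegralOn univ h)) := by
  rw [onLine_fourierIntegral_comp_neg]
  exact (bddHolder_onLine (memLp_expShift_comp_neg h2) (comp_neg_eq_zero h0)
    (neg_lt_neg hs)).comp_neg

/-- The boundary behaviour of a function `K` with `K - 1` of class `{{a, b}}`. -/
theorem strip_properties {a b : ℝ} (hab : a < b) {K : ℂ → ℂ}
    (hcont : ContinuousOn K {z : ℂ | a ≤ z.im ∧ z.im < b})
    (hK : ImageStripClass a b fun z => K z - 1) :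
    DifferentiableOn ℂ K (strip a b) ∧
    (∀ s₁, a < s₁ → s₁ < b → ∀ ε > 0, ∃ R, ∀ z : ℂ, a ≤ z.im → z.im ≤ s₁ → R ≤ |z.re| →
      ‖K z - 1‖ ≤ ε) ∧
    (∃ M : ℝ≥0∞, M ≠ ∞ ∧ ∀ s, a < s → s < b →
      eLpNorm (fun x => onLine s K x - 1) 2 volume ≤ M) ∧
    BddHolder (onLine a K) ∧
    ∃ Ψ, BddHolder Ψ ∧ ∀ x, Tendsto (fun s => onLine s K x) (𝓝[<] b) (𝓝 (Ψ x)) := by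
  obtain ⟨f, ⟨⟨Φp, hΦp, hFp⟩, ⟨Φm, hΦm, hFm⟩⟩, hf⟩ := hK
  set fp := plusPart f
  set fm := minusPart f
  have hp0 : ∀ t < 0, fp t = 0 := plusPart_of_neg f
  have hm0 : ∀ t > 0, fm t = 0 := minusPart_of_pos f
  have hp2 := hFp.memLp_left
  have hm2 := hFm.memLp_left
  set Fp := fourierIntegralOn univ fp with hFpdef
  set Fm := fourierIntegralOn univ fm with hFmdef
  have hdec : ∀ z ∈ strip a b, K z = 1 + (Fp z - Fm z) := fun z hz => by
    rw [← fourierIntegral_eq_sub hp2 hm2 hz, ← hf z hz]; ring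
  have hdecl : ∀ s, a < s → s < b → ∀ x, onLine s K x = 1 + (onLine s Fp x - onLine s Fm x) :=
    fun s h1 h2 x => hdec _ ⟨by rwa [onLine_im], by rwa [onLine_im]⟩
  have hopen : IsOpen (strip a b) := (isOpen_lt continuous_const Complex.continuous_im).inter
    (isOpen_lt Complex.continuous_im continuous_const)
  have hKlim : ∀ x, Tendsto (fun s => onLine s K x) (𝓝[>] a) (𝓝 (onLine a K x)) := by
    intro x
    refine tendsto_onLine_of_continuousWithinAt (S := {z : ℂ | a ≤ z.im ∧ z.im < b})
      (hcont _ ?_) ?_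
    · exact ⟨(onLine_im a x).ge, by rwa [onLine_im]⟩
    · filter_upwards [Ioo_mem_nhdsGT hab] with s hs
      exact ⟨by rw [onLine_im]; exact hs.1.le, by rw [onLine_im]; exact hs.2⟩
  have hFplim : ∀ x, Tendsto (fun s => onLine s Fp x) (𝓝[>] a) (𝓝 (Φp x)) := fun x =>
    tendsto_of_uniform_right fun ε hε => by
      obtain ⟨δ, hδ, h⟩ := fourierIntegral_tendsto_boundary hp0 hFp hΦp.bddHolder hε
      exact ⟨δ, hδ, fun s h1 h2 => h s h1 h2 x⟩
  have hFmlim : ∀ x, Tendsto (fun s => onLine s Fm x) (𝓝[<] b) (𝓝 (Φm x)) := fun x =>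
    tendsto_of_uniform_left fun ε hε => by
      obtain ⟨δ, hδ, h⟩ := fourierIntegral_tendsto_boundary_lower hm0 hFm hΦm.bddHolder hε
      exact ⟨δ, hδ, fun s h1 h2 => h s h1 h2 x⟩
  have hFma : ∀ x, Tendsto (fun s => onLine s Fm x) (𝓝[>] a) (𝓝 (onLine a Fm x)) := fun x =>
    tendsto_onLine_of_continuousWithinAt (S := univ)
      (differentiableAt_fourierIntegral_lower hm2 hm0
        (by rwa [onLine_im])).continuousAt.continuousWithinAt
      (Eventually.of_forall fun _ => mem_univ _)
  have hFpb : ∀ x, Tendsto (fun s => onLine s Fp x) (𝓝[<] b) (𝓝 (onLine b Fp x)) := fun x =>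
    tendsto_onLine_of_continuousWithinAt (S := univ)
      (hasDerivAt_fourierIntegral hp2 hp0
        (by rwa [onLine_im])).continuousAt.continuousWithinAt
      (Eventually.of_forall fun _ => mem_univ _)
  -- The line Im z = a is interior to the half-plane of `Fm`, so only `Φp` enters as a boundary
  -- value; continuity of K up to the edge identifies the limit with K itself.
  have hKa : onLine a K = (fun _ => 1) + (Φp - onLine a Fm) := by
    ext x
    refine tendsto_nhds_unique (hKlim x) ?_
    refine (((hFplim x).sub (hFma x)).const_add 1).congr' ?_
    filter_upwards [Ioo_mem_nhdsGT hab] with s hs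
    exact (hdecl s hs.1 hs.2 x).symm
  refine ⟨?_, ?_, ?_, ?_, ?_⟩
  · intro z hz
    have h1 : DifferentiableAt ℂ (fun z => 1 + (Fp z - Fm z)) z :=
      ((hasDerivAt_fourierIntegral hp2 hp0 hz.1).differentiableAt.sub
        (differentiableAt_fourierIntegral_lower hm2 hm0 hz.2)).const_add 1
    refine (h1.congr_of_eventuallyEq ?_).differentiableWithinAt
    filter_upwards [hopen.mem_nhds hz] with w hw using hdec w hw
  · intro s₁ has hsb ε hε
    have hε4 : 0 < ε / 4 := by positivity
    obtain ⟨δ, hδ, h1⟩ := fourierIntegral_tendsto_boundary hp0 hFp hΦp.bddHolder hε4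
    obtain ⟨R₁, hR₁⟩ := hΦp.small_at_infinity hε4
    obtain ⟨R₂, hR₂⟩ := fourierIntegral_small_at_infinity hp2 hp0
      (show a < a + δ / 2 by linarith) hε4
    obtain ⟨R₃, hR₃⟩ := fourierIntegral_small_at_infinity_lower hm2 hm0 hsb hε4
    have hint : ∀ z : ℂ, a < z.im → z.im ≤ s₁ → max R₁ (max R₂ R₃) ≤ |z.re| → ‖K z - 1‖ ≤ ε := by
      intro z hza hzs hzR
      have hz1 : R₁ ≤ |z.re| := (le_max_left _ _).trans hzR
      have hz2 : R₂ ≤ |z.re| := ((le_max_left _ _).trans (le_max_right _ _)).trans hzR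
      have hz3 : R₃ ≤ |z.re| := ((le_max_right _ _).trans (le_max_right _ _)).trans hzR
      rw [hdec z ⟨hza, hzs.trans_lt hsb⟩, add_sub_cancel_left]
      have hFmz : ‖Fm z‖ ≤ ε / 4 := hR₃ z hzs (norm_eq_abs_re_le z hz3)
      have hFpz : ‖Fp z‖ ≤ ε / 2 := by
        -- The Riemann–Lebesgue lemma needs a fixed distance from the edge. Closer to it, `Fp` is
        -- uniformly near its boundary function, which is small at infinity.
        rcases le_total (a + δ / 2) z.im with h | h
        · exact (hR₂ z h (norm_eq_abs_re_le z hz2)).trans (by linarith)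
        · have e1 := h1 z.im hza (by linarith) z.re
          rw [onLine_re_im] at e1
          have e2 := hR₁ z.re hz1
          have e3 := norm_add_le (Fp z - Φp z.re) (Φp z.re)
          rw [sub_add_cancel] at e3
          linarith
      exact (norm_sub_le _ _).trans (by linarith)
    refine ⟨max R₁ (max R₂ R₃), fun z hza hzs hzR => ?_⟩
    rcases hza.eq_or_lt with h | h
    · have e1 := ((hKlim z.re).sub_const 1).norm
      have e2 : onLine a K z.re = K z := by rw [h, onLine_re_im]
      rw [e2] at e1
      refine le_of_tendsto e1 ?_
      filter_upwards [Ioo_mem_nhdsGT has] with s hs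
      exact hint _ (by rw [onLine_im]; exact hs.1) (by rw [onLine_im]; exact hs.2.le)
        (by rwa [onLine_re])
    · exact hint z h hzs hzR
  · refine ⟨eLpNorm (expShift a fp) 2 volume + eLpNorm (expShift b fm) 2 volume,
      (ENNReal.add_lt_top.2 ⟨hp2.2, hm2.2⟩).ne, fun s has hsb => ?_⟩
    have h1 : (fun x => onLine s K x - 1) = onLine s Fp - onLine s Fm := by
      ext x
      rw [hdecl s has hsb, add_sub_cancel_left]; rfl
    have e1 := isFourierL2_onLine hp2 hp0 has
    rw [h1]
    refine (eLpNorm_sub_le e1.memLp_right.1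
      (isFourierL2_onLine_lower hm2 hm0 hsb).memLp_right.1 (by norm_num)).trans ?_
    refine add_le_add ?_ (eLpNorm_onLine_lower_le hm2 hm0 hsb)
    rw [e1.eLpNorm_eq]
    exact eLpNorm_expShift_le hp0 has.le
  · rw [hKa]
    exact (bddHolder_const 1).add (hΦp.bddHolder.sub (bddHolder_onLine_lower hm2 hm0 hab))
  · refine ⟨(fun _ => 1) + (onLine b Fp - Φm),
      (bddHolder_const 1).add ((bddHolder_onLine hp2 hp0 hab).sub hΦm.bddHolder), fun x => ?_⟩
    refine (((hFpb x).sub (hFmlim x)).const_add 1).congr' ?_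
    filter_upwards [Ioo_mem_nhdsLT hab] with s hs
    exact (hdecl s hs.1 hs.2 x).symm


/-! ### Logarithms on the strip -/

/-- Lifting through the covering map `exp`, possible because a convex set is contractible and
locally path connected. S need not be open, so that the edge Im z = a can be included. -/
theorem exists_continuousOn_log_of_convex {S : Set ℂ} (hS : Convex ℝ S) (hne : S.Nonempty)
    {K : ℂ → ℂ} (hK : ContinuousOn K S) (h0 : ∀ z ∈ S, K z ≠ 0) :
    ∃ L : ℂ → ℂ, ContinuousOn L S ∧ ∀ z ∈ S, Complex.exp (L z) = K z := by
  classical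
  have := hS.contractibleSpace hne
  have := hS.locallyPathConnectedSpace
  obtain ⟨x₀, hx₀⟩ := hne
  rcases Complex.isCoveringMapOn_exp.existsUnique_continuousMap_lifts
    ⟨S.domRestrict K, continuousOn_iff_continuous_domRestrict.mp hK⟩ (a₀ := ⟨x₀, hx₀⟩)
    (Complex.exp_log (h0 x₀ hx₀)) (fun x ↦ h0 x x.2) with ⟨f, ⟨-, hf⟩, -⟩
  refine ⟨fun z ↦ if hz : z ∈ S then f ⟨z, hz⟩ else 0, ?_, fun z hz => ?_⟩
  · rw [continuousOn_iff_continuous_domRestrict]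
    convert map_continuous f
    simp
  · have := congrFun hf ⟨z, hz⟩
    simpa [hz] using this

theorem eqOn_of_exp_eq {X : Type*} [TopologicalSpace X] {S : Set X} (hS : IsPreconnected S)
    {f g : X → ℂ} (hf : ContinuousOn f S) (hg : ContinuousOn g S)
    (h : ∀ x ∈ S, Complex.exp (f x) = Complex.exp (g x)) {x₀ : X} (hx₀ : x₀ ∈ S)
    (h₀ : f x₀ = g x₀) : EqOn f g S :=
  Complex.isCoveringMap_exp.eqOn_of_comp_eqOn hS hf hg
    (fun x hx => Subtype.ext (h x hx)) hx₀ h₀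

theorem exists_eq_add_of_exp_eq {X : Type*} [TopologicalSpace X] {S : Set X}
    (hS : IsPreconnected S) (hne : S.Nonempty)
    {f g : X → ℂ} (hf : ContinuousOn f S) (hg : ContinuousOn g S)
    (h : ∀ x ∈ S, Complex.exp (f x) = Complex.exp (g x)) :
    ∃ c, Complex.exp c = 1 ∧ ∀ x ∈ S, f x = g x + c := by
  obtain ⟨x₀, hx₀⟩ := hne
  have hc : Complex.exp (f x₀ - g x₀) = 1 := by
    rw [Complex.exp_sub, h x₀ hx₀, div_self (Complex.exp_ne_zero _)]
  refine ⟨f x₀ - g x₀, hc, ?_⟩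
  refine eqOn_of_exp_eq hS hf (hg.add continuousOn_const) (fun x hx => ?_) hx₀
    (by simp)
  rw [Complex.exp_add, hc, mul_one, h x hx]

/-- Near z, continuity keeps Im (L w - L z) within (-π, π), so L w = L z + log (K w / K z) with the
principal logarithm. -/
theorem differentiableAt_of_exp {K L : ℂ → ℂ} {z : ℂ} (hK : DifferentiableAt ℂ K z)
    (hL : ContinuousAt L z) (h : ∀ᶠ w in 𝓝 z, Complex.exp (L w) = K w) :
    DifferentiableAt ℂ L z := by
  have hz : Complex.exp (L z) = K z := h.self_of_nhds
  have hz0 : K z ≠ 0 := hz ▸ Complex.exp_ne_zero _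
  have h1 : DifferentiableAt ℂ (fun w => L z + Complex.log (K w / K z)) z := by
    refine (DifferentiableAt.clog (hK.div_const _) ?_).const_add _
    rw [div_self hz0]
    exact Complex.one_mem_slitPlane
  refine h1.congr_of_eventuallyEq ?_
  have h2 : ∀ᶠ w in 𝓝 z, ‖L w - L z‖ < 1 := by
    have := Metric.tendsto_nhds.1 hL 1 one_pos
    simpa only [dist_eq_norm] using this
  filter_upwards [h, h2] with w hw hw'
  have h3 : |(L w - L z).im| < 1 := (Complex.abs_im_le_norm _).trans_lt hw'
  have h4 := abs_lt.1 h3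
  have hpi := Real.pi_gt_three
  rw [← hw, ← hz, ← Complex.exp_sub, Complex.log_exp (by linarith) (by linarith)]
  ring

theorem isPreconnected_strip (a b : ℝ) : IsPreconnected (strip a b) :=
  ((convex_halfSpace_im_gt a).inter (convex_halfSpace_im_lt b)).isPreconnected

/-- The analytic branch of the logarithm is unique. -/
theorem IsLog.unique {a b : ℝ} (hab : a < b) {K L L' : ℂ → ℂ} (h : IsLog a b K L)
    (h' : IsLog a b K L') : EqOn L L' (strip a b) := by
  obtain ⟨s, has, hsb⟩ := exists_between hab
  have hmem : ∀ x : ℝ, (x : ℂ) + (s : ℂ) * Complex.I ∈ strip a b := fun x =>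
    ⟨by rwa [onLine_im], by rwa [onLine_im]⟩
  obtain ⟨c, -, hc⟩ := exists_eq_add_of_exp_eq (isPreconnected_strip a b) ⟨_, hmem 0⟩
    h.analytic.continuousOn h'.analytic.continuousOn
    (fun z hz => (h.exp_eq z hz).trans (h'.exp_eq z hz).symm)
  have h1 : Tendsto (fun x => onLine s L x - onLine s L' x) (cocompact ℝ) (𝓝 0) := by
    simpa using (h.vanish s has hsb).sub (h'.vanish s has hsb)
  have h2 : Tendsto (fun x => onLine s L x - onLine s L' x) (cocompact ℝ) (𝓝 c) := by
    refine tendsto_const_nhds.congr fun x => ?_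
    rw [onLine, onLine, hc _ (hmem x), add_sub_cancel_left]
  have hc0 : c = 0 := tendsto_nhds_unique h2 h1
  intro z hz
  rw [hc z hz, hc0, add_zero]

theorem tendsto_cocompact_of_small {F : ℝ → ℂ}
    (h : ∀ ε > 0, ∃ R, ∀ x : ℝ, R ≤ |x| → ‖F x‖ ≤ ε) : Tendsto F (cocompact ℝ) (𝓝 0) := by
  rw [Metric.tendsto_nhds]
  intro ε hε
  obtain ⟨R, hR⟩ := h (ε / 2) (half_pos hε)
  have h1 : (Metric.closedBall (0 : ℝ) |R|)ᶜ ∈ cocompact ℝ :=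
    (isCompact_closedBall _ _).compl_mem_cocompact
  filter_upwards [h1] with x hx
  rw [mem_compl_iff, mem_closedBall_zero_iff, not_le, Real.norm_eq_abs] at hx
  rw [dist_zero_right]
  linarith [hR x ((le_abs_self R).trans hx.le)]

theorem exists_small_of_tendsto {F : ℝ → ℂ} (h : Tendsto F atTop (𝓝 0))
    (h' : Tendsto F atBot (𝓝 0)) {ε : ℝ} (hε : 0 < ε) :
    ∃ R, ∀ x : ℝ, R ≤ |x| → ‖F x‖ ≤ ε := by
  obtain ⟨R₁, h₁⟩ := eventually_atTop.1 (Metric.tendsto_nhds.1 h ε hε)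
  obtain ⟨R₂, h₂⟩ := eventually_atBot.1 (Metric.tendsto_nhds.1 h' ε hε)
  refine ⟨max R₁ (-R₂), fun x hx => ?_⟩
  rcases le_total 0 x with h0 | h0
  · rw [abs_of_nonneg h0] at hx
    have := h₁ x ((le_max_left _ _).trans hx)
    rw [dist_zero_right] at this
    exact this.le
  · rw [abs_of_nonpos h0] at hx
    have := h₂ x (by linarith [(le_max_right R₁ (-R₂)).trans hx])
    rw [dist_zero_right] at this
    exact this.le

/-- A function of index zero which tends to `1` at infinity has a logarithm vanishing at
infinity. -/
theorem HasIndex.exists_log {φ : ℝ → ℂ} (h : HasIndex φ 0)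
    (h1 : Tendsto φ atTop (𝓝 1)) :
    ∃ l : ℝ → ℂ, Continuous l ∧ (∀ x, Complex.exp (l x) = φ x) ∧
      (Tendsto φ atBot (𝓝 1) → ∀ ε > 0, ∃ R, ∀ x : ℝ, R ≤ |x| → ‖l x‖ ≤ ε) := by
  obtain ⟨hc, h0, θ, hθ, hφ, p, m, hp, hm, hpm⟩ := h
  -- Index zero means that the argument has the same limit at both ends. Since φ → 1, this limit is
  -- a multiple of 2π and can be subtracted from the argument.
  have hmp : m = p := by
    have := two_pi_pos.ne'
    rw [eq_div_iff this, zero_mul] at hpm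
    linarith
  subst hmp
  have hexp : Complex.exp (Complex.I * (m : ℂ)) = 1 := by
    have e1 : Tendsto (fun x => (‖φ x‖ : ℂ) * Complex.exp (Complex.I * (θ x : ℂ))) atTop
        (𝓝 (((‖(1 : ℂ)‖ : ℝ) : ℂ) * Complex.exp (Complex.I * (m : ℂ)))) := by
      refine Tendsto.mul ?_ ?_
      · exact (Complex.continuous_ofReal.tendsto _).comp h1.norm
      · have : Continuous fun r : ℝ => Complex.exp (Complex.I * (r : ℂ)) := by fun_prop
        exact (this.tendsto m).comp hp
    have e2 := tendsto_nhds_unique (e1.congr fun x => (hφ x).symm) h1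
    simpa using e2
  have hlog : ∀ x, Complex.exp ((Real.log ‖φ x‖ : ℝ) : ℂ) = (‖φ x‖ : ℂ) := fun x => by
    rw [← Complex.ofReal_exp, Real.exp_log (norm_pos_iff.2 (h0 x))]
  have hlim : ∀ l : Filter ℝ, Tendsto φ l (𝓝 1) → Tendsto θ l (𝓝 m) →
      Tendsto (fun x => ((Real.log ‖φ x‖ : ℝ) : ℂ) + Complex.I * ((θ x - m : ℝ) : ℂ)) l (𝓝 0) := by
    intro l h2 h3
    have e1 : Tendsto (fun x => Real.log ‖φ x‖) l (𝓝 0) := by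
      have := h2.norm
      rw [norm_one] at this
      simpa using this.log one_ne_zero
    have e2 := (Complex.continuous_ofReal.tendsto _).comp e1
    have e3 := (Complex.continuous_ofReal.tendsto _).comp (h3.sub_const m)
    simpa [Function.comp_def] using e2.add (e3.const_mul Complex.I)
  refine ⟨fun x => ((Real.log ‖φ x‖ : ℝ) : ℂ) + Complex.I * ((θ x - m : ℝ) : ℂ), ?_, fun x => ?_,
    fun h2 ε hε => exists_small_of_tendsto (hlim _ h1 hp) (hlim _ h2 hm) hε⟩
  · have : Continuous fun x => Real.log ‖φ x‖ :=
      hc.norm.log fun x => norm_ne_zero_iff.2 (h0 x)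
    fun_prop
  · rw [Complex.exp_add, hlog]
    have : Complex.I * ((θ x - m : ℝ) : ℂ) = Complex.I * (θ x : ℂ) - Complex.I * (m : ℂ) := by
      push_cast; ring
    rw [this, Complex.exp_sub, hexp, div_one]
    exact (hφ x).symm

/-- Existence of the logarithm on the strip, continuous up to the lower boundary line and
vanishing uniformly at infinity. -/
theorem exists_isLog {a b : ℝ} (hab : a < b) {K : ℂ → ℂ}
    (hcont : ContinuousOn K {z : ℂ | a ≤ z.im ∧ z.im < b})
    (hne : ∀ z ∈ strip a b, K z ≠ 0) (hd : DifferentiableOn ℂ K (strip a b))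
    (hsmall : ∀ s₁, a < s₁ → s₁ < b → ∀ ε > 0, ∃ R, ∀ z : ℂ, a ≤ z.im → z.im ≤ s₁ → R ≤ |z.re| →
      ‖K z - 1‖ ≤ ε)
    (hind : HasIndex (onLine a K) 0) :
    ∃ L : ℂ → ℂ, ContinuousOn L {z : ℂ | a ≤ z.im ∧ z.im < b} ∧
      (∀ z : ℂ, a ≤ z.im → z.im < b → Complex.exp (L z) = K z) ∧ IsLog a b K L ∧
      ∀ s₁, a < s₁ → s₁ < b → ∀ ε > 0, ∃ R, ∀ z : ℂ, a ≤ z.im → z.im ≤ s₁ → R ≤ |z.re| →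
        ‖L z‖ ≤ ε := by
  set S : Set ℂ := {z : ℂ | a ≤ z.im ∧ z.im < b} with hS
  have hSc : Convex ℝ S := (convex_halfSpace_im_ge a).inter (convex_halfSpace_im_lt b)
  have hline : ∀ x : ℝ, (x : ℂ) + (a : ℂ) * Complex.I ∈ S := fun x =>
    ⟨(onLine_im a x).ge, by rwa [onLine_im]⟩
  have h0 : ∀ z ∈ S, K z ≠ 0 := by
    intro z hz
    rcases hz.1.eq_or_lt with h | h
    · have := hind.2.1 z.re
      rwa [h, onLine_re_im] at this
    · exact hne z ⟨h, hz.2⟩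
  obtain ⟨L₀, hL₀c, hL₀⟩ := exists_continuousOn_log_of_convex hSc ⟨_, hline 0⟩ hcont h0
  have hKa : ∀ ε > 0, ∃ R, ∀ x : ℝ, R ≤ |x| → ‖onLine a K x - 1‖ ≤ ε := by
    intro ε hε
    obtain ⟨s₁, h1, h2⟩ := exists_between hab
    obtain ⟨R, hR⟩ := hsmall s₁ h1 h2 ε hε
    exact ⟨R, fun x hx => hR _ (onLine_im a x).ge (by rw [onLine_im]; exact h1.le)
      (by rwa [onLine_re])⟩
  have hKa1 : Tendsto (onLine a K) (cocompact ℝ) (𝓝 1) := by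
    have := (tendsto_cocompact_of_small hKa).add_const 1
    simpa using this
  obtain ⟨l, hlc, hl, hlsmall⟩ := hind.exists_log (hKa1.mono_left atTop_le_cocompact)
  have hlsm := hlsmall (hKa1.mono_left atBot_le_cocompact)
  have hmap : Continuous fun x : ℝ => (x : ℂ) + (a : ℂ) * Complex.I := by fun_prop
  obtain ⟨c, hc1, hc⟩ := exists_eq_add_of_exp_eq (S := (univ : Set ℝ)) isPreconnected_univ
    ⟨0, mem_univ _⟩ (f := onLine a L₀) (g := l)
    (hL₀c.comp hmap.continuousOn fun x _ => hline x) hlc.continuousOn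
    (fun x _ => (hL₀ _ (hline x)).trans (hl x).symm)
  -- The constant is fixed so that on Im z = a the logarithm is `l`, which vanishes at both ends.
  set L : ℂ → ℂ := fun z => L₀ z - c with hLdef
  have hLc : ContinuousOn L S := hL₀c.sub continuousOn_const
  have hLexp : ∀ z ∈ S, Complex.exp (L z) = K z := fun z hz => by
    rw [hLdef, Complex.exp_sub, hc1, div_one, hL₀ z hz]
  have hLa : ∀ x, onLine a L x = l x := fun x => by
    have := hc x (mem_univ x)
    simp only [onLine] at this ⊢
    rw [hLdef]
    simp only [this, add_sub_cancel_right]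
  have hLsmall : ∀ s₁, a < s₁ → s₁ < b → ∀ ε > 0, ∃ R, ∀ z : ℂ, a ≤ z.im → z.im ≤ s₁ →
      R ≤ |z.re| → ‖L z‖ ≤ ε := by
    intro s₁ h1 h2 ε hε
    have hlogc : ContinuousAt Complex.log 1 :=
      continuousAt_clog Complex.one_mem_slitPlane
    obtain ⟨η, hη, hηε⟩ := Metric.continuousAt_iff.1 hlogc ε hε
    obtain ⟨R₁, hR₁⟩ := hsmall s₁ h1 h2 (min (η / 2) (1 / 2)) (by positivity)
    obtain ⟨R₂, hR₂⟩ := hlsm 1 one_pos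
    refine ⟨max R₁ R₂, fun z hz1 hz2 hzR => ?_⟩
    have hK1 : ∀ y ∈ Icc a s₁, ‖onLine y K z.re - 1‖ ≤ min (η / 2) (1 / 2) := fun y hy =>
      hR₁ _ (by rw [onLine_im]; exact hy.1) (by rw [onLine_im]; exact hy.2)
        (by rw [onLine_re]; exact (le_max_left _ _).trans hzR)
    have hslit : ∀ y ∈ Icc a s₁, onLine y K z.re ∈ Complex.slitPlane := fun y hy => by
      have h3 := (hK1 y hy).trans (min_le_right _ _)
      refine Complex.mem_slitPlane_iff.2 (Or.inl ?_)
      have h4 := (Complex.abs_re_le_norm _).trans h3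
      rw [Complex.sub_re, Complex.one_re] at h4
      linarith [(abs_le.1 h4).1]
    have hyS : ∀ y ∈ Icc a s₁, (z.re : ℂ) + (y : ℂ) * Complex.I ∈ S := fun y hy =>
      ⟨by rw [onLine_im]; exact hy.1, by rw [onLine_im]; exact hy.2.trans_lt h2⟩
    have hvert : ContinuousOn (fun y : ℝ => (z.re : ℂ) + (y : ℂ) * Complex.I) (Icc a s₁) :=
      Continuous.continuousOn (by fun_prop)
    -- Smallness is carried upwards: for large |Re z| the whole vertical segment is mapped by K near
    -- 1, so L and the principal logarithm of K are two continuous lifts on it. They agree at the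
    -- bottom, where |l| ≤ 1 < π.
    have hEq : EqOn (fun y => onLine y L z.re) (fun y => Complex.log (onLine y K z.re))
        (Icc a s₁) := by
      refine eqOn_of_exp_eq isPreconnected_Icc (hLc.comp hvert hyS)
        (ContinuousOn.clog (hcont.comp hvert hyS) hslit) (fun y hy => ?_)
        (left_mem_Icc.2 h1.le) ?_
      · rw [Complex.exp_log (Complex.slitPlane_ne_zero (hslit y hy))]
        exact hLexp _ (hyS y hy)
      · have h3 := hR₂ z.re ((le_max_right _ _).trans hzR)
        have h4 := abs_le.1 ((Complex.abs_im_le_norm _).trans h3)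
        have hpi := Real.pi_gt_three
        have h5 : onLine a K z.re = Complex.exp (l z.re) := by
          rw [hl]
        rw [hLa, h5, Complex.log_exp (by linarith) (by linarith)]
    have h6 := hEq ⟨hz1, hz2⟩
    simp only [onLine_re_im] at h6
    have h7 := (hK1 z.im ⟨hz1, hz2⟩).trans (min_le_left _ _)
    rw [onLine_re_im] at h7
    have h8 := hηε (x := K z) (by rw [dist_eq_norm]; linarith)
    rw [Complex.log_one, dist_zero_right] at h8
    rw [h6]
    exact h8.le
  have hopen : IsOpen (strip a b) := (isOpen_lt continuous_const Complex.continuous_im).inter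
    (isOpen_lt Complex.continuous_im continuous_const)
  have hsub : strip a b ⊆ S := fun z hz => ⟨hz.1.le, hz.2⟩
  refine ⟨L, hLc, fun z hz1 hz2 => hLexp z ⟨hz1, hz2⟩, ⟨fun z hz => ?_, fun z hz =>
    hLexp z (hsub hz), fun s has hsb => ?_⟩, hLsmall⟩
  · refine (differentiableAt_of_exp (hd.differentiableAt (hopen.mem_nhds hz))
      ((hLc.mono hsub).continuousAt (hopen.mem_nhds hz)) ?_).differentiableWithinAt
    filter_upwards [hopen.mem_nhds hz] with w hw using hLexp w (hsub hw)
  · refine tendsto_cocompact_of_small fun ε hε => ?_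
    obtain ⟨R, hR⟩ := hLsmall s has hsb ε hε
    exact ⟨R, fun x hx => hR _ (by rw [onLine_im]; exact has.le) (onLine_im s x).le
      (by rwa [onLine_re])⟩


/-! ### Square integrability of the logarithm and its inverse transform -/

theorem exists_norm_le_of_small {a b s₁ R : ℝ} {L : ℂ → ℂ}
    (hc : ContinuousOn L {z : ℂ | a ≤ z.im ∧ z.im < b}) (hs : s₁ < b)
    (h : ∀ z : ℂ, a ≤ z.im → z.im ≤ s₁ → R ≤ |z.re| → ‖L z‖ ≤ 1) :
    ∃ B, ∀ z : ℂ, a ≤ z.im → z.im ≤ s₁ → ‖L z‖ ≤ B := by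
  have hcomp : IsCompact (Icc (-R) R ×ℂ Icc a s₁) := isCompact_Icc.reProdIm isCompact_Icc
  have hsub : (Icc (-R) R ×ℂ Icc a s₁) ⊆ {z : ℂ | a ≤ z.im ∧ z.im < b} := fun z hz =>
    ⟨(Complex.mem_reProdIm.1 hz).2.1, (Complex.mem_reProdIm.1 hz).2.2.trans_lt hs⟩
  obtain ⟨B, hB⟩ := hcomp.exists_bound_of_continuousOn (hc.mono hsub)
  refine ⟨max B 1, fun z h1 h2 => ?_⟩
  by_cases hR : R ≤ |z.re|
  · exact (h z h1 h2 hR).trans (le_max_right _ _)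
  · exact (hB z (Complex.mem_reProdIm.2 ⟨abs_le.1 (not_le.1 hR).le, h1, h2⟩)).trans
      (le_max_left _ _)

theorem continuous_onLine_of_continuousOn {a b s : ℝ} {G : ℂ → ℂ}
    (hG : ContinuousOn G {z : ℂ | a ≤ z.im ∧ z.im < b}) (h1 : a ≤ s) (h2 : s < b) :
    Continuous (onLine s G) :=
  hG.comp_continuous (f := fun x : ℝ => (x : ℂ) + (s : ℂ) * Complex.I) (by fun_prop)
    (fun x => by simpa using ⟨h1, h2⟩)

theorem exists_eLpNorm_log_le {a b s₁ B R : ℝ} {K L : ℂ → ℂ} {M : ℝ≥0∞} (hM : M ≠ ∞)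
    (hK : ContinuousOn K {z : ℂ | a ≤ z.im ∧ z.im < b})
    (hexp : ∀ z : ℂ, a ≤ z.im → z.im < b → Complex.exp (L z) = K z)
    (hK2 : ∀ s, a < s → s < b → eLpNorm (fun x => onLine s K x - 1) 2 volume ≤ M) (hs₁ : s₁ < b)
    (hB : ∀ z : ℂ, a ≤ z.im → z.im ≤ s₁ → ‖L z‖ ≤ B)
    (hR : ∀ z : ℂ, a ≤ z.im → z.im ≤ s₁ → R ≤ |z.re| → ‖L z‖ ≤ 1 / 2) :
    ∃ M' : ℝ≥0∞, M' ≠ ∞ ∧ ∀ s, a < s → s ≤ s₁ → eLpNorm (onLine s L) 2 volume ≤ M' := by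
  -- For |x| ≥ R, |L| ≤ 1/2 yields |L| ≤ 2|K - 1|. On the compact remainder only the bound B is
  -- available, and it is square integrable there.
  set χ : ℝ → ℝ := (Icc (-R) R).indicator fun _ => B with hχ
  have hχ2 : MemLp χ 2 volume :=
    memLp_indicator_const 2 measurableSet_Icc B (Or.inr (by simp))
  refine ⟨2 * M + eLpNorm χ 2 volume,
    ENNReal.add_ne_top.2 ⟨ENNReal.mul_ne_top (by simp) hM, hχ2.2.ne⟩, fun s h1 h2 => ?_⟩
  have hc : Continuous fun x => onLine s K x - 1 :=
    (continuous_onLine_of_continuousOn hK h1.le (h2.trans_lt hs₁)).sub continuous_const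
  have hpt : ∀ x, ‖onLine s L x‖ ≤ 2 * ‖onLine s K x - 1‖ + χ x := by
    intro x
    set z : ℂ := (x : ℂ) + (s : ℂ) * Complex.I
    have him : z.im = s := onLine_im s x
    have hre : z.re = x := onLine_re s x
    by_cases hx : R ≤ |x|
    · have h3 := half_norm_le_norm_exp_sub_one
        (hR z (him ▸ h1.le) (him ▸ h2) (hre ▸ hx))
      rw [hexp z (him ▸ h1.le) (him ▸ h2.trans_lt hs₁)] at h3
      have h4 : 0 ≤ χ x := by
        refine indicator_nonneg (fun _ _ => ?_) x
        exact (norm_nonneg _).trans (hB z (him ▸ h1.le) (him ▸ h2))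
      exact h3.trans (le_add_of_nonneg_right h4)
    · have hxm : x ∈ Icc (-R) R := abs_le.1 (not_le.1 hx).le
      have h4 : χ x = B := indicator_of_mem hxm _
      rw [h4]
      exact (hB z (him ▸ h1.le) (him ▸ h2)).trans (le_add_of_nonneg_left (by positivity))
  calc eLpNorm (onLine s L) 2 volume
      ≤ eLpNorm ((fun x => 2 * ‖onLine s K x - 1‖) + χ) 2 volume := eLpNorm_mono_real hpt
    _ ≤ eLpNorm (fun x => 2 * ‖onLine s K x - 1‖) 2 volume + eLpNorm χ 2 volume :=
        eLpNorm_add_le (by fun_prop : Continuous _).aestronglyMeasurable hχ2.1 (by norm_num)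
    _ ≤ 2 * M + eLpNorm χ 2 volume := by
        gcongr
        have h5 := eLpNorm_const_smul (2 : ℝ) (fun x => ‖onLine s K x - 1‖) 2 volume
        rw [eLpNorm_norm] at h5
        have h6 : (2 : ℝ) • (fun x => ‖onLine s K x - 1‖) = fun x => 2 * ‖onLine s K x - 1‖ := rfl
        rw [h6] at h5
        rw [h5]
        have h7 : ‖(2 : ℝ)‖ₑ = 2 := by simp [enorm_eq_nnnorm]
        rw [h7]
        gcongr
        exact hK2 s h1 (h2.trans_lt hs₁)

/-- The logarithm of the kernel: bounds on sub-strips, and Hölder continuity on the edge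
`Im z = a`. -/
theorem exists_isLog_bounded {a b : ℝ} (hab : a < b) {K : ℂ → ℂ}
    (hcont : ContinuousOn K {z : ℂ | a ≤ z.im ∧ z.im < b})
    (hne : ∀ z ∈ strip a b, K z ≠ 0)
    (hK : ImageStripClass a b fun z => K z - 1)
    (hind : HasIndex (onLine a K) 0) :
    ∃ L : ℂ → ℂ, IsLog a b K L ∧
      (∀ s₁, a < s₁ → s₁ < b → ∃ B, ∀ z : ℂ, a ≤ z.im → z.im ≤ s₁ → ‖L z‖ ≤ B) ∧
      (∀ s₁, a < s₁ → s₁ < b → ∃ M : ℝ≥0∞, M ≠ ∞ ∧ ∀ s, a < s → s ≤ s₁ →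
        eLpNorm (onLine s L) 2 volume ≤ M) ∧
      BddHolder (onLine a L) ∧
      ∀ x, Tendsto (fun s => onLine s L x) (𝓝[>] a) (𝓝 (onLine a L x)) := by
  obtain ⟨hd, hsmall, ⟨M, hM, hK2⟩, hHol, -⟩ := strip_properties hab hcont hK
  obtain ⟨L, hLc, hexp, hLog, hLs⟩ := exists_isLog hab hcont hne hd hsmall hind
  have hbd : ∀ s₁, a < s₁ → s₁ < b → ∃ B, ∀ z : ℂ, a ≤ z.im → z.im ≤ s₁ → ‖L z‖ ≤ B := by
    intro s₁ h1 h2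
    obtain ⟨R, hR⟩ := hLs s₁ h1 h2 1 one_pos
    exact exists_norm_le_of_small hLc h2 hR
  refine ⟨L, hLog, hbd, ?_, ?_, ?_⟩
  · intro s₁ h1 h2
    obtain ⟨B, hB⟩ := hbd s₁ h1 h2
    obtain ⟨R, hR⟩ := hLs s₁ h1 h2 (1 / 2) (by norm_num)
    exact exists_eLpNorm_log_le hM hcont hexp hK2 h2 hB hR
  · obtain ⟨s₁, h1, h2⟩ := exists_between hab
    obtain ⟨B, hB⟩ := hbd s₁ h1 h2
    have hexp' : (fun x => Complex.exp (onLine a L x)) = onLine a K := funext fun x =>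
      hexp _ (onLine_im a x).ge (by rw [onLine_im]; exact hab)
    refine BddHolder.of_exp (by rw [hexp']; exact hHol)
      (fun x => hB _ (onLine_im a x).ge (by rw [onLine_im]; exact h1.le)) ?_
    refine (continuous_onLine_of_continuousOn hLc le_rfl hab).uniformContinuous_of_tendsto_cocompact
      (x := 0) (tendsto_cocompact_of_small fun ε hε => ?_)
    obtain ⟨R, hR⟩ := hLs s₁ h1 h2 ε hε
    exact ⟨R, fun x hx => hR _ (onLine_im a x).ge (by rw [onLine_im]; exact h1.le)
      (by rw [onLine_re]; exact hx)⟩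
  · intro x
    refine tendsto_onLine_of_continuousWithinAt (hLc _ (by simpa using hab)) ?_
    filter_upwards [Ioo_mem_nhdsGT hab] with s hs
    simpa using ⟨hs.1.le, hs.2⟩

theorem isOpen_strip (a b : ℝ) : IsOpen (strip a b) :=
  (isOpen_lt continuous_const Complex.continuous_im).inter
    (isOpen_lt Complex.continuous_im continuous_const)

theorem continuous_onLine_of_differentiableOn_strip {a b s : ℝ} {L : ℂ → ℂ}
    (hd : DifferentiableOn ℂ L (strip a b)) (h1 : a < s) (h2 : s < b) : Continuous (onLine s L) :=
  continuous_onLine_of_continuousAt fun _ hz =>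
    (hd.differentiableAt ((isOpen_strip a b).mem_nhds ⟨hz ▸ h1, hz ▸ h2⟩)).continuousAt

/-- The original is read off from one line; boundedness of L between two lines lets
`isFourierL2_onLine_shift` carry it to every other. -/
theorem exists_isInverseFourierOnStrip {a b : ℝ} (hab : a < b) {L : ℂ → ℂ}
    (hd : DifferentiableOn ℂ L (strip a b))
    (hB : ∀ s₁, a < s₁ → s₁ < b → ∃ B, ∀ z : ℂ, a ≤ z.im → z.im ≤ s₁ → ‖L z‖ ≤ B)
    (h2 : ∀ s₁, a < s₁ → s₁ < b → ∃ M : ℝ≥0∞, M ≠ ∞ ∧ ∀ s, a < s → s ≤ s₁ →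
      eLpNorm (onLine s L) 2 volume ≤ M) :
    ∃ κ, IsInverseFourierOnStrip a b L κ := by
  have hda : ∀ z ∈ strip a b, DifferentiableAt ℂ L z := fun z hz =>
    hd.differentiableAt ((isOpen_strip a b).mem_nhds hz)
  have hmem : ∀ s, a < s → s < b → MemLp (onLine s L) 2 volume := by
    intro s h3 h4
    obtain ⟨M, hM, hM2⟩ := h2 s h3 h4
    refine ⟨(continuous_onLine_of_differentiableOn_strip hd h3 h4).aestronglyMeasurable,
      (hM2 s h3 le_rfl).trans_lt hM.lt_top⟩
  obtain ⟨s₀, h3, h4⟩ := exists_between hab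
  obtain ⟨f, hf⟩ := exists_isFourierL2_left (hmem s₀ h3 h4)
  have hshift : expShift s₀ (expShift (-s₀) f) = f := by
    rw [expShift_expShift]; funext t; simp [expShift]
  refine ⟨expShift (-s₀) f, fun s h5 h6 => ?_⟩
  obtain ⟨B, hB'⟩ := hB (max s₀ s) (lt_max_of_lt_left h3) (max_lt h4 h6)
  have hmin : a < min s₀ s := lt_min h3 h5
  refine isFourierL2_onLine_shift (s₁ := s₀) (B := B) (fun z hz => hda z ?_) (fun z hz => ?_)
    (by rw [hshift]; exact hf) (hmem s h5 h6)
  · exact ⟨hmin.trans_le hz.1, hz.2.trans_lt (max_lt h4 h6)⟩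
  · exact hB' z (hmin.le.trans hz.1) hz.2

/-- The hypothesis on κ concerns interior lines only; L² bounds that are uniform down to the edge
allow the limit along lines descending from s₁ to a. -/
theorem isFourierL2_expShift_left_edge {a b : ℝ} (hab : a < b) {L : ℂ → ℂ} {κ : ℝ → ℂ}
    (h2 : ∀ s₁, a < s₁ → s₁ < b → ∃ M : ℝ≥0∞, M ≠ ∞ ∧ ∀ s, a < s → s ≤ s₁ →
      eLpNorm (onLine s L) 2 volume ≤ M)
    (hl : ∀ x, Tendsto (fun s => onLine s L x) (𝓝[>] a) (𝓝 (onLine a L x)))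
    (hκ : IsInverseFourierOnStrip a b L κ) : IsFourierL2 (expShift a κ) (onLine a L) := by
  obtain ⟨s₁, h3, h4⟩ := exists_between hab
  obtain ⟨M, hM, hM2⟩ := h2 s₁ h3 h4
  set s : ℕ → ℝ := fun n => a + (s₁ - a) / (n + 1) with hs
  have hpos : 0 < s₁ - a := sub_pos.2 h3
  have hgt : ∀ n, a < s n := fun n => lt_add_of_pos_right _ (by positivity)
  have hle : ∀ n, s n ≤ s₁ := fun n => by
    have : (s₁ - a) / ((n : ℝ) + 1) ≤ s₁ - a := div_le_self hpos.le (by simp)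
    simp only [hs]; linarith
  have h0 : s 0 = s₁ := by simp [hs]
  have htend : Tendsto s atTop (𝓝 a) := by
    have := (tendsto_const_div_atTop_nhds_zero_nat (s₁ - a)).comp (tendsto_add_atTop_nat 1)
    simpa [hs, Function.comp_def] using this.const_add a
  refine isFourierL2_expShift_of_tendsto hM (fun n => hκ (s n) (hgt n) ((hle n).trans_lt h4))
    (fun n => hM2 _ (hgt n) (hle n)) htend (fun n => ?_) (Eventually.of_forall fun x => ?_)
  · rw [h0, uIcc_of_le h3.le]
    exact ⟨(hgt n).le, hle n⟩
  · exact (hl x).comp (tendsto_nhdsWithin_iff.2 ⟨htend, Eventually.of_forall hgt⟩)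

theorem plusPart_expShift (s : ℝ) (f : ℝ → ℂ) :
    plusPart (expShift s f) = expShift s (plusPart f) := by
  funext t; simp [plusPart, expShift]

theorem minusPart_expShift (s : ℝ) (f : ℝ → ℂ) :
    minusPart (expShift s f) = expShift s (minusPart f) := by
  funext t; simp [minusPart, expShift]

theorem memLp_plusPart {f : ℝ → ℂ} (hf : MemLp f 2 volume) : MemLp (plusPart f) 2 volume := by
  have : plusPart f = (Ioi 0).indicator f := by
    funext t; simp [plusPart, indicator]
  rw [this]; exact hf.indicator measurableSet_Ioi

theorem memLp_minusPart {f : ℝ → ℂ} (hf : MemLp f 2 volume) : MemLp (minusPart f) 2 volume := by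
  have : minusPart f = -(Iio 0).indicator f := by
    funext t; by_cases h : t < 0 <;> simp [minusPart, indicator, h]
  rw [this]; exact (hf.indicator measurableSet_Iio).neg

/-- For t < 0 the weight e^{-st} increases with s, so any line of the strip above s gives the bound.
The value s = b is excluded, no line of the strip lying above it. -/
theorem IsInverseFourierOnStrip.memLp_minusPart {a b : ℝ} (hab : a < b) {L : ℂ → ℂ} {κ : ℝ → ℂ}
    (hκ : IsInverseFourierOnStrip a b L κ) {s : ℝ} (hs : s < b) :
    MemLp (expShift s (minusPart κ)) 2 volume := by
  obtain ⟨r, h1, h2⟩ := exists_between (max_lt hab hs)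
  have h3 := WienerHopf.memLp_minusPart
    (hκ r ((le_max_left _ _).trans_lt h1) h2).memLp_left
  rw [minusPart_expShift] at h3
  exact memLp_expShift_lower h3 (minusPart_of_pos κ) ((le_max_right _ _).trans h1.le)

/-- Additive decomposition of a function with a Fourier transform in the strip. -/
theorem IsInverseFourierOnStrip.eq_sub {a b : ℝ} (hab : a < b) {L : ℂ → ℂ} {κ : ℝ → ℂ}
    (hd : DifferentiableOn ℂ L (strip a b)) (hκ : IsInverseFourierOnStrip a b L κ)
    (hp : MemLp (expShift a (plusPart κ)) 2 volume) {z : ℂ} (hz : z ∈ strip a b) :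
    L z = fourierIntegralOn univ (plusPart κ) z - fourierIntegralOn univ (minusPart κ) z := by
  obtain ⟨b', hb, hb'⟩ := exists_between hz.2
  have hm := hκ.memLp_minusPart hab hb'
  have h1 := isFourierL2_onLine hp (plusPart_of_neg κ) hz.1
  have h2 := isFourierL2_onLine_lower hm (minusPart_of_pos κ) hb
  have h3 := (h1.sub h2).congr (g := expShift z.im κ) (by
    filter_upwards [plusPart_sub_minusPart_ae κ] with t ht
    have : expShift z.im κ t = (Real.exp (-(z.im * t)) : ℂ) * (plusPart κ - minusPart κ) t := by
      rw [ht]; rfl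
    rw [this]
    simp only [Pi.sub_apply, expShift]
    ring) EventuallyEq.rfl
  have h4 := h3.unique_right (hκ z.im hz.1 hz.2)
  have hc : Continuous (onLine z.im L) := continuous_onLine_of_differentiableOn_strip hd hz.1 hz.2
  have h5 := Continuous.ae_eq_iff_eq volume
    ((bddHolder_onLine hp (plusPart_of_neg κ) hz.1).sub
      (bddHolder_onLine_lower hm (minusPart_of_pos κ) hb)).continuous hc |>.1 h4
  have h6 := congrFun h5 z.re
  simp only [Pi.sub_apply, onLine_re_im] at h6
  exact h6.symm


/-! ### The two factors and their classes -/

theorem eLpNorm_exp_sub_one_le {f : ℝ → ℂ} {B : ℝ} (hB : ∀ x, ‖f x‖ ≤ B) :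
    eLpNorm (fun x => Complex.exp (f x) - 1) 2 volume
      ≤ ENNReal.ofReal (Real.exp B) * eLpNorm f 2 volume :=
  eLpNorm_le_mul_eLpNorm_of_ae_le_mul (Eventually.of_forall fun x => norm_exp_sub_one_le (hB x)) 2

/-- Poisson's formula bounds the exponent by B up to the edge, so |e^P - 1| ≤ e^B |P| transfers the
L² bounds on lines; the boundary values e^Φ - 1 remain Hölder. The Paley–Wiener theorem then
applies. -/
theorem imageUpperClass_exp {a : ℝ} {h Φ : ℝ → ℂ} (h0 : ∀ t < 0, h t = 0)
    (hΦ : IsFourierL2 (expShift a h) Φ) (hH : BddHolder Φ) :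
    ImageUpperClass a fun z => Complex.exp (fourierIntegralOn univ h z) - 1 := by
  obtain ⟨B, hB⟩ := hH.1
  have hPB : ∀ z : ℂ, a < z.im → ‖fourierIntegralOn univ h z‖ ≤ B := fun z hz =>
    norm_fourierIntegral_le_of_boundary h0 hΦ hB hz
  have hB0 : 0 ≤ B := (norm_nonneg _).trans (hB 0)
  have h2 := hΦ.memLp_left
  refine imageUpperClass_of_bounded (Φ := (fun x => Complex.exp (Φ x)) - fun _ => 1)
    (M := ENNReal.ofReal (Real.exp B) * eLpNorm (expShift a h) 2 volume) ?_ ?_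
    (ENNReal.mul_ne_top ENNReal.ofReal_ne_top h2.2.ne) ?_ (hH.exp.sub (bddHolder_const 1)) ?_
  · exact (differentiableOn_fourierIntegral h2 h0).cexp.sub_const 1
  · exact fun s hs => ⟨Real.exp B * B, fun z hz =>
      (norm_exp_sub_one_le (hPB z (hs.trans_le hz))).trans (by gcongr; exact hPB z (hs.trans_le hz))⟩
  · intro s hs
    refine (eLpNorm_exp_sub_one_le (f := onLine s (fourierIntegralOn univ h))
      fun x => hPB _ (by rw [onLine_im]; exact hs)).trans ?_
    gcongr
    rw [(isFourierL2_onLine h2 h0 hs).eLpNorm_eq]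
    exact eLpNorm_expShift_le h0 hs.le
  · intro x
    have h3 : Tendsto (fun s => onLine s (fourierIntegralOn univ h) x) (𝓝[>] a) (𝓝 (Φ x)) := by
      refine tendsto_of_uniform_right fun ε hε => ?_
      obtain ⟨δ, hδ, h4⟩ := fourierIntegral_tendsto_boundary h0 hΦ hH hε
      exact ⟨δ, hδ, fun s h5 h6 => h4 s h5 h6 x⟩
    exact h3.cexp.sub_const 1

/-- Near the edge `Im z = b` the lower factor is controlled by `K` and the upper factor. -/
theorem imageLowerClass_exp {a b : ℝ} (hab : a < b) {K : ℂ → ℂ} {p m Ψ : ℝ → ℂ} {M : ℝ≥0∞}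
    (hM : M ≠ ∞) (hK2 : ∀ s, a < s → s < b → eLpNorm (fun x => onLine s K x - 1) 2 volume ≤ M)
    (hKd : DifferentiableOn ℂ K (strip a b))
    (hΨ : BddHolder Ψ) (hKΨ : ∀ x, Tendsto (fun s => onLine s K x) (𝓝[<] b) (𝓝 (Ψ x)))
    (hp0 : ∀ t < 0, p t = 0) (hp : MemLp (expShift a p) 2 volume)
    (hm0 : ∀ t > 0, m t = 0) (hm : ∀ s < b, MemLp (expShift s m) 2 volume)
    (hexp : ∀ z ∈ strip a b,
      K z = Complex.exp (fourierIntegralOn univ p z - fourierIntegralOn univ m z)) :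
    ImageLowerClass b fun z => Complex.exp (-fourierIntegralOn univ m z) - 1 := by
  set P := fourierIntegralOn univ p
  set N := fourierIntegralOn univ m
  have hNd : ∀ z : ℂ, z.im < b → DifferentiableAt ℂ N z := fun z hz => by
    obtain ⟨r, h1, h2⟩ := exists_between hz
    exact differentiableAt_fourierIntegral_lower (hm r h2) hm0 h1
  have hNB : ∀ s < b, ∃ B, ∀ z : ℂ, z.im ≤ s → ‖-N z‖ ≤ B := fun s hs => by
    obtain ⟨r, h1, h2⟩ := exists_between hs
    simpa only [norm_neg] using exists_norm_fourierIntegral_le_lower (hm r h2) hm0 h1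
  -- The line Im z = c divides the estimates. Below it N is bounded and square integrable on lines;
  -- above it N is not controlled near Im z = b, and e^{-N} = K e^{-P} is used, P being bounded on
  -- Im z ≥ c. `M₁` and `M₂` are the corresponding L² bounds.
  obtain ⟨c, hac, hcb⟩ := exists_between hab
  obtain ⟨B, hB⟩ := exists_norm_fourierIntegral_le hp hp0 hac
  obtain ⟨B', hB'⟩ := hNB c hcb
  have hfac : ∀ z ∈ strip a b, Complex.exp (-N z) = K z * Complex.exp (-P z) := fun z hz => by
    rw [hexp z hz, ← Complex.exp_add]; ring_nf
  set M₁ := ENNReal.ofReal (Real.exp B') * eLpNorm (expShift c m) 2 volume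
  set M₂ := ENNReal.ofReal (Real.exp B) *
    (M + ENNReal.ofReal (Real.exp B) * eLpNorm (expShift a p) 2 volume)
  have hM₁ : M₁ ≠ ∞ := ENNReal.mul_ne_top ENNReal.ofReal_ne_top (hm c hcb).2.ne
  have hM₂ : M₂ ≠ ∞ := ENNReal.mul_ne_top ENNReal.ofReal_ne_top (ENNReal.add_ne_top.2
    ⟨hM, ENNReal.mul_ne_top ENNReal.ofReal_ne_top hp.2.ne⟩)
  refine imageLowerClass_of_bounded
    (Φ := (Ψ * fun x => Complex.exp ((-onLine b P) x)) - fun _ => 1)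
    (M := M₁ + M₂) ?_ ?_ (ENNReal.add_ne_top.2 ⟨hM₁, hM₂⟩) ?_
    ((hΨ.mul (bddHolder_onLine hp hp0 hab).neg.exp).sub (bddHolder_const 1)) ?_
  · exact fun z hz => (((hNd z hz).neg).cexp.sub_const 1).differentiableWithinAt
  · intro s hs
    obtain ⟨C, hC⟩ := hNB s hs
    refine ⟨Real.exp C * C, fun z hz => (norm_exp_sub_one_le (hC z hz)).trans ?_⟩
    gcongr
    exact hC z hz
  · intro s hs
    rcases le_total s c with hsc | hsc
    · refine le_trans ?_ (le_add_right (le_refl M₁))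
      refine (eLpNorm_exp_sub_one_le (f := -onLine s N)
        fun x => hB' _ (by rw [onLine_im]; exact hsc)).trans ?_
      refine mul_le_mul' le_rfl ?_
      rw [eLpNorm_neg]
      have h2s := memLp_expShift_lower (hm c hcb) hm0 hsc
      obtain ⟨r, h1, h2⟩ := exists_between hs
      rw [(isFourierL2_onLine_lower (hm r h2) hm0 h1).eLpNorm_eq]
      exact eLpNorm_mono (norm_expShift_le_lower hm0 hsc)
    · refine le_trans ?_ (le_add_left (le_refl M₂))
      have has : a < s := hac.trans_le hsc
      have hPs : ∀ x, ‖onLine s P x‖ ≤ B := fun x => hB _ (by rw [onLine_im]; exact hsc)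
      have hpt : ∀ x, ‖Complex.exp (-onLine s N x) - 1‖ ≤ Real.exp B *
          ‖((fun x => onLine s K x - 1) - fun x => Complex.exp (onLine s P x) - 1) x‖ := by
        intro x
        have h1 : Complex.exp (-onLine s N x) = onLine s K x * Complex.exp (-onLine s P x) :=
          hfac _ (by simpa [strip] using ⟨has, hs⟩)
        -- Both K - 1 and e^P - 1 have L² bounds up to Im z = b, and the factor e^{-P} is bounded.
        have h2 : Complex.exp (-onLine s N x) - 1 = Complex.exp (-onLine s P x) *
            ((onLine s K x - 1) - (Complex.exp (onLine s P x) - 1)) := by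
          have h3 : Complex.exp (-onLine s P x) * Complex.exp (onLine s P x) = 1 := by
            rw [← Complex.exp_add]; simp
          rw [h1]; linear_combination h3
        rw [h2, norm_mul]
        refine mul_le_mul_of_nonneg_right ?_ (norm_nonneg _)
        exact (Complex.norm_exp_le_exp_norm _).trans
          (Real.exp_le_exp.2 (by rw [norm_neg]; exact hPs x))
      refine (eLpNorm_le_mul_eLpNorm_of_ae_le_mul (Eventually.of_forall hpt) 2).trans ?_
      refine mul_le_mul' le_rfl ?_
      have hPc : Continuous (onLine s P) := (bddHolder_onLine hp hp0 has).continuous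
      have hKc := continuous_onLine_of_differentiableOn_strip hKd has hs
      refine (eLpNorm_sub_le (by fun_prop : Continuous _).aestronglyMeasurable
        (by fun_prop : Continuous _).aestronglyMeasurable (by norm_num)).trans ?_
      gcongr
      · exact hK2 s has hs
      · refine (eLpNorm_exp_sub_one_le hPs).trans ?_
        gcongr
        rw [(isFourierL2_onLine hp hp0 has).eLpNorm_eq]
        exact eLpNorm_expShift_le hp0 has.le
  · intro x
    have hPt : Tendsto (fun s => onLine s P x) (𝓝[<] b) (𝓝 (onLine b P x)) := by
      refine tendsto_onLine_of_continuousWithinAt (S := univ)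
        (hasDerivAt_fourierIntegral hp hp0 ?_).continuousAt.continuousWithinAt (by simp)
      rw [onLine_im]; exact hab
    refine Tendsto.congr' ?_ (((hKΨ x).mul hPt.neg.cexp).sub_const 1)
    filter_upwards [Ioo_mem_nhdsLT hab] with s hs
    have h1 : Complex.exp (-onLine s N x) = onLine s K x * Complex.exp (-onLine s P x) :=
      hfac _ (by simpa [strip] using hs)
    exact congrArg (· - 1) h1.symm

theorem integrableOn_Ioi_of_plusPart {f : ℝ → ℂ} {g : ℝ → ℂ}
    (h : Integrable fun t => plusPart f t * g t) : IntegrableOn (fun t => f t * g t) (Ioi 0) :=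
  h.integrableOn.congr_fun (fun t ht => by simp [plusPart, mem_Ioi.1 ht]) measurableSet_Ioi

theorem integrableOn_Iio_of_minusPart {f : ℝ → ℂ} {g : ℝ → ℂ}
    (h : Integrable fun t => minusPart f t * g t) : IntegrableOn (fun t => f t * g t) (Iio 0) :=
  h.neg.integrableOn.congr_fun (fun t ht => by simp [minusPart, mem_Iio.1 ht]) measurableSet_Iio

/-- The plus part of the inverse transform has a bounded Hölder continuous boundary transform. -/
theorem exists_boundary_plusPart {a b : ℝ} (hab : a < b) {κ Λ : ℝ → ℂ}
    (hκ : IsFourierL2 (expShift a κ) Λ) (hΛ : BddHolder Λ)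
    (hm : ∀ s < b, MemLp (expShift s (minusPart κ)) 2 volume) :
    ∃ Φ, BddHolder Φ ∧ IsFourierL2 (expShift a (plusPart κ)) Φ := by
  obtain ⟨r, h1, h2⟩ := exists_between hab
  -- By the sign convention the plus part is κ plus `minusPart κ`. The line Im z = a is interior to
  -- the half-plane of the latter, whose transform is therefore bounded and Lipschitz there.
  refine ⟨Λ + onLine a (fourierIntegralOn univ (minusPart κ)),
    hΛ.add (bddHolder_onLine_lower (hm r h2) (minusPart_of_pos κ) h1), ?_⟩
  refine (hκ.add (isFourierL2_onLine_lower (hm r h2) (minusPart_of_pos κ) h1)).congr ?_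
    EventuallyEq.rfl
  filter_upwards [plusPart_sub_minusPart_ae κ] with t ht
  simp only [Pi.sub_apply] at ht
  simp only [Pi.add_apply, expShift, ← ht]
  ring

theorem isFactorisation_factor {a b : ℝ} (hab : a < b) {K L : ℂ → ℂ} {κ : ℝ → ℂ}
    (hcont : ContinuousOn K {z : ℂ | a ≤ z.im ∧ z.im < b})
    (hK : ImageStripClass a b fun z => K z - 1) (hL : IsLog a b K L)
    (hΛ : BddHolder (onLine a L)) (hκ : IsInverseFourierOnStrip a b L κ)
    (hκa : IsFourierL2 (expShift a κ) (onLine a L)) :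
    IsFactorisation a b K (factorPlus κ) (factorMinus κ) := by
  obtain ⟨hKd, -, ⟨M, hM, hK2⟩, -, Ψ, hΨ, hKΨ⟩ := strip_properties hab hcont hK
  have hm : ∀ s < b, MemLp (expShift s (minusPart κ)) 2 volume := fun s hs =>
    hκ.memLp_minusPart hab hs
  obtain ⟨Φ, hΦ, hΦ2⟩ := exists_boundary_plusPart hab hκa hΛ hm
  have hp := hΦ2.memLp_left
  have hp0 := plusPart_of_neg κ
  have hm0 := minusPart_of_pos κ
  have hfp : factorPlus κ = fun z => Complex.exp (fourierIntegralOn univ (plusPart κ) z) :=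
    funext fun z => by rw [factorPlus, fourierIntegralOn_Ioi]
  have hfm : factorMinus κ = fun z => Complex.exp (-fourierIntegralOn univ (minusPart κ) z) :=
    funext fun z => by rw [factorMinus, fourierIntegralOn_Iio]
  have hexp : ∀ z ∈ strip a b, K z = Complex.exp (fourierIntegralOn univ (plusPart κ) z
      - fourierIntegralOn univ (minusPart κ) z) := fun z hz => by
    rw [← hκ.eq_sub hab hL.analytic hp hz, hL.exp_eq z hz]
  rw [hfp, hfm]
  refine ⟨(differentiableOn_fourierIntegral hp hp0).cexp, fun z hz => ?_,
    imageUpperClass_exp hp0 hΦ2 hΦ,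
    imageLowerClass_exp hab hM hK2 hKd hΨ hKΨ hp0 hp hm0 hm hexp, fun z hz => ?_⟩
  · obtain ⟨r, h1, h2⟩ := exists_between (show z.im < b from hz)
    exact (differentiableAt_fourierIntegral_lower (hm r h2) hm0 h1).neg.cexp.differentiableWithinAt
  · rw [hexp z hz, sub_eq_add_neg, Complex.exp_add]

end WienerHopf

end

theorem mainTheorem4 (a b : ℝ) (hab : a < b) (K : ℂ → ℂ)
    (hcont : ContinuousOn K {z : ℂ | a ≤ z.im ∧ z.im < b})
    (hne : ∀ z ∈ WienerHopf.strip a b, K z ≠ 0)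
    (hK : WienerHopf.ImageStripClass a b fun z => K z - 1)
    (hind : WienerHopf.HasIndex (WienerHopf.onLine a K) 0) :
    (∃ (L : ℂ → ℂ) (κ : ℝ → ℂ),
      WienerHopf.IsLog a b K L ∧ WienerHopf.IsInverseFourierOnStrip a b L κ) ∧
    ∀ (L : ℂ → ℂ) (κ : ℝ → ℂ),
      WienerHopf.IsLog a b K L → WienerHopf.IsInverseFourierOnStrip a b L κ →
      (∀ z ∈ WienerHopf.upper a, MeasureTheory.IntegrableOn
        (fun t : ℝ => κ t * Complex.exp (Complex.I * z * t)) (Set.Ioi 0)) ∧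
      (∀ z ∈ WienerHopf.lower b, MeasureTheory.IntegrableOn
        (fun t : ℝ => κ t * Complex.exp (Complex.I * z * t)) (Set.Iio 0)) ∧
      WienerHopf.IsFactorisation a b K (WienerHopf.factorPlus κ) (WienerHopf.factorMinus κ) ∧
      ∀ Pp Pm : ℂ → ℂ, WienerHopf.IsFactorisation a b K Pp Pm →
        (∀ z ∈ WienerHopf.upper a, Pp z ≠ 0) → (∀ z ∈ WienerHopf.lower b, Pm z ≠ 0) →
        Set.EqOn Pp (WienerHopf.factorPlus κ) (WienerHopf.upper a) ∧
        Set.EqOn Pm (WienerHopf.factorMinus κ) (WienerHopf.lower b) := by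
  obtain ⟨L₀, hL₀, hB, h2, hΛ, hl⟩ := WienerHopf.exists_isLog_bounded hab hcont hne hK hind
  obtain ⟨κ₀, hκ₀⟩ := WienerHopf.exists_isInverseFourierOnStrip hab hL₀.analytic hB h2
  refine ⟨⟨L₀, κ₀, hL₀, hκ₀⟩, fun L κ hL hκ => ?_⟩
  -- The given L is determined only on the open strip and its values on Im z = a are arbitrary. It
  -- is exchanged for `L₀`, which is continuous up to that edge, while κ is kept.
  have hκ' : WienerHopf.IsInverseFourierOnStrip a b L₀ κ := fun s h3 h4 => by
    have h5 : WienerHopf.onLine s L = WienerHopf.onLine s L₀ := funext fun x =>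
      hL.unique hab hL₀ (by simpa [WienerHopf.strip] using ⟨h3, h4⟩)
    exact h5 ▸ hκ s h3 h4
  have hκa := WienerHopf.isFourierL2_expShift_left_edge hab h2 hl hκ'
  have hp : MeasureTheory.MemLp (WienerHopf.expShift a (WienerHopf.plusPart κ)) 2 MeasureTheory.volume := by
    rw [← WienerHopf.plusPart_expShift]
    exact WienerHopf.memLp_plusPart hκa.memLp_left
  have hfac := WienerHopf.isFactorisation_factor hab hcont hK hL₀ hΛ hκ' hκa
  refine ⟨fun z hz => ?_, fun z hz => ?_, hfac, fun Pp Pm hP hPp hPm => ?_⟩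
  · exact WienerHopf.integrableOn_Ioi_of_plusPart
      (WienerHopf.integrable_mul_cexp hp (WienerHopf.plusPart_of_neg κ) hz)
  -- Square integrability of the weighted negative part is known for weights below b only, so a line
  -- between Im z and b is used.
  · obtain ⟨r, h3, h4⟩ := exists_between (show z.im < b from hz)
    exact WienerHopf.integrableOn_Iio_of_minusPart (WienerHopf.integrable_mul_cexp_lower
      (hκ.memLp_minusPart hab h4) (WienerHopf.minusPart_of_pos κ) h3)
  · exact hP.unique hab hfac hPp hPm (fun z _ => Complex.exp_ne_zero _)
      (fun z _ => Complex.exp_ne_zero _)
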